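/- **Theorem 1.1.** For $p,q>1$ and $n\in\mathbb N$ put $$F(p,q,n)=\max\left\{\frac{q+2+p^{-1}}{pq-1},\ \frac{p+2+q^{-1}}{pq-1}\right\}-\frac{n-1}{2}.$$ Let $n\ge 4$, $1<p\le q$ and $F(p,q,n)=0$. Let $R>0$, $f_1\in H^1(\mathbb R^n)\cap L^q(\mathbb R^n)$, $f_2\in H^1(\mathbb R^n)$ and $g_1,g_2\in L^2(\mathbb R^n)$ be real-valued and non-negative, all vanishing for $|x|>R$, and suppose that neither $g_1$ nor $g_2$ vanishes identically (pointwise statements are understood almost everywhere). Then there are constants $\varepsilon_0>0$ and $C>0$, depending only on $f_1,f_2,g_1,g_2,p,q,n,R$ (in particular $C$ is independent of $\varepsilon$), such that the following holds for every $0<\varepsilon\le\varepsilon_0$. Let $0<T(\varepsilon)\le\infty$ be such that the problem $$u_{tt}-\Delta u=|v|^p,\qquad v_{tt}-\Delta v=|u|^q\qquad\text{in }\mathbb R^n\times[0,T(\varepsilon)),$$ $$(u,u_t)|_{t=0}=(\varepsilon f_1,\varepsilon g_1),\qquad (v,v_t)|_{t=0}=(\varepsilon f_2,\varepsilon g_2)$$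 has a real-valued solution with $$u\in C([0,T(\varepsilon));H^1(\mathbb R^n)\cap L^q(\mathbb R^n)),\quad v\in C([0,T(\varepsilon));H^1(\mathbb R^n)),\quad u_t,v_t\in C([0,T(\varepsilon));L^2(\mathbb R^n)),$$ $$\operatorname{supp}(u,v,u_t,v_t)\subset\{(x,t)\in\mathbb R^n\times[0,T(\varepsilon)):\ |x|\le t+R\},$$ where an equation $w_{tt}-\Delta w=N$ is understood in the weak sense: for all $\varphi\in C_0^\infty(\mathbb R^n\times\mathbb R)$ and all $t\in[0,T(\varepsilon))$, $$\int_{\mathbb R^n}w_t(x,t)\varphi(x,t)\,dx-\int_{\mathbb R^n}w_t(x,0)\varphi(x,0)\,dx=\int_0^t\!\!\int_{\mathbb R^n}\bigl(w_t\varphi_t-\nabla w\cdot\nabla\varphi+N\varphi\bigr)\,dx\,ds.$$ Then $$T(\varepsilon)\le\begin{cases}\exp\bigl(C\varepsilon^{-p(pq-1)}\bigr)&\text{if }p\ne q,\\[2pt]\exp\bigl(C\varepsilon^{-p(p-1)}\bigr)&\text{if }p=q.\end{cases}$$ In particular $T(\varepsilon)<\infty$. -/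

import Mathlib

open MeasureTheory Set Filter Topology
open scoped ContDiff

noncomputable section

/-- The exponent `F(p,q,n)` whose vanishing is the critical case of the weakly coupled system. -/
def criticalF (p q : ℝ) (n : ℕ) : ℝ :=
  max ((q + 2 + p⁻¹) / (p * q - 1)) ((p + 2 + q⁻¹) / (p * q - 1)) - ((n : ℝ) - 1) / 2

/-- `ℝⁿ` with the Euclidean norm. -/
abbrev Space (n : ℕ) : Type := EuclideanSpace ℝ (Fin n)

/-- `L²(ℝⁿ)`. -/
abbrev L2 (n : ℕ) : Type := Lp ℝ 2 (volume : Measure (Space n))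

/-- `L²(ℝⁿ; ℝⁿ)`. -/
abbrev L2Vec (n : ℕ) : Type := Lp (Space n) 2 (volume : Measure (Space n))

/-- `G` is the gradient of `f` in the sense of distributions. -/
def HasWeakGradient {n : ℕ} (f : Space n → ℝ) (G : Space n → Space n) : Prop :=
  ∀ φ : Space n → ℝ, ContDiff ℝ ∞ φ → HasCompactSupport φ →
    ∫ x, f x • gradient φ x = - ∫ x, φ x • G x

/-- The Sobolev space `H¹(ℝⁿ)`: an element is a function in `L²` together with its (unique) weak
gradient in `L²`; the topology is that of convergence in `L²` of functions and of gradients. -/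
abbrev H1 (n : ℕ) : Type :=
  {w : L2 n × L2Vec n // HasWeakGradient (w.1 : Space n → ℝ) (w.2 : Space n → Space n)}

/-- The underlying `L²` function of an element of `H¹(ℝⁿ)`. -/
def H1.fn {n : ℕ} (w : H1 n) : L2 n := w.1.1

/-- The weak gradient of an element of `H¹(ℝⁿ)`. -/
def H1.grad {n : ℕ} (w : H1 n) : L2Vec n := w.1.2

/-- The time interval `[0,T)`, where `T = ∞` is allowed. -/
def timeInterval (T : EReal) : Set ℝ := {t : ℝ | 0 ≤ t ∧ (t : EReal) < T}

/-- `u ∈ C(I; L^r(ℝⁿ))`. -/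
def ContinuousIntoLr {n : ℕ} (r : ℝ) (I : Set ℝ) (u : ℝ → Space n → ℝ) : Prop :=
  ∀ t ∈ I, MemLp (u t) (ENNReal.ofReal r) volume ∧
    Tendsto (fun s => eLpNorm (u s - u t) (ENNReal.ofReal r) volume) (𝓝[I] t) (𝓝 0)

/-- The weak (energy) form of `u_tt - Δu = N` on `ℝⁿ × I`: for all test functions
`φ ∈ C_c^∞(ℝ × ℝⁿ)` and all `t ∈ I`,
`∫ u_t φ dx |_{s=t} - ∫ u_t φ dx |_{s=0} = ∫_0^t ∫ (u_t φ_t - ∇u · ∇φ + N φ) dx ds`. -/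
def IsWeakWave {n : ℕ} (I : Set ℝ) (u : ℝ → H1 n) (ut : ℝ → L2 n)
    (N : ℝ → Space n → ℝ) : Prop :=
  ∀ φ : ℝ × Space n → ℝ, ContDiff ℝ ∞ φ → HasCompactSupport φ → ∀ t ∈ I,
    (∫ x, ut t x * φ (t, x)) - (∫ x, ut 0 x * φ (0, x)) =
      ∫ s in (0 : ℝ)..t, ∫ x,
        (ut s x * deriv (fun τ => φ (τ, x)) s
          - inner ℝ ((u s).grad x) (gradient (fun y => φ (s, y)) x)
          + N s x * φ (s, x))

/-- `w = 0` almost everywhere in `{|x| > r}`. -/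
def VanishesOutside {n : ℕ} (r : ℝ) (w : L2 n) : Prop :=
  ∀ᵐ x ∂(volume : Measure (Space n)), r < ‖x‖ → w x = 0

/-- `(u,v)`, with time derivatives `(ut,vt)`, is an energy solution on `ℝⁿ × [0,T)` of
`u_tt - Δu = |v|^p`, `v_tt - Δv = |u|^q` with initial data
`u = ε f₁`, `u_t = ε g₁`, `v = ε f₂`, `v_t = ε g₂`, in the class
`(u,v) ∈ C([0,T); (H¹ ∩ L^q) × H¹)`, `(u_t,v_t) ∈ C([0,T); L² × L²)`,
supported in `{|x| ≤ t + R}`. -/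
structure IsEnergySolution {n : ℕ} (p q R ε : ℝ) (f₁ f₂ : H1 n) (g₁ g₂ : L2 n) (T : EReal)
    (u v : ℝ → H1 n) (ut vt : ℝ → L2 n) : Prop where
  u_cont : ContinuousOn u (timeInterval T)
  u_cont_Lq : ContinuousIntoLr q (timeInterval T) (fun t => ((u t).fn : Space n → ℝ))
  v_cont : ContinuousOn v (timeInterval T)
  ut_cont : ContinuousOn ut (timeInterval T)
  vt_cont : ContinuousOn vt (timeInterval T)
  u_deriv : ∀ t ∈ timeInterval T,
    HasDerivWithinAt (fun s => (u s).fn) (ut t) (timeInterval T) t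
  v_deriv : ∀ t ∈ timeInterval T,
    HasDerivWithinAt (fun s => (v s).fn) (vt t) (timeInterval T) t
  u_init : (u 0).fn = ε • f₁.fn
  ut_init : ut 0 = ε • g₁
  v_init : (v 0).fn = ε • f₂.fn
  vt_init : vt 0 = ε • g₂
  u_eq : IsWeakWave (timeInterval T) u ut (fun s x => |(v s).fn x| ^ p)
  v_eq : IsWeakWave (timeInterval T) v vt (fun s x => |(u s).fn x| ^ q)
  support : ∀ t ∈ timeInterval T,
    VanishesOutside (t + R) (u t).fn ∧ VanishesOutside (t + R) (v t).fn ∧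
      VanishesOutside (t + R) (ut t) ∧ VanishesOutside (t + R) (vt t)

end

/-!
The proof is a test function argument with self-similar test functions. Averaging
`(t + R + 1 + ⟪x, ω⟫) ^ (-β)` over directions `ω` gives positive solutions of the wave equation
(`planeAvg`, `testWave`); inside the cone `|x| ≤ t + R` their size, and that of their time
derivative, is controlled by estimating the spherical cap on which the phase `t + R + 1 + ⟪x, ω⟫`
is small (`lintegral_phase_rpow_le`). The weak equation is tested with such a solution times a
cutoff `ζ (t / ρ)`, so that the wave operator only falls on `ζ` and every term with `w` lives on
`ρ / 2 ≤ t ≤ ρ` (`test_identity`). Hölder's inequality then compares the nonlinear term on the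
scale `ρ` with the space-time integral of `|w| ^ r` near `t = ρ` (`scale_inequality`).

Three choices are made. The exponent `β = m / 2 - 1 / p` with `m = n - 1` is the one at which the
Hölder weight is just not integrable, and gives a logarithm of `ρ` (`growth_log`); a larger exponent
only uses the initial velocity and gives a lower bound in terms of `ε` (`growth_data`); the constant
solution, `β = 0`, compares the two nonlinear terms (`growth_const`). Criticality is exactly the
cancellation of all powers of `ρ` when these are combined: for `p ≠ q` the second equation is fed
into the first, for `p = q` the two equations are added. What remains is a weighted integral
`W (ρ)` of the nonlinear term with `ρ W' ≥ c ε ^ a` and `ρ W' ≥ c W ^ K (log ρ) ^ (-μ)`. As a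
function of `log ρ` it blows up by the time a constant times `ε ^ (-a (K - 1) / (K - μ))`
(`lifespan_of_growth`), where `K = a = p q`, `μ = q (p - 1)` if `p ≠ q`, and `K = a = p`,
`μ = p - 1` if `p = q`. In dimension at least four criticality forces `p ≤ 2`, so that `|v| ^ p`
is integrable in space without any assumption on `v` beyond `L²` and compact support.
-/

/-! ### Directional derivatives on space-time and the wave operator -/

/-- The derivative of `φ` in the direction `e`. -/
noncomputable def dirDeriv {E : Type*} [NormedAddCommGroup E] [NormedSpace ℝ E] (e : E)
    (φ : E → ℝ) : E → ℝ := fun z => fderiv ℝ φ z e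

section dirDeriv
variable {E : Type*} [NormedAddCommGroup E] [NormedSpace ℝ E]

lemma ContDiff.dirDeriv {φ : E → ℝ} (h : ContDiff ℝ ∞ φ) (e : E) :
    ContDiff ℝ ∞ (dirDeriv e φ) :=
  (h.fderiv_right (m := ∞) (by simp)).clm_apply contDiff_const

lemma HasCompactSupport.dirDeriv {φ : E → ℝ} (h : HasCompactSupport φ) (e : E) :
    HasCompactSupport (dirDeriv e φ) := h.fderiv_apply (𝕜 := ℝ) e

lemma dirDeriv_eventuallyEq {φ ψ : E → ℝ} {z : E} (h : φ =ᶠ[𝓝 z] ψ) (e : E) :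
    dirDeriv e φ =ᶠ[𝓝 z] dirDeriv e ψ :=
  (h.fderiv (𝕜 := ℝ)).mono fun x hx => by simp [_root_.dirDeriv, hx]

lemma dirDeriv_mul {φ ψ : E → ℝ} (hφ : Differentiable ℝ φ) (hψ : Differentiable ℝ ψ) (e : E) :
    dirDeriv e (fun z => φ z * ψ z) = fun z => dirDeriv e φ z * ψ z + φ z * dirDeriv e ψ z := by
  funext z
  simp [_root_.dirDeriv, fderiv_fun_mul (hφ z) (hψ z)]
  ring

lemma dirDeriv_add {φ ψ : E → ℝ} (hφ : Differentiable ℝ φ) (hψ : Differentiable ℝ ψ) (e : E) :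
    dirDeriv e (fun z => φ z + ψ z) = fun z => dirDeriv e φ z + dirDeriv e ψ z := by
  funext z
  simp [_root_.dirDeriv, fderiv_fun_add (hφ z) (hψ z)]

end dirDeriv

section spacetime
variable {n : ℕ}

/-- The time derivative of a function on space-time. -/
noncomputable abbrev timeDeriv (φ : ℝ × Space n → ℝ) : ℝ × Space n → ℝ := dirDeriv (1, 0) φ

/-- The `i`-th spatial derivative of a function on space-time. -/
noncomputable abbrev spaceDeriv (i : Fin n) (φ : ℝ × Space n → ℝ) : ℝ × Space n → ℝ :=
  dirDeriv (0, EuclideanSpace.single i 1) φ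

/-- The spatial Laplacian of a function on space-time. -/
noncomputable def spaceLaplacian (φ : ℝ × Space n → ℝ) : ℝ × Space n → ℝ :=
  fun z => ∑ i, spaceDeriv i (spaceDeriv i φ) z

/-- The wave operator `∂ₜ² - Δ`. -/
noncomputable def waveOp (φ : ℝ × Space n → ℝ) : ℝ × Space n → ℝ :=
  fun z => timeDeriv (timeDeriv φ) z - spaceLaplacian φ z

lemma hasDerivAt_time {φ : ℝ × Space n → ℝ} (h : Differentiable ℝ φ) (s : ℝ) (x : Space n) :
    HasDerivAt (fun τ => φ (τ, x)) (timeDeriv φ (s, x)) s :=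
  (h (s, x)).hasFDerivAt.comp_hasDerivAt s ((hasDerivAt_id s).prodMk (hasDerivAt_const s x))

lemma gradient_slice_apply {φ : ℝ × Space n → ℝ} (h : Differentiable ℝ φ) (s : ℝ) (x : Space n)
    (i : Fin n) : gradient (fun y => φ (s, y)) x i = spaceDeriv i φ (s, x) := by
  have h1 : HasFDerivAt (fun y => φ (s, y))
      ((fderiv ℝ φ (s, x)).comp (ContinuousLinearMap.inr ℝ ℝ (Space n))) x :=
    (h (s, x)).hasFDerivAt.comp x (hasFDerivAt_prodMk_right s x)
  have h2 : inner ℝ (gradient (fun y => φ (s, y)) x) (EuclideanSpace.single i (1 : ℝ))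
      = fderiv ℝ (fun y => φ (s, y)) x (EuclideanSpace.single i 1) := by
    rw [gradient, InnerProductSpace.toDual_symm_apply]
  rw [h1.fderiv, EuclideanSpace.inner_single_right] at h2
  simpa [dirDeriv] using h2

lemma continuous_slice {φ : ℝ × Space n → ℝ} (h : Continuous φ) (s : ℝ) :
    Continuous fun x => φ (s, x) := h.comp (Continuous.prodMk_right s)

lemma hasCompactSupport_slice {φ : ℝ × Space n → ℝ} (h : HasCompactSupport φ) (s : ℝ) :
    HasCompactSupport fun x => φ (s, x) := by
  apply HasCompactSupport.intro (h.image continuous_snd)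
  intro x hx
  by_contra hne
  exact hx ⟨(s, x), subset_tsupport _ hne, rfl⟩

lemma contDiff_slice {φ : ℝ × Space n → ℝ} (h : ContDiff ℝ ∞ φ) (s : ℝ) :
    ContDiff ℝ ∞ fun x => φ (s, x) := h.comp (contDiff_const.prodMk contDiff_id)

/-- Spatial integration by parts against a compactly supported test function. -/
lemma integral_inner_gradient {f : Space n → ℝ} {G : Space n → Space n}
    (hf : MemLp f 2 volume) (hG : MemLp G 2 volume) (hfG : HasWeakGradient f G)
    {φ : ℝ × Space n → ℝ} (hφ : ContDiff ℝ ∞ φ) (hc : HasCompactSupport φ) (s : ℝ) :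
    ∫ x, inner ℝ (G x) (gradient (fun y => φ (s, y)) x)
      = - ∫ x, f x * spaceLaplacian φ (s, x) := by
  have hfl := hf.locallyIntegrable (by norm_num)
  have hGl := hG.locallyIntegrable (by norm_num)
  have hd : Differentiable ℝ φ := hφ.differentiable (by simp)
  have hd' (i : Fin n) : Differentiable ℝ (spaceDeriv i φ) :=
    (hφ.dirDeriv _).differentiable (by simp)
  have hGint (i : Fin n) : Integrable (fun x => spaceDeriv i φ (s, x) • G x) :=
    hGl.integrable_smul_left_of_hasCompactSupport
      (continuous_slice (hφ.dirDeriv _).continuous s) (hasCompactSupport_slice (hc.dirDeriv _) s)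
  have hfint (i : Fin n) : Integrable (fun x => f x * spaceDeriv i (spaceDeriv i φ) (s, x)) := by
    simpa [mul_comm] using hfl.integrable_smul_left_of_hasCompactSupport
      (continuous_slice ((hφ.dirDeriv _).dirDeriv _).continuous s)
      (hasCompactSupport_slice ((hc.dirDeriv _).dirDeriv _) s)
  have hcomp (i : Fin n) : ∫ x, f x * spaceDeriv i (spaceDeriv i φ) (s, x)
      = - ∫ x, spaceDeriv i φ (s, x) * G x i := by
    have h := hfG (fun x => spaceDeriv i φ (s, x)) (contDiff_slice (hφ.dirDeriv _) s)
      (hasCompactSupport_slice (hc.dirDeriv _) s)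
    have hint : Integrable (fun x => f x • gradient (fun y => spaceDeriv i φ (s, y)) x) := by
      have hgc : Continuous (gradient (fun y => spaceDeriv i φ (s, y))) := by
        unfold gradient
        exact (LinearIsometryEquiv.continuous _).comp
          ((contDiff_slice (hφ.dirDeriv _) s).continuous_fderiv (by simp))
      have hgs : HasCompactSupport (gradient (fun y => spaceDeriv i φ (s, y))) := by
        unfold gradient
        exact ((hasCompactSupport_slice (hc.dirDeriv _) s).fderiv (𝕜 := ℝ)).comp_left (by simp)
      exact hfl.integrable_smul_right_of_hasCompactSupport hgc hgs
    have h3 := congrArg (EuclideanSpace.proj (𝕜 := ℝ) i) h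
    rw [← ContinuousLinearMap.integral_comp_comm _ hint, map_neg,
      ← ContinuousLinearMap.integral_comp_comm _ (hGint i)] at h3
    simpa [gradient_slice_apply (hd' i)] using h3
  have hprod (x : Space n) : inner ℝ (G x) (gradient (fun y => φ (s, y)) x)
      = ∑ i, spaceDeriv i φ (s, x) * G x i := by
    rw [PiLp.inner_apply]
    simp [gradient_slice_apply hd]
  simp_rw [hprod, spaceLaplacian, Finset.mul_sum]
  rw [integral_finsetSum _ fun i _ => ?_, integral_finsetSum _ fun i _ => hfint i]
  · simp [hcomp]
  · simpa using (EuclideanSpace.proj (𝕜 := ℝ) i).integrable_comp (hGint i)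

/-! ### Test functions as curves in `L²` -/

lemma memLp_slice {φ : ℝ × Space n → ℝ} (h : Continuous φ) (hc : HasCompactSupport φ) (s : ℝ) :
    MemLp (fun x => φ (s, x)) 2 volume :=
  (continuous_slice h s).memLp_of_hasCompactSupport (hasCompactSupport_slice hc s)

open Classical in
/-- The time slice `φ(s, ·)` as an element of `L²`; zero if `φ(s, ·)` is not in `L²`. -/
noncomputable def slice (φ : ℝ × Space n → ℝ) (s : ℝ) : L2 n :=
  if h : MemLp (fun x => φ (s, x)) 2 volume then h.toLp else 0

lemma coeFn_slice {φ : ℝ × Space n → ℝ} (h : Continuous φ) (hc : HasCompactSupport φ) (s : ℝ) :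
    slice φ s =ᵐ[volume] fun x => φ (s, x) := by
  rw [slice, dif_pos (memLp_slice h hc s)]
  exact MemLp.coeFn_toLp _

lemma inner_slice {φ : ℝ × Space n → ℝ} (h : Continuous φ) (hc : HasCompactSupport φ) (s : ℝ)
    (f : L2 n) : inner ℝ f (slice φ s) = ∫ x, f x * φ (s, x) := by
  rw [L2.inner_def]
  refine integral_congr_ae ?_
  filter_upwards [coeFn_slice h hc s] with x hx
  simp [hx, mul_comm]

/-- An `L²` function supported in a fixed set of finite measure is small if it is uniformly
small. -/
lemma norm_le_of_bound_on {K : Set (Space n)} (hK : MeasurableSet K) (hKf : volume K ≠ ⊤)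
    (f : L2 n) {c : ℝ} (hc : 0 ≤ c) (h : ∀ᵐ x, ‖f x‖ ≤ K.indicator (fun _ => c) x) :
    ‖f‖ ≤ c * (volume K).toReal ^ (2⁻¹ : ℝ) := by
  rw [Lp.norm_def]
  have h1 : eLpNorm f 2 volume ≤ ENNReal.ofReal c * volume K ^ (2⁻¹ : ℝ) := by
    refine (eLpNorm_mono_ae_real h).trans ?_
    rw [eLpNorm_indicator_const hK (by norm_num) (by norm_num)]
    simp [Real.enorm_eq_ofReal hc]
  refine (ENNReal.toReal_mono (by finiteness) h1).trans (le_of_eq ?_)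
  simp [ENNReal.toReal_mul, hc, ENNReal.toReal_rpow]

lemma slice_hasDerivAt {φ : ℝ × Space n → ℝ} (h : ContDiff ℝ ∞ φ) (hc : HasCompactSupport φ)
    (s : ℝ) : HasDerivAt (slice φ) (slice (timeDeriv φ) s) s := by
  have hd : Differentiable ℝ φ := h.differentiable (by simp)
  have h1 := h.dirDeriv (1, 0)
  have hc1 := hc.dirDeriv (1, 0)
  have h2 := h1.dirDeriv (1, 0)
  have hc2 := hc1.dirDeriv (1, 0)
  have hd1 : Differentiable ℝ (timeDeriv φ) := h1.differentiable (by simp)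
  obtain ⟨M, hM⟩ := h2.continuous.bounded_above_of_compact_support hc2
  have hM0 : 0 ≤ M := (norm_nonneg _).trans (hM (0, 0))
  set K : Set (Space n) := Prod.snd '' tsupport φ with hKdef
  have hKc : IsCompact K := hc.image continuous_snd
  have hz : ∀ x ∉ K, ∀ t, φ (t, x) = 0 := fun x hx t => by
    by_contra hne
    exact hx ⟨(t, x), subset_tsupport _ hne, rfl⟩
  have hz1 : ∀ x ∉ K, ∀ t, timeDeriv φ (t, x) = 0 := fun x hx t => by
    rw [← (hasDerivAt_time hd t x).deriv]
    simp [hz x hx]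
  have hlip (x : Space n) (a b : ℝ) : ‖timeDeriv φ (b, x) - timeDeriv φ (a, x)‖ ≤ M * ‖b - a‖ :=
    Convex.norm_image_sub_le_of_norm_hasDerivWithin_le (s := univ)
      (fun t _ => (hasDerivAt_time hd1 t x).hasDerivWithinAt) (fun t _ => hM _) convex_univ
      (mem_univ _) (mem_univ _)
  have htay (x : Space n) (t : ℝ) :
      ‖φ (t, x) - φ (s, x) - (t - s) * timeDeriv φ (s, x)‖ ≤ M * ‖t - s‖ * ‖t - s‖ := by
    have := Convex.norm_image_sub_le_of_norm_hasDerivWithin_le (s := uIcc s t)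
      (f := fun τ => φ (τ, x) - τ * timeDeriv φ (s, x))
      (f' := fun τ => timeDeriv φ (τ, x) - 1 * timeDeriv φ (s, x)) (C := M * ‖t - s‖)
      (fun τ _ => ((hasDerivAt_time hd τ x).sub
        ((hasDerivAt_id τ).mul_const _)).hasDerivWithinAt)
      (fun τ hτ => by
        rw [one_mul]
        refine (hlip x s τ).trans (mul_le_mul_of_nonneg_left ?_ hM0)
        simpa [Real.norm_eq_abs] using abs_sub_left_of_mem_uIcc hτ)
      (convex_uIcc s t) left_mem_uIcc right_mem_uIcc
    refine le_of_eq_of_le ?_ this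
    congr 1
    ring
  rw [hasDerivAt_iff_isLittleO]
  have hb : ∀ t, ‖slice φ t - slice φ s - (t - s) • slice (timeDeriv φ) s‖
      ≤ M * ‖t - s‖ * ‖t - s‖ * (volume K).toReal ^ (2⁻¹ : ℝ) := by
    intro t
    refine norm_le_of_bound_on hKc.isClosed.measurableSet hKc.measure_ne_top _ (by positivity) ?_
    filter_upwards [coeFn_slice h.continuous hc t, coeFn_slice h.continuous hc s,
      coeFn_slice h1.continuous hc1 s, Lp.coeFn_sub (slice φ t) (slice φ s),
      Lp.coeFn_sub (slice φ t - slice φ s) ((t - s) • slice (timeDeriv φ) s),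
      Lp.coeFn_smul (t - s) (slice (timeDeriv φ) s)] with x e1 e2 e3 e4 e5 e6
    rw [e5, Pi.sub_apply, e4, e6, Pi.sub_apply, Pi.smul_apply, e1, e2, e3, smul_eq_mul]
    by_cases hx : x ∈ K
    · simpa [hx] using htay x t
    · simp [hz x hx, hz1 x hx, hx]
  refine Asymptotics.IsBigO.trans_isLittleO (g := fun t => (t - s) ^ 2) ?_ ?_
  · refine Asymptotics.IsBigO.of_bound (M * (volume K).toReal ^ (2⁻¹ : ℝ))
      (Eventually.of_forall fun t => (hb t).trans (le_of_eq ?_))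
    rw [norm_pow]
    ring
  · have : (fun t : ℝ => t - s) =o[𝓝 s] fun _ => (1 : ℝ) := by
      rw [Asymptotics.isLittleO_one_iff]
      exact (continuous_id.sub continuous_const).tendsto' s _ (sub_self s)
    simpa [pow_two] using (this.mul_isBigO (Asymptotics.isBigO_refl (fun t : ℝ => t - s) (𝓝 s)))

end spacetime

/-! ### Continuity in time of the nonlinear terms -/

section continuity
variable {n : ℕ}

lemma continuousOn_integral_rpow {r : ℝ} (hr : 1 ≤ r) {I : Set ℝ} {F : ℝ → Space n → ℝ}
    (h : ContinuousIntoLr r I F) : ContinuousOn (fun s => ∫ x, |F s x| ^ r) I := by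
  have hr1 : (1 : ENNReal) ≤ ENNReal.ofReal r := by simpa using ENNReal.ofReal_le_ofReal hr
  have hr0 : 0 < r := by linarith
  have hN : ContinuousOn (fun s => (eLpNorm (F s) (ENNReal.ofReal r) volume).toReal) I := by
    intro t ht
    have h1 := (ENNReal.tendsto_toReal (by simp)).comp (h t ht).2
    rw [ContinuousWithinAt, tendsto_iff_norm_sub_tendsto_zero]
    refine squeeze_zero' (Eventually.of_forall fun _ => norm_nonneg _) ?_ h1
    filter_upwards [self_mem_nhdsWithin] with s hs
    have ms := (h s hs).1
    have mt := (h t ht).1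
    have fs := ms.eLpNorm_ne_top
    have ft := mt.eLpNorm_ne_top
    have fd := (ms.sub mt).eLpNorm_ne_top
    have a1 : eLpNorm (F s) (ENNReal.ofReal r) volume ≤
        eLpNorm (F s - F t) (ENNReal.ofReal r) volume +
          eLpNorm (F t) (ENNReal.ofReal r) volume := by
      simpa using eLpNorm_add_le (ms.sub mt).1 mt.1 hr1
    have a2 : eLpNorm (F t) (ENNReal.ofReal r) volume ≤
        eLpNorm (F s - F t) (ENNReal.ofReal r) volume +
          eLpNorm (F s) (ENNReal.ofReal r) volume := by
      rw [← eLpNorm_sub_comm]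
      simpa using eLpNorm_add_le (mt.sub ms).1 ms.1 hr1
    have b1 := ENNReal.toReal_mono (by finiteness) a1
    have b2 := ENNReal.toReal_mono (by finiteness) a2
    rw [ENNReal.toReal_add fd ft] at b1
    rw [ENNReal.toReal_add fd fs] at b2
    rw [Real.norm_eq_abs, abs_le]
    constructor <;> simp only [Function.comp] <;> linarith
  refine (hN.rpow_const (p := r) fun _ _ => Or.inr hr0.le).congr fun s hs => ?_
  have hm := (h s hs).1
  simp only
  rw [hm.eLpNorm_eq_integral_rpow_norm (by simpa using hr0) (by simp), ENNReal.toReal_ofReal hr0.le,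
    ENNReal.toReal_ofReal (by positivity), ← Real.rpow_mul (by positivity),
    inv_mul_cancel₀ hr0.ne', Real.rpow_one]
  simp [Real.norm_eq_abs]

lemma ContinuousIntoLr.mul_weight {r : ℝ} (hr : 1 ≤ r) {I : Set ℝ} {F : ℝ → Space n → ℝ}
    (h : ContinuousIntoLr r I F) {w : ℝ × Space n → ℝ} (hw : Continuous w)
    (hc : HasCompactSupport w) :
    ContinuousIntoLr r I (fun s x => F s x * w (s, x)) := by
  have hr1 : (1 : ENNReal) ≤ ENNReal.ofReal r := by simpa using ENNReal.ofReal_le_ofReal hr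
  obtain ⟨M, hM⟩ := hw.bounded_above_of_compact_support hc
  have hM0 : 0 ≤ M := (norm_nonneg _).trans (hM (0, 0))
  have hmeas (s : ℝ) : AEStronglyMeasurable (fun x => w (s, x)) (volume : Measure (Space n)) :=
    (continuous_slice hw s).aestronglyMeasurable
  intro t ht
  refine ⟨(h t ht).1.of_le_mul (c := M) ((h t ht).1.1.mul (hmeas t))
    (Eventually.of_forall fun x => ?_), ?_⟩
  · rw [norm_mul, mul_comm]
    exact mul_le_mul_of_nonneg_right (hM _) (norm_nonneg _)
  have huc := hc.uniformContinuous_of_continuous hw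
  have hft := (h t ht).1.eLpNorm_ne_top
  rw [ENNReal.tendsto_nhds_zero]
  intro ε hε
  -- the oscillation of the weight is chosen small relative to the norm of `F t`
  obtain ⟨η, hη0, hη⟩ : ∃ η : ℝ, 0 < η ∧
      ENNReal.ofReal η * eLpNorm (F t) (ENNReal.ofReal r) volume ≤ ε / 2 := by
    have : Tendsto (fun η : ℝ => ENNReal.ofReal η * eLpNorm (F t) (ENNReal.ofReal r) volume)
        (𝓝[>] 0) (𝓝 0) := by
      have h1 : Tendsto (fun η : ℝ => ENNReal.ofReal η) (𝓝[>] 0) (𝓝 0) :=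
        (ENNReal.continuous_ofReal.tendsto' 0 0 (by simp)).mono_left nhdsWithin_le_nhds
      simpa using ENNReal.Tendsto.mul_const h1 (Or.inr hft)
    obtain ⟨η, h1, h2⟩ := ((ENNReal.tendsto_nhds_zero.1 this (ε / 2)
      (ENNReal.half_pos hε.ne')).and self_mem_nhdsWithin).exists
    exact ⟨η, h2, h1⟩
  obtain ⟨δ, hδ0, hδ⟩ := Metric.uniformContinuous_iff.1 huc η hη0
  have h3 : Tendsto (fun s => ENNReal.ofReal M * eLpNorm (F s - F t) (ENNReal.ofReal r) volume)
      (𝓝[I] t) (𝓝 0) := by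
    simpa using ENNReal.Tendsto.const_mul (h t ht).2 (Or.inr ENNReal.ofReal_ne_top)
  filter_upwards [self_mem_nhdsWithin, ENNReal.tendsto_nhds_zero.1 h3 (ε / 2)
    (ENNReal.half_pos hε.ne'), mem_nhdsWithin_of_mem_nhds (Metric.ball_mem_nhds t hδ0)]
    with s hs hs2 hs3
  have key : ((fun x => F s x * w (s, x)) - fun x => F t x * w (t, x))
      = (fun x => (F s - F t) x * w (s, x)) + fun x => F t x * (w (s, x) - w (t, x)) := by
    funext x
    simp only [Pi.sub_apply, Pi.add_apply]
    ring
  rw [key]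
  refine (eLpNorm_add_le (((h s hs).1.sub (h t ht).1).1.mul (hmeas s))
    ((h t ht).1.1.mul ((hmeas s).sub (hmeas t))) hr1).trans ?_
  rw [← ENNReal.add_halves ε]
  refine add_le_add (le_trans ?_ hs2) (le_trans ?_ hη)
  · refine eLpNorm_le_mul_eLpNorm_of_ae_le_mul (Eventually.of_forall fun x => ?_) _
    rw [Pi.mul_apply, norm_mul, mul_comm]
    exact mul_le_mul_of_nonneg_right (hM _) (norm_nonneg _)
  · refine eLpNorm_le_mul_eLpNorm_of_ae_le_mul (Eventually.of_forall fun x => ?_) _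
    rw [Pi.mul_apply, norm_mul, mul_comm]
    refine mul_le_mul_of_nonneg_right ?_ (norm_nonneg _)
    rw [Pi.sub_apply, ← dist_eq_norm]
    refine (hδ ?_).le
    rw [Prod.dist_eq, dist_self]
    exact max_lt hs3 hδ0

/-- For a nonnegative test function `φ`, the map `s ↦ ∫ |F(s)|^r φ(s)` is continuous. -/
lemma continuousOn_integral_rpow_mul {r : ℝ} (hr : 1 ≤ r) {I : Set ℝ} {F : ℝ → Space n → ℝ}
    (h : ContinuousIntoLr r I F) {φ : ℝ × Space n → ℝ} (hφ : Continuous φ)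
    (hc : HasCompactSupport φ) (h0 : ∀ z, 0 ≤ φ z) :
    ContinuousOn (fun s => ∫ x, |F s x| ^ r * φ (s, x)) I := by
  have hr0 : 0 < r := by linarith
  have hw : Continuous fun z => φ z ^ r⁻¹ := hφ.rpow_const fun _ => Or.inr (by positivity)
  have hwc : HasCompactSupport fun z => φ z ^ r⁻¹ :=
    hc.comp_left (g := fun a : ℝ => a ^ r⁻¹) (Real.zero_rpow (by positivity))
  refine (continuousOn_integral_rpow hr (h.mul_weight hr hw hwc)).congr fun s _ => ?_
  refine integral_congr_ae (Eventually.of_forall fun x => ?_)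
  simp only
  have hw0 : 0 ≤ φ (s, x) ^ r⁻¹ := Real.rpow_nonneg (h0 _) _
  rw [abs_mul, abs_of_nonneg hw0, Real.mul_rpow (abs_nonneg _) hw0, ← Real.rpow_mul (h0 _),
    inv_mul_cancel₀ hr0.ne', Real.rpow_one]

lemma integrable_rpow_of_memLp {r : ℝ} (hr : 0 < r) {f : Space n → ℝ}
    (h : MemLp f (ENNReal.ofReal r) volume) : Integrable fun x => |f x| ^ r := by
  have := h.integrable_norm_rpow (by simpa using hr) (by simp)
  simpa [ENNReal.toReal_ofReal hr.le] using this

lemma integrable_rpow_mul_of_memLp {r : ℝ} (hr : 0 < r) {f : Space n → ℝ}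
    (h : MemLp f (ENNReal.ofReal r) volume) {w : Space n → ℝ} (hw : Continuous w)
    (hc : HasCompactSupport w) :
    Integrable fun x => |f x| ^ r * w x := by
  simpa [mul_comm] using
    (integrable_rpow_of_memLp hr h).locallyIntegrable
      |>.integrable_smul_left_of_hasCompactSupport hw hc

/-- Since supports stay in a fixed ball, continuity into `L²` gives continuity into `L^p`,
`p ≤ 2`. -/
lemma continuousIntoLr_of_continuousOn {R p : ℝ} (hp1 : 1 ≤ p) (hp2 : p ≤ 2) {T : EReal}
    {v : ℝ → L2 n} (hv : ContinuousOn v (timeInterval T))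
    (hs : ∀ t ∈ timeInterval T, VanishesOutside (t + R) (v t)) :
    ContinuousIntoLr p (timeInterval T) (fun t => (v t : Space n → ℝ)) := by
  have hp' : ENNReal.ofReal p ≤ 2 := by simpa using ENNReal.ofReal_le_ofReal hp2
  have hind {r : ℝ} {f : Space n → ℝ} (hf : MemLp f 2 volume) (h : ∀ᵐ x, r < ‖x‖ → f x = 0) :
      MemLp f (ENNReal.ofReal p) volume ∧ eLpNorm f (ENNReal.ofReal p) volume ≤
        eLpNorm f 2 volume * volume (Metric.closedBall (0 : Space n) r) ^ (1 / p - 1 / 2) := by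
    set B := Metric.closedBall (0 : Space n) r
    have hB : MeasurableSet B := Metric.isClosed_closedBall.measurableSet
    have hfB : f =ᵐ[volume] B.indicator f := by
      filter_upwards [h] with x hx
      by_cases hxB : x ∈ B
      · simp [hxB]
      · rw [indicator_of_notMem hxB]
        exact hx (by simpa [B] using hxB)
    have hle : eLpNorm f (ENNReal.ofReal p) volume ≤
        eLpNorm f 2 volume * volume B ^ (1 / p - 1 / 2) := by
      rw [eLpNorm_congr_ae hfB, eLpNorm_indicator_eq_eLpNorm_restrict hB]
      refine (eLpNorm_le_eLpNorm_mul_rpow_measure_univ hp' hf.1.restrict).trans ?_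
      rw [ENNReal.toReal_ofReal (by linarith)]
      simp only [MeasurableSet.univ, Measure.restrict_apply, univ_inter, ENNReal.toReal_ofNat]
      gcongr
      exact Measure.restrict_le_self
    refine ⟨⟨hf.1, hle.trans_lt ?_⟩, hle⟩
    have hBf : volume B ≠ ⊤ := (isCompact_closedBall _ _).measure_ne_top
    refine ENNReal.mul_lt_top hf.2 (ENNReal.rpow_lt_top_of_nonneg ?_ hBf)
    have : 1 / 2 ≤ 1 / p := one_div_le_one_div_of_le (by linarith) hp2
    linarith
  intro t ht
  refine ⟨(hind (Lp.memLp (v t)) (hs t ht)).1, ?_⟩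
  have h1 : Tendsto (fun s => eLpNorm (v s - v t : Space n → ℝ) 2 volume
      * volume (Metric.closedBall (0 : Space n) (t + 1 + R)) ^ (1 / p - 1 / 2))
      (𝓝[timeInterval T] t) (𝓝 0) := by
    have h2 : Tendsto (fun s => eLpNorm (v s - v t : Space n → ℝ) 2 volume)
        (𝓝[timeInterval T] t) (𝓝 0) := by
      have := (Lp.tendsto_Lp_iff_tendsto_eLpNorm' _ _).1 (hv t ht)
      exact this
    have hBf : volume (Metric.closedBall (0 : Space n) (t + 1 + R)) ≠ ⊤ :=
      (isCompact_closedBall _ _).measure_ne_top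
    have : 1 / 2 ≤ 1 / p := one_div_le_one_div_of_le (by linarith) hp2
    simpa using ENNReal.Tendsto.mul_const h2
      (Or.inr (ENNReal.rpow_ne_top_of_nonneg (by linarith : 0 ≤ 1 / p - 1 / 2) hBf))
  refine tendsto_of_tendsto_of_tendsto_of_le_of_le' tendsto_const_nhds h1
    (Eventually.of_forall fun _ => bot_le) ?_
  filter_upwards [self_mem_nhdsWithin,
    mem_nhdsWithin_of_mem_nhds (Iio_mem_nhds (show t < t + 1 by linarith))] with s hsI hst
  refine (hind ((Lp.memLp (v s)).sub (Lp.memLp (v t))) ?_).2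
  filter_upwards [hs s hsI, hs t ht] with x h1 h2 hx
  have hst' : s < t + 1 := hst
  simp [h1 (by linarith), h2 (by linarith)]

end continuity

/-! ### The weak equation tested twice -/

section energy
variable {n : ℕ}

lemma Icc_subset_timeInterval {T : EReal} {ρ : ℝ} (hρ : ρ ∈ timeInterval T) :
    Icc 0 ρ ⊆ timeInterval T := fun _ hs =>
  ⟨hs.1, lt_of_le_of_lt (by exact_mod_cast hs.2) hρ.2⟩

lemma timeInterval_mem_nhds {T : EReal} {ρ s : ℝ} (hρ : ρ ∈ timeInterval T) (hs : s ∈ Ioo 0 ρ) :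
    timeInterval T ∈ 𝓝 s :=
  mem_of_superset (Icc_mem_nhds hs.1 hs.2) (Icc_subset_timeInterval hρ)

/-- Moving both time derivatives and both space derivatives onto the test function. -/
theorem energy_identity {T : EReal} {w : ℝ → H1 n} {wt : ℝ → L2 n} {N : ℝ → Space n → ℝ}
    (hw : ContinuousOn w (timeInterval T)) (hwt : ContinuousOn wt (timeInterval T))
    (hd : ∀ t ∈ timeInterval T,
      HasDerivWithinAt (fun s => (w s).fn) (wt t) (timeInterval T) t)
    (heq : IsWeakWave (timeInterval T) w wt N)
    {φ : ℝ × Space n → ℝ} (hφ : ContDiff ℝ ∞ φ) (hc : HasCompactSupport φ)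
    (hNi : ∀ s ∈ timeInterval T, Integrable fun x => N s x * φ (s, x))
    (hN : ContinuousOn (fun s => ∫ x, N s x * φ (s, x)) (timeInterval T))
    {ρ : ℝ} (hρ : ρ ∈ timeInterval T) :
    ∫ s in (0 : ℝ)..ρ, ((∫ x, (w s).fn x * waveOp φ (s, x)) - ∫ x, N s x * φ (s, x))
      = ((∫ x, (w ρ).fn x * timeDeriv φ (ρ, x)) - ∫ x, (w 0).fn x * timeDeriv φ (0, x))
        - ((∫ x, wt ρ x * φ (ρ, x)) - ∫ x, wt 0 x * φ (0, x)) := by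
  have hsub := Icc_subset_timeInterval hρ
  have hsub' : uIcc 0 ρ ⊆ timeInterval T := by rwa [uIcc_of_le hρ.1]
  have hdf : Differentiable ℝ φ := hφ.differentiable (by simp)
  have hφ1 := hφ.dirDeriv (1, 0)
  have hc1 := hc.dirDeriv (1, 0)
  have hφ2 := hφ1.dirDeriv (1, 0)
  have hc2 := hc1.dirDeriv (1, 0)
  have hφL : Continuous (spaceLaplacian φ) :=
    continuous_finsetSum _ fun i _ => ((hφ.dirDeriv _).dirDeriv _).continuous
  have hcL : HasCompactSupport (spaceLaplacian φ) := by
    refine HasCompactSupport.intro hc fun z hz => ?_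
    refine Finset.sum_eq_zero fun i _ => ?_
    have : φ =ᶠ[𝓝 z] fun _ => 0 := notMem_tsupport_iff_eventuallyEq.1 hz
    have h0 (e : ℝ × Space n) : dirDeriv e (fun _ : ℝ × Space n => (0 : ℝ)) = fun _ => 0 := by
      funext z
      simp [dirDeriv]
    have h2 := dirDeriv_eventuallyEq (dirDeriv_eventuallyEq this (0, EuclideanSpace.single i 1))
      (0, EuclideanSpace.single i 1)
    refine h2.eq_of_nhds.trans ?_
    rw [h0, h0]
  have hwf : ContinuousOn (fun s => (w s).fn) (timeInterval T) :=
    (continuous_fst.comp continuous_subtype_val).comp_continuousOn hw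
  have hsl {ψ : ℝ × Space n → ℝ} (h : ContDiff ℝ ∞ ψ) (h' : HasCompactSupport ψ) :
      Continuous (slice ψ) :=
    continuous_iff_continuousAt.2 fun s => (slice_hasDerivAt h h' s).continuousAt
  -- the three spatial pairings, as continuous functions of time
  have hA : ContinuousOn (fun s => ∫ x, wt s x * timeDeriv φ (s, x)) (timeInterval T) :=
    (hwt.inner (𝕜 := ℝ) (hsl hφ1 hc1).continuousOn).congr fun s _ =>
      (inner_slice hφ1.continuous hc1 s _).symm
  have hB : ContinuousOn (fun s => ∫ x, (w s).fn x * timeDeriv (timeDeriv φ) (s, x))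
      (timeInterval T) :=
    (hwf.inner (𝕜 := ℝ) (hsl hφ2 hc2).continuousOn).congr fun s _ =>
      (inner_slice hφ2.continuous hc2 s _).symm
  have hφLs : ContDiff ℝ ∞ (spaceLaplacian φ) :=
    ContDiff.sum fun i _ => (hφ.dirDeriv _).dirDeriv _
  have hL : ContinuousOn (fun s => ∫ x, (w s).fn x * spaceLaplacian φ (s, x))
      (timeInterval T) :=
    (hwf.inner (𝕜 := ℝ) (hsl hφLs hcL).continuousOn).congr fun s _ =>
      (inner_slice hφL hcL s _).symm
  have hint {f : ℝ → ℝ} (hf : ContinuousOn f (timeInterval T)) :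
      IntervalIntegrable f volume 0 ρ := (hf.mono hsub').intervalIntegrable
  have hLint (f : L2 n) {ψ : ℝ × Space n → ℝ} (h : Continuous ψ) (h' : HasCompactSupport ψ)
      (s : ℝ) : Integrable fun x => f x * ψ (s, x) := by
    simpa [mul_comm] using ((Lp.memLp f).locallyIntegrable
      (by norm_num)).integrable_smul_left_of_hasCompactSupport (continuous_slice h s)
        (hasCompactSupport_slice h' s)
  -- the product rule for `s ↦ ∫ w(s) ∂ₜφ(s)`
  have hftc : ∫ s in (0 : ℝ)..ρ, ((∫ x, (w s).fn x * timeDeriv (timeDeriv φ) (s, x))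
      + ∫ x, wt s x * timeDeriv φ (s, x))
      = (∫ x, (w ρ).fn x * timeDeriv φ (ρ, x)) - ∫ x, (w 0).fn x * timeDeriv φ (0, x) := by
    rw [← inner_slice hφ1.continuous hc1, ← inner_slice hφ1.continuous hc1]
    refine intervalIntegral.integral_eq_sub_of_hasDerivAt_of_le
      (f := fun s => inner ℝ (w s).fn (slice (timeDeriv φ) s)) hρ.1
      ((hwf.mono hsub).inner (𝕜 := ℝ) (hsl hφ1 hc1).continuousOn) (fun s hs => ?_)
      (hint (hB.add hA))
    have h1 := (hd s (hsub (Ioo_subset_Icc_self hs))).hasDerivAt (timeInterval_mem_nhds hρ hs)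
    have h2 := h1.inner ℝ (slice_hasDerivAt hφ1 hc1 s)
    rwa [inner_slice hφ2.continuous hc2, inner_slice hφ1.continuous hc1] at h2
  -- the weak equation, with the gradient term integrated by parts
  have hweak : (∫ x, wt ρ x * φ (ρ, x)) - (∫ x, wt 0 x * φ (0, x))
      = ∫ s in (0 : ℝ)..ρ, ((∫ x, wt s x * timeDeriv φ (s, x))
        + (∫ x, (w s).fn x * spaceLaplacian φ (s, x)) + ∫ x, N s x * φ (s, x)) := by
    rw [heq φ hφ hc ρ hρ]
    refine intervalIntegral.integral_congr fun s hs => ?_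
    have hsI := hsub' hs
    have i1 := hLint (wt s) hφ1.continuous hc1 s
    have hgi : Integrable fun x =>
        inner ℝ ((w s).grad x) (gradient (fun y => φ (s, y)) x) := by
      have hgc : Continuous (gradient (fun y => φ (s, y))) := by
        unfold gradient
        exact (LinearIsometryEquiv.continuous _).comp
          ((contDiff_slice hφ s).continuous_fderiv (by simp))
      have hgs : HasCompactSupport (gradient (fun y => φ (s, y))) := by
        unfold gradient
        exact ((hasCompactSupport_slice hc s).fderiv (𝕜 := ℝ)).comp_left (by simp)
      have hg2 : MemLp (gradient (fun y => φ (s, y))) 2 volume :=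
        hgc.memLp_of_hasCompactSupport hgs
      refine (L2.integrable_inner (𝕜 := ℝ) (w s).grad hg2.toLp).congr ?_
      filter_upwards [hg2.coeFn_toLp] with x hx
      rw [hx]
    have hib := integral_inner_gradient (Lp.memLp (w s).fn) (Lp.memLp (w s).grad) (w s).2 hφ hc s
    simp_rw [(hasDerivAt_time hdf s _).deriv]
    refine (integral_add (i1.sub hgi) (hNi s hsI)).trans ?_
    rw [integral_sub' i1 hgi, hib]
    ring
  have hwave (s : ℝ) : ∫ x, (w s).fn x * waveOp φ (s, x)
      = (∫ x, (w s).fn x * timeDeriv (timeDeriv φ) (s, x))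
        - ∫ x, (w s).fn x * spaceLaplacian φ (s, x) := by
    rw [← integral_sub (hLint _ hφ2.continuous hc2 s) (hLint _ hφL hcL s)]
    simp only [waveOp, mul_sub]
  rw [hweak, ← hftc]
  refine Eq.trans ?_ (intervalIntegral.integral_sub (hint (hB.add hA))
    (hint ((hA.add hL).add hN)))
  refine intervalIntegral.integral_congr fun s _ => ?_
  simp only [hwave]
  ring

end energy

/-! ### Averages of plane waves -/

section average
variable {Y : Type*} [MeasurableSpace Y] {μ : Measure Y} [IsFiniteMeasure μ]
  {E : Type*} [NormedAddCommGroup E] [NormedSpace ℝ E]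
  {ℓ : Y → E →L[ℝ] ℝ} {K : ℝ}

lemma hasFDerivAt_integral_plane (hℓ : StronglyMeasurable ℓ) (hK : ∀ y, ‖ℓ y‖ ≤ K)
    {c : Y → ℝ} (hc : StronglyMeasurable c) {M : ℝ} (hM : ∀ y, ‖c y‖ ≤ M)
    {h : ℝ → ℝ} (hh : ContDiff ℝ 1 h) (z : E) :
    Integrable (fun y => (deriv h (ℓ y z) * c y) • ℓ y) μ ∧
    HasFDerivAt (fun z => ∫ y, h (ℓ y z) * c y ∂μ) (∫ y, (deriv h (ℓ y z) * c y) • ℓ y ∂μ) z := by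
  by_cases hY : IsEmpty Y
  · have : μ = 0 := Measure.eq_zero_of_isEmpty μ
    subst this
    simpa using hasFDerivAt_const (𝕜 := ℝ) (0 : ℝ) z
  obtain ⟨y0⟩ := not_isEmpty_iff.1 hY
  have hM0 : 0 ≤ M := (norm_nonneg _).trans (hM y0)
  have hK0 : 0 ≤ K := (norm_nonneg _).trans (hK y0)
  have hdc : Continuous (deriv h) := hh.continuous_deriv le_rfl
  have hmz (z : E) : StronglyMeasurable fun y => ℓ y z :=
    (ContinuousLinearMap.apply ℝ ℝ z).continuous.comp_stronglyMeasurable hℓ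
  have hbd (f : ℝ → ℝ) (hf : Continuous f) : ∃ B, 0 ≤ B ∧
      ∀ y, ∀ x ∈ Metric.ball z 1, ‖f (ℓ y x)‖ ≤ B := by
    obtain ⟨B, hB⟩ := (isCompact_closedBall (0 : ℝ) (K * (‖z‖ + 1))).exists_bound_of_continuousOn
      hf.continuousOn
    refine ⟨B, (norm_nonneg _).trans (hB 0 (by simp; positivity)), fun y x hx => hB _ ?_⟩
    rw [mem_closedBall_zero_iff]
    refine ((ℓ y).le_opNorm x).trans ?_
    have : ‖x‖ ≤ ‖z‖ + 1 := by
      have h1 : ‖x - z‖ < 1 := by simpa [dist_eq_norm] using hx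
      have h2 := norm_le_norm_add_norm_sub' x z
      linarith
    exact mul_le_mul (hK y) this (norm_nonneg _) hK0
  obtain ⟨B, hB0, hB⟩ := hbd _ hdc
  obtain ⟨B', hB0', hB'⟩ := hbd _ hh.continuous
  have hF' : ∀ y, ∀ x ∈ Metric.ball z 1, ‖(deriv h (ℓ y x) * c y) • ℓ y‖ ≤ B * M * K :=
    fun y x hx => by
      rw [norm_smul, norm_mul]
      exact mul_le_mul (mul_le_mul (hB y x hx) (hM y) (norm_nonneg _) hB0) (hK y) (norm_nonneg _)
        (by positivity)
  have hm' : AEStronglyMeasurable (fun y => (deriv h (ℓ y z) * c y) • ℓ y) μ :=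
    (((hdc.comp_stronglyMeasurable (hmz z)).mul hc).smul hℓ).aestronglyMeasurable
  refine ⟨Integrable.of_bound hm' (B * M * K) (Eventually.of_forall fun y =>
    hF' y z (Metric.mem_ball_self one_pos)), ?_⟩
  refine hasFDerivAt_integral_of_dominated_of_fderiv_le (bound := fun _ => B * M * K)
    (F' := fun x y => (deriv h (ℓ y x) * c y) • ℓ y)
    (Metric.ball_mem_nhds z one_pos) (Eventually.of_forall fun x =>
      ((hh.continuous.comp_stronglyMeasurable (hmz x)).mul hc).aestronglyMeasurable) ?_ hm'
    (Eventually.of_forall hF') (integrable_const _) ?_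
  · refine Integrable.of_bound
      ((hh.continuous.comp_stronglyMeasurable (hmz z)).mul hc).aestronglyMeasurable (B' * M)
      (Eventually.of_forall fun y => ?_)
    rw [norm_mul]
    exact mul_le_mul (hB' y z (Metric.mem_ball_self one_pos)) (hM y) (norm_nonneg _) hB0'
  · refine Eventually.of_forall fun y x _ => ?_
    have h1 : HasDerivAt h (deriv h (ℓ y x)) (ℓ y x) :=
      (hh.differentiable (by simp) _).hasDerivAt
    have h2 := (h1.comp_hasFDerivAt x (ℓ y).hasFDerivAt).mul_const (c y)
    rwa [smul_smul, mul_comm] at h2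

lemma contDiff_integral_plane [FiniteDimensional ℝ E] (hℓ : StronglyMeasurable ℓ)
    (hK : ∀ y, ‖ℓ y‖ ≤ K)
    {c : Y → ℝ} (hc : StronglyMeasurable c) {M : ℝ} (hM : ∀ y, ‖c y‖ ≤ M)
    {h : ℝ → ℝ} (hh : ContDiff ℝ ∞ h) :
    ContDiff ℝ ∞ (fun z => ∫ y, h (ℓ y z) * c y ∂μ) := by
  rw [contDiff_infty]
  intro k
  induction k generalizing c M h with
  | zero =>
    rw [Nat.cast_zero, contDiff_zero]
    exact continuous_iff_continuousAt.2 fun z =>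
      (hasFDerivAt_integral_plane hℓ hK hc hM (hh.of_le (by simp)) z).2.continuousAt
  | succ k ih =>
    rw [Nat.cast_succ, contDiff_succ_iff_fderiv_apply]
    have hd := hasFDerivAt_integral_plane (μ := μ) hℓ hK hc hM (hh.of_le (by simp))
    refine ⟨fun z => (hd z).2.differentiableAt, by simp, fun e => ?_⟩
    have he : (fun z => fderiv ℝ (fun z => ∫ y, h (ℓ y z) * c y ∂μ) z e)
        = fun z => ∫ y, deriv h (ℓ y z) * (c y * ℓ y e) ∂μ := by
      funext z
      rw [(hd z).2.fderiv, ContinuousLinearMap.integral_apply (hd z).1]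
      simp [mul_assoc]
    rw [he]
    refine ih (c := fun y => c y * ℓ y e) (M := M * (K * ‖e‖))
      (hc.mul ((ContinuousLinearMap.apply ℝ ℝ e).continuous.comp_stronglyMeasurable hℓ))
      (fun y => ?_) (contDiff_infty_iff_deriv.1 hh).2
    rw [norm_mul]
    refine mul_le_mul (hM y) ?_ (norm_nonneg _) ((norm_nonneg _).trans (hM y))
    exact ((ℓ y).le_opNorm e).trans (mul_le_mul_of_nonneg_right (hK y) (norm_nonneg _))

lemma dirDeriv_integral_plane (hℓ : StronglyMeasurable ℓ) (hK : ∀ y, ‖ℓ y‖ ≤ K)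
    {c : Y → ℝ} (hc : StronglyMeasurable c) {M : ℝ} (hM : ∀ y, ‖c y‖ ≤ M)
    {h : ℝ → ℝ} (hh : ContDiff ℝ 1 h) (e : E) :
    dirDeriv e (fun z => ∫ y, h (ℓ y z) * c y ∂μ)
      = fun z => ∫ y, deriv h (ℓ y z) * (c y * ℓ y e) ∂μ := by
  funext z
  obtain ⟨h1, h2⟩ := hasFDerivAt_integral_plane (μ := μ) hℓ hK hc hM hh z
  rw [dirDeriv, h2.fderiv, ContinuousLinearMap.integral_apply h1]
  simp [mul_assoc]

end average

section planeAvg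
variable {n : ℕ}

/-- The direction `y / |y|` of a point of the unit ball (zero for `y = 0`). -/
noncomputable def waveDir (y : Space n) : Space n := ‖y‖⁻¹ • y

/-- The phase `t + ⟨x, y / |y|⟩` of a plane wave, as a linear functional on space-time. -/
noncomputable def phase (y : Space n) : ℝ × Space n →L[ℝ] ℝ :=
  ContinuousLinearMap.fst ℝ ℝ (Space n) +
    (innerSL ℝ (waveDir y)).comp (ContinuousLinearMap.snd ℝ ℝ (Space n))

/-- The average of the plane waves `h (t + ⟨x, y / |y|⟩)` over the unit ball of the `y`-space; this
is a multiple of the average over all directions in the unit sphere. -/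
noncomputable def planeAvg (h : ℝ → ℝ) (z : ℝ × Space n) : ℝ :=
  ∫ y in Metric.ball (0 : Space n) 1, h (phase y z)

lemma phase_apply (y : Space n) (z : ℝ × Space n) :
    phase y z = z.1 + inner ℝ (waveDir y) z.2 := rfl

lemma norm_waveDir_le (y : Space n) : ‖waveDir y‖ ≤ 1 := by
  rw [waveDir, norm_smul, norm_inv, norm_norm]
  exact inv_mul_le_one

lemma norm_waveDir {y : Space n} (hy : y ≠ 0) : ‖waveDir y‖ = 1 := by
  rw [waveDir, norm_smul, norm_inv, norm_norm, inv_mul_cancel₀ (norm_ne_zero_iff.2 hy)]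

lemma abs_inner_waveDir_le (y x : Space n) : |inner ℝ (waveDir y) x| ≤ ‖x‖ := by
  refine (abs_real_inner_le_norm _ _).trans ?_
  exact mul_le_of_le_one_left (norm_nonneg _) (norm_waveDir_le y)

lemma measurable_waveDir : Measurable (waveDir : Space n → Space n) :=
  measurable_norm.inv.smul measurable_id

lemma stronglyMeasurable_phase : StronglyMeasurable (phase : Space n → _) := by
  have h1 : StronglyMeasurable (fun y : Space n => innerSL ℝ (waveDir y)) :=
    (innerSL ℝ (E := Space n)).continuous.comp_stronglyMeasurable
      measurable_waveDir.stronglyMeasurable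
  have h2 : Continuous fun L : Space n →L[ℝ] ℝ =>
      ContinuousLinearMap.fst ℝ ℝ (Space n) + L.comp (ContinuousLinearMap.snd ℝ ℝ (Space n)) := by
    fun_prop
  exact h2.comp_stronglyMeasurable h1

lemma norm_phase_le (y : Space n) : ‖(phase y : ℝ × Space n →L[ℝ] ℝ)‖ ≤ 2 := by
  refine ContinuousLinearMap.opNorm_le_bound _ (by norm_num) fun z => ?_
  rw [phase_apply, two_mul]
  refine (norm_add_le _ _).trans (add_le_add (norm_fst_le z) ?_)
  exact (abs_inner_waveDir_le y z.2).trans (norm_snd_le z)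

instance : IsFiniteMeasure ((volume : Measure (Space n)).restrict (Metric.ball 0 1)) :=
  ⟨by simpa using measure_ball_lt_top⟩

lemma contDiff_planeAvg {h : ℝ → ℝ} (hh : ContDiff ℝ ∞ h) :
    ContDiff ℝ ∞ (planeAvg h : ℝ × Space n → ℝ) := by
  unfold planeAvg
  simpa using contDiff_integral_plane (μ := (volume : Measure (Space n)).restrict (Metric.ball 0 1))
    stronglyMeasurable_phase norm_phase_le
    (c := fun _ => 1) stronglyMeasurable_const (M := 1) (by simp) hh

lemma timeDeriv_planeAvg {h : ℝ → ℝ} (hh : ContDiff ℝ ∞ h) :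
    timeDeriv (planeAvg h : ℝ × Space n → ℝ) = planeAvg (deriv h) := by
  unfold planeAvg
  have := dirDeriv_integral_plane (μ := (volume : Measure (Space n)).restrict (Metric.ball 0 1))
    stronglyMeasurable_phase norm_phase_le
    (c := fun _ => 1) stronglyMeasurable_const (M := 1) (by simp) (hh.of_le (by simp)) (1, 0)
  simpa [phase_apply] using this

/-- Averages of plane waves solve the wave equation. -/
lemma waveOp_planeAvg [NeZero n] {h : ℝ → ℝ} (hh : ContDiff ℝ ∞ h) (z : ℝ × Space n) :
    waveOp (planeAvg h) z = 0 := by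
  have hh1 := (contDiff_infty_iff_deriv.1 hh).2
  have hh2 := (contDiff_infty_iff_deriv.1 hh1).2
  have hph (y : Space n) (i : Fin n) :
      phase y ((0 : ℝ), EuclideanSpace.single i 1) = waveDir y i := by
    rw [phase_apply]
    simp [EuclideanSpace.inner_single_right]
  have hwb (y : Space n) (i : Fin n) : ‖waveDir y i‖ ≤ 1 :=
    (PiLp.norm_apply_le (waveDir y) i).trans (norm_waveDir_le y)
  have hmeas (i : Fin n) : StronglyMeasurable fun y : Space n => waveDir y i :=
    ((EuclideanSpace.proj (𝕜 := ℝ) i).continuous.measurable.comp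
      measurable_waveDir).stronglyMeasurable
  have hsp (i : Fin n) : spaceDeriv i (spaceDeriv i (planeAvg h)) z
      = ∫ y in Metric.ball (0 : Space n) 1,
        deriv (deriv h) (phase y z) * (waveDir y i * waveDir y i) := by
    have h1 := dirDeriv_integral_plane
      (μ := (volume : Measure (Space n)).restrict (Metric.ball 0 1))
      stronglyMeasurable_phase norm_phase_le (c := fun _ => 1) stronglyMeasurable_const (M := 1)
      (by simp) (hh.of_le (by simp)) (0, EuclideanSpace.single i 1)
    simp only [mul_one, one_mul, hph] at h1
    have h2 := dirDeriv_integral_plane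
      (μ := (volume : Measure (Space n)).restrict (Metric.ball 0 1))
      stronglyMeasurable_phase norm_phase_le (c := fun y => waveDir y i) (hmeas i) (M := 1)
      (fun y => hwb y i) (hh1.of_le (by simp)) (0, EuclideanSpace.single i 1)
    simp only [hph] at h2
    change dirDeriv _
      (dirDeriv _ (fun z => ∫ y in Metric.ball (0 : Space n) 1, h (phase y z))) z = _
    rw [h1, h2]
  have hint (i : Fin n) : Integrable (fun y : Space n =>
      deriv (deriv h) (phase y z) * (waveDir y i * waveDir y i))
      (volume.restrict (Metric.ball 0 1)) := by
    obtain ⟨B, hB⟩ := (isCompact_closedBall (0 : ℝ) (2 * ‖z‖)).exists_bound_of_continuousOn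
      hh2.continuous.continuousOn
    have hm : StronglyMeasurable fun y : Space n => phase y z :=
      (ContinuousLinearMap.apply ℝ ℝ z).continuous.comp_stronglyMeasurable stronglyMeasurable_phase
    refine Integrable.of_bound ((hh2.continuous.comp_stronglyMeasurable hm).mul
      ((hmeas i).mul (hmeas i))).aestronglyMeasurable B (Eventually.of_forall fun y => ?_)
    have hb1 : ‖deriv (deriv h) (phase y z)‖ ≤ B := hB _ <| by
      rw [mem_closedBall_zero_iff]
      exact ((phase y).le_opNorm z).trans
        (mul_le_mul_of_nonneg_right (norm_phase_le y) (norm_nonneg _))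
    simp only [norm_mul]
    calc _ ≤ ‖deriv (deriv h) (phase y z)‖ * (1 * 1) := by
          gcongr <;> exact hwb y i
      _ ≤ B := by simpa using hb1
  rw [waveOp, timeDeriv_planeAvg hh, timeDeriv_planeAvg hh1, spaceLaplacian]
  simp_rw [hsp]
  rw [← integral_finsetSum _ fun i _ => hint i, planeAvg, sub_eq_zero]
  refine integral_congr_ae ?_
  have hne : ∀ᵐ y ∂(volume : Measure (Space n)), y ≠ 0 := by
    simp [ae_iff]
  filter_upwards [ae_restrict_of_ae hne] with y hy
  have h1 := EuclideanSpace.real_norm_sq_eq (waveDir y)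
  rw [norm_waveDir hy] at h1
  simp only [pow_two, one_mul] at h1
  rw [← Finset.mul_sum, ← h1, mul_one]

end planeAvg

/-! ### Size of averages of negative powers of the phase -/

section capEstimate

/-- Orthogonal splitting along a unit vector `e`, in measure-preserving coordinates. -/
lemma exists_measurePreserving_split (k : ℕ) {e : Space (k + 1)} (he : ‖e‖ = 1) :
    ∃ Ψ : ℝ × Space k → Space (k + 1), MeasurePreserving Ψ ∧
      ∀ w, inner ℝ e (Ψ w) = w.1 ∧ ‖Ψ w‖ ^ 2 = w.1 ^ 2 + ‖w.2‖ ^ 2 := by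
  have he0 : e ≠ 0 := by
    rintro rfl
    simp at he
  have : Fact (Module.finrank ℝ (Space (k + 1)) = k + 1) := ⟨by simp⟩
  let L₁ := LinearIsometryEquiv.toSpanUnitSingleton (𝕜 := ℝ) e he
  let L₂ := (OrthonormalBasis.fromOrthogonalSpanSingleton (𝕜 := ℝ) k he0).repr.symm
  let O := (Submodule.orthogonalDecomposition (𝕜 := ℝ) (Submodule.span ℝ {e})).symm
  have hmp : MeasurePreserving (fun w : ℝ × Space k => O (WithLp.toLp 2 (Prod.map L₁ L₂ w))) :=
    (O.measurePreserving.comp (WithLp.volume_preserving_toLp _ _)).comp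
      (L₁.measurePreserving.prod L₂.measurePreserving)
  refine ⟨_, hmp, fun w => ?_⟩
  have hO : O (WithLp.toLp 2 (Prod.map L₁ L₂ w)) = w.1 • e + (L₂ w.2 : Space (k + 1)) := by
    simp [O, L₁]
  have horth : inner ℝ e (L₂ w.2 : Space (k + 1)) = 0 :=
    Submodule.mem_orthogonal_singleton_iff_inner_right.1 (L₂ w.2).2
  have hn : ‖(L₂ w.2 : Space (k + 1))‖ = ‖w.2‖ := L₂.norm_map w.2
  refine ⟨?_, ?_⟩
  · rw [hO, inner_add_right, horth, inner_smul_right, real_inner_self_eq_norm_sq, he]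
    simp
  · rw [hO, norm_add_sq_real, inner_smul_left, horth, norm_smul, he, hn]
    simp

/-- The elementary convexity bound behind the estimate: on the unit ball, the phase of a plane wave
is bounded below by a quadratic in the component of `y` orthogonal to `e`. -/
lemma le_phase_of_mem_ball {n : ℕ} {e y : Space n} (he : ‖e‖ = 1) (hy : ‖y‖ < 1)
    {τ r : ℝ} (hr : 0 ≤ r) (hrτ : r ≤ τ) :
    ((τ - r) + τ * (‖y‖ ^ 2 - inner ℝ e y ^ 2)) / 2 ≤ τ + inner ℝ (waveDir y) (r • e) := by
  set a := inner ℝ e y with ha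
  have hay : |a| ≤ ‖y‖ := by
    have := abs_real_inner_le_norm e y
    rwa [he, one_mul] at this
  obtain ⟨h1, h2⟩ := abs_le.1 hay
  have hD0 : 0 ≤ ‖y‖ ^ 2 - a ^ 2 := by nlinarith
  have hD1 : ‖y‖ ^ 2 - a ^ 2 ≤ 1 := by nlinarith [sq_nonneg a, norm_nonneg y]
  have hw : inner ℝ (waveDir y) (r • e) = r * (‖y‖⁻¹ * a) := by
    rw [waveDir, inner_smul_left, inner_smul_right, ha, real_inner_comm]
    simp
    ring
  have hq : (‖y‖ ^ 2 - a ^ 2) / 2 ≤ 1 + ‖y‖⁻¹ * a := by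
    rcases eq_or_lt_of_le (norm_nonneg y) with h0 | h0
    · rw [← h0] at h1 h2 ⊢
      nlinarith
    · have : 1 + ‖y‖⁻¹ * a = (‖y‖ + a) / ‖y‖ := by field_simp
      rw [this, le_div_iff₀ h0]
      nlinarith [mul_nonneg (by linarith : 0 ≤ ‖y‖ + a) h0.le,
        mul_nonneg (by linarith : 0 ≤ ‖y‖ + a) (by linarith : 0 ≤ ‖y‖ - a),
        mul_nonneg (mul_nonneg (by linarith : 0 ≤ ‖y‖ + a) h0.le) h0.le]
  rw [hw]
  nlinarith [mul_le_mul_of_nonneg_left hq hr, mul_nonneg (by linarith : 0 ≤ τ - r) hD0,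
    mul_nonneg (by linarith : 0 ≤ τ - r) (by linarith : 0 ≤ 1 - (‖y‖ ^ 2 - a ^ 2))]

lemma lintegral_quadratic_rpow (k : ℕ) {γ : ℝ} (hγ : (k : ℝ) / 2 < γ) :
    ∃ C : ℝ, 0 < C ∧ ∀ a τ : ℝ, 0 < a → 0 < τ →
      ∫⁻ z : Space k, ENNReal.ofReal (((a + τ * ‖z‖ ^ 2) / 2) ^ (-γ))
        ≤ ENNReal.ofReal (C * τ ^ (-((k : ℝ) / 2)) * a ^ ((k : ℝ) / 2 - γ)) := by
  have hJ : Integrable fun z : Space k => (1 + ‖z‖ ^ 2) ^ (-γ) := by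
    have h := integrable_rpow_neg_one_add_norm_sq (E := Space k) (μ := volume) (r := 2 * γ)
      (by simp; linarith)
    convert h using 3
    ring
  set J := ∫ z : Space k, (1 + ‖z‖ ^ 2) ^ (-γ)
  have hJ0 : 0 ≤ J := integral_nonneg fun z => by positivity
  refine ⟨2 ^ γ * (J + 1), by positivity, fun a τ ha hτ => ?_⟩
  have hR : (0 : ℝ) < √(τ / a) := Real.sqrt_pos.2 (by positivity)
  have hscale (z : Space k) : ((a + τ * ‖z‖ ^ 2) / 2) ^ (-γ)
      = (a / 2) ^ (-γ) * (1 + ‖√(τ / a) • z‖ ^ 2) ^ (-γ) := by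
    rw [← Real.mul_rpow (by positivity) (by positivity), norm_smul, mul_pow, Real.norm_eq_abs,
      sq_abs, Real.sq_sqrt (by positivity)]
    congr 1
    field_simp
  simp_rw [hscale]
  rw [← ofReal_integral_eq_lintegral_ofReal ((hJ.comp_smul hR.ne').const_mul _)
    (Eventually.of_forall fun z => by positivity), integral_const_mul,
    Measure.integral_comp_smul volume (fun z : Space k => (1 + ‖z‖ ^ 2) ^ (-γ))]
  refine ENNReal.ofReal_le_ofReal ?_
  have h1 : |(√(τ / a) ^ Module.finrank ℝ (Space k))⁻¹| =
      τ ^ (-((k : ℝ) / 2)) * a ^ ((k : ℝ) / 2) := by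
    rw [abs_of_pos (by positivity), finrank_euclideanSpace_fin, Real.sqrt_eq_rpow,
      ← Real.rpow_natCast, ← Real.rpow_mul (by positivity), ← Real.rpow_neg (by positivity),
      Real.div_rpow hτ.le ha.le,
      div_eq_mul_inv, ← Real.rpow_neg ha.le]
    congr 2 <;> ring
  have h2 : (a / 2) ^ (-γ) = 2 ^ γ * a ^ (-γ) := by
    rw [Real.div_rpow ha.le (by norm_num), Real.rpow_neg (by norm_num : (0 : ℝ) ≤ 2),
      div_inv_eq_mul, mul_comm]
  rw [h1, h2, smul_eq_mul, sub_eq_add_neg, Real.rpow_add ha]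
  have h3 : 0 ≤ 2 ^ γ * a ^ (-γ) * (τ ^ (-((k : ℝ) / 2)) * a ^ ((k : ℝ) / 2)) := by positivity
  nlinarith

/-- The average of `(τ + ⟨x, y/|y|⟩)^(-γ)` for `γ` above the critical power `k / 2`, where `k` is
the dimension of the sphere of directions: only directions close to `-x/|x|` matter. -/
theorem lintegral_phase_rpow_le (k : ℕ) {γ : ℝ} (hγ : (k : ℝ) / 2 < γ) :
    ∃ C : ℝ, 0 < C ∧ ∀ (x : Space (k + 1)) (τ : ℝ), ‖x‖ < τ →
      ∫⁻ y in Metric.ball (0 : Space (k + 1)) 1,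
          ENNReal.ofReal ((τ + inner ℝ (waveDir y) x) ^ (-γ))
        ≤ ENNReal.ofReal (C * τ ^ (-((k : ℝ) / 2)) * (τ - ‖x‖) ^ ((k : ℝ) / 2 - γ)) := by
  obtain ⟨C, hC, hCb⟩ := lintegral_quadratic_rpow k hγ
  have hγ0 : 0 ≤ γ := (by positivity : (0 : ℝ) ≤ (k : ℝ) / 2).trans hγ.le
  refine ⟨2 * C, by positivity, fun x τ hx => ?_⟩
  have hτ : 0 < τ := (norm_nonneg x).trans_lt hx
  obtain ⟨e, he, hxe⟩ : ∃ e : Space (k + 1), ‖e‖ = 1 ∧ x = ‖x‖ • e := by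
    rcases eq_or_ne x 0 with rfl | h0
    · exact ⟨EuclideanSpace.single 0 1, by simp, by simp⟩
    · exact ⟨‖x‖⁻¹ • x, norm_smul_inv_norm h0, by
        rw [smul_smul, mul_inv_cancel₀ (norm_ne_zero_iff.2 h0), one_smul]⟩
  obtain ⟨Ψ, hΨ, hΨ'⟩ := exists_measurePreserving_split k he
  set G : Space (k + 1) → ENNReal := fun y => (Metric.ball (0 : Space (k + 1)) 1).indicator
    (fun y => ENNReal.ofReal
      ((((τ - ‖x‖) + τ * (‖y‖ ^ 2 - inner ℝ e y ^ 2)) / 2) ^ (-γ))) y with hG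
  have hGm : Measurable G := by
    refine Measurable.indicator ?_ Metric.isOpen_ball.measurableSet
    fun_prop
  have hpos : 0 < τ - ‖x‖ := sub_pos.2 hx
  calc ∫⁻ y in Metric.ball (0 : Space (k + 1)) 1,
          ENNReal.ofReal ((τ + inner ℝ (waveDir y) x) ^ (-γ))
      ≤ ∫⁻ y, G y := by
        rw [← lintegral_indicator Metric.isOpen_ball.measurableSet]
        refine lintegral_mono fun y => ?_
        by_cases hy : y ∈ Metric.ball (0 : Space (k + 1)) 1
        · simp only [hG, indicator_of_mem hy]
          have hy1 : ‖y‖ < 1 := by simpa using hy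
          have hD0 : 0 ≤ ‖y‖ ^ 2 - inner ℝ e y ^ 2 := by
            have h := abs_real_inner_le_norm e y
            rw [he, one_mul] at h
            have := sq_le_sq' (abs_le.1 h).1 (abs_le.1 h).2
            linarith
          have hle := le_phase_of_mem_ball he hy1 (norm_nonneg x) hx.le
          rw [← hxe] at hle
          exact ENNReal.ofReal_le_ofReal (Real.rpow_le_rpow_of_nonpos (by positivity) hle
            (by linarith))
        · simp [hG, indicator_of_notMem hy]
    _ = ∫⁻ w, G (Ψ w) := (hΨ.lintegral_comp hGm).symm
    _ ≤ ∫⁻ w : ℝ × Space k, (Icc (-1 : ℝ) 1).indicator 1 w.1 *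
          ENNReal.ofReal ((((τ - ‖x‖) + τ * ‖w.2‖ ^ 2) / 2) ^ (-γ)) := by
        refine lintegral_mono fun w => ?_
        obtain ⟨h1, h2⟩ := hΨ' w
        by_cases hw : Ψ w ∈ Metric.ball (0 : Space (k + 1)) 1
        · have hw1 : ‖Ψ w‖ < 1 := by simpa using hw
          have hwI : w.1 ∈ Icc (-1 : ℝ) 1 := abs_le.1 (by
            have : w.1 ^ 2 ≤ 1 := by nlinarith [sq_nonneg ‖w.2‖, norm_nonneg (Ψ w)]
            exact (sq_le_one_iff_abs_le_one _).1 this)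
          simp only [hG, indicator_of_mem hw, indicator_of_mem hwI, h1, h2]
          simp
        · simp [hG, indicator_of_notMem hw]
    _ = (∫⁻ a : ℝ, (Icc (-1 : ℝ) 1).indicator 1 a) * ∫⁻ z : Space k,
          ENNReal.ofReal ((((τ - ‖x‖) + τ * ‖z‖ ^ 2) / 2) ^ (-γ)) :=
        lintegral_prod_mul (f := (Icc (-1 : ℝ) 1).indicator 1)
          (g := fun z : Space k => ENNReal.ofReal ((((τ - ‖x‖) + τ * ‖z‖ ^ 2) / 2) ^ (-γ)))
          (measurable_one.indicator measurableSet_Icc).aemeasurable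
          (by fun_prop)
    _ ≤ ENNReal.ofReal 2 *
          ENNReal.ofReal (C * τ ^ (-((k : ℝ) / 2)) * (τ - ‖x‖) ^ ((k : ℝ) / 2 - γ)) := by
        gcongr
        · rw [lintegral_indicator_one measurableSet_Icc, Real.volume_Icc]
          norm_num
        · exact hCb _ _ hpos hτ
    _ = _ := by
        rw [← ENNReal.ofReal_mul (by norm_num)]
        congr 1
        ring

end capEstimate

section radial

/-- A function of the distance to the boundary of a ball, integrated over a slightly smaller
ball. -/
lemma setIntegral_radial_le (n : ℕ) [NeZero n] : ∃ C : ℝ, 0 < C ∧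
    ∀ (f : ℝ → ℝ) (σ τ : ℝ), 0 ≤ σ → σ ≤ τ → ContinuousOn f (Icc 0 σ) → (∀ r ∈ Icc 0 σ, 0 ≤ f r) →
      ∫ x in Metric.closedBall (0 : Space n) σ, f ‖x‖
        ≤ C * τ ^ ((n : ℝ) - 1) * ∫ r in (0 : ℝ)..σ, f r := by
  refine ⟨n * volume.real (Metric.ball (0 : Space n) 1), ?_, fun f σ τ hσ hστ hf hf0 => ?_⟩
  · refine mul_pos (by exact_mod_cast Nat.pos_of_ne_zero (NeZero.ne n)) ?_
    exact ENNReal.toReal_pos (Metric.measure_ball_pos _ _ one_pos).ne' measure_ball_lt_top.ne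
  have hnn : Nontrivial (Space n) := by
    have : Nonempty (Fin n) := ⟨⟨0, Nat.pos_of_ne_zero (NeZero.ne n)⟩⟩
    infer_instance
  have h1 : ∫ x in Metric.closedBall (0 : Space n) σ, f ‖x‖
      = ∫ x : Space n, (Iic σ).indicator f ‖x‖ := by
    rw [← integral_indicator Metric.isClosed_closedBall.measurableSet]
    refine integral_congr_ae (Eventually.of_forall fun x => ?_)
    simp [indicator]
  have hcast : ((n - 1 : ℕ) : ℝ) = (n : ℝ) - 1 := by
    rw [Nat.cast_sub (Nat.one_le_iff_ne_zero.2 (NeZero.ne n)), Nat.cast_one]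
  have h2 : ∫ y in Ioi (0 : ℝ), y ^ (n - 1) • (Iic σ).indicator f y
      = ∫ y in (0 : ℝ)..σ, y ^ (n - 1) * f y := by
    rw [intervalIntegral.integral_of_le hσ, ← Ioi_inter_Iic, inter_comm,
      ← Measure.restrict_restrict measurableSet_Iic, ← integral_indicator measurableSet_Iic]
    congr 1
    funext y
    by_cases hy : y ∈ Iic σ <;> simp [hy]
  rw [h1, integral_fun_norm_addHaar, finrank_euclideanSpace_fin, h2, nsmul_eq_mul, smul_eq_mul,
    mul_assoc (_ * _), ← mul_assoc]
  refine mul_le_mul_of_nonneg_left ?_ (by positivity)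
  rw [← intervalIntegral.integral_const_mul]
  have hc : ContinuousOn f (uIcc 0 σ) := by rwa [uIcc_of_le hσ]
  refine intervalIntegral.integral_mono_on hσ
    ((((continuous_pow _).continuousOn).mul hc).intervalIntegrable)
    ((continuousOn_const.mul hc).intervalIntegrable) fun r hr => ?_
  refine mul_le_mul_of_nonneg_right ?_ (hf0 r hr)
  rw [← hcast, Real.rpow_natCast]
  exact pow_le_pow_left₀ hr.1 (hr.2.trans hστ) _

lemma integral_sub_rpow_neg_one {τ : ℝ} (hτ : 1 ≤ τ) :
    ∫ r in (0 : ℝ)..(τ - 1), (τ - r) ^ (-1 : ℝ) = Real.log τ := by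
  simp_rw [Real.rpow_neg_one]
  rw [intervalIntegral.integral_comp_sub_left (fun x => x⁻¹) τ, sub_sub_cancel, sub_zero,
    integral_inv_of_pos one_pos (by linarith), div_one]

lemma integral_sub_rpow_neg_two {τ : ℝ} (hτ : 1 ≤ τ) :
    ∫ r in (0 : ℝ)..(τ - 1), (τ - r) ^ (-2 : ℝ) ≤ 1 := by
  rw [intervalIntegral.integral_comp_sub_left (fun x => x ^ (-2 : ℝ)) τ, sub_sub_cancel, sub_zero,
    integral_rpow (Or.inr ⟨by norm_num, by
      rw [uIcc_of_le hτ]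
      exact fun h => by linarith [h.1]⟩)]
  norm_num
  rw [div_neg, div_one, neg_sub, sub_le_self_iff]
  positivity

end radial

/-! ### Cutoffs in time -/

/-- `ζ` is an admissible time cutoff on the scale `1`: smooth, nonnegative, zero beyond time `1`,
with first two derivatives dominated by `κ ^ (1/r)`. The weight `κ` lives on `[1/2, 1]`. -/
structure IsCutoff (κ : ℝ → ℝ) (r M : ℝ) (ζ : ℝ → ℝ) : Prop where
  contDiff : ContDiff ℝ ∞ ζ
  nonneg : ∀ a, 0 ≤ ζ a
  eq_zero : ∀ a, 1 ≤ a → ζ a = 0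
  deriv_le : ∀ a, |deriv ζ a| ≤ M * κ a ^ r⁻¹
  deriv2_le : ∀ a, |deriv (deriv ζ) a| ≤ M * κ a ^ r⁻¹

/-- A weight `κ` and a primitive `ψ` of `-κ`, both admissible cutoffs relative to `κ`. With
`κ = θ ^ (j+2)` for a bump function `θ`, derivatives cost at most two powers of `θ`, which is
affordable for large `j`. That `κ` is itself `-ψ'` makes the growth of `∫ ψ(s/ρ) w(s) ds` in `ρ`
computable. -/
lemma exists_cutoffs {p : ℝ} (hp : 1 < p) : ∃ κ ψ : ℝ → ℝ, ∃ M : ℝ, 0 < M ∧ Continuous κ ∧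
    (∀ a, 0 ≤ κ a) ∧ (∀ a, a ≤ 1 / 2 → κ a = 0) ∧ (∀ a, 1 ≤ a → κ a = 0) ∧
    (∀ a, HasDerivAt ψ (-κ a) a) ∧ 0 < ψ 0 ∧
    ∀ r, p ≤ r → IsCutoff κ r M κ ∧ IsCutoff κ r M ψ := by
  obtain ⟨j, hj⟩ := exists_nat_ge (2 / (p - 1))
  have hp1 : 0 < p - 1 := by linarith
  have hj2 : 2 ≤ j * (p - 1) := by rwa [div_le_iff₀ hp1] at hj
  let θ : ContDiffBump (3 / 4 : ℝ) := ⟨1 / 8, 1 / 4, by norm_num, by norm_num⟩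
  have hθ : ContDiff ℝ ∞ θ := θ.contDiff
  have hθd : ContDiff ℝ ∞ (deriv θ) := (contDiff_infty_iff_deriv.1 hθ).2
  have hθdd : ContDiff ℝ ∞ (deriv (deriv θ)) := (contDiff_infty_iff_deriv.1 hθd).2
  have hθc : HasCompactSupport θ := θ.hasCompactSupport
  obtain ⟨A, hA⟩ := hθd.continuous.bounded_above_of_compact_support hθc.deriv
  obtain ⟨B, hB⟩ := hθdd.continuous.bounded_above_of_compact_support hθc.deriv.deriv
  have hA0 : 0 ≤ A := (norm_nonneg _).trans (hA 0)
  have hB0 : 0 ≤ B := (norm_nonneg _).trans (hB 0)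
  set κ : ℝ → ℝ := fun a => θ a ^ (j + 2) with hκ
  have hκs : ContDiff ℝ ∞ κ := hθ.pow _
  have hκ0 : ∀ a, 0 ≤ κ a := fun a => pow_nonneg θ.nonneg _
  have hκl : ∀ a, a ≤ 1 / 2 → κ a = 0 := fun a ha => by
    have : θ a = 0 := θ.zero_of_le_dist (by
      rw [Real.dist_eq, le_abs]
      right
      simp only [θ]
      linarith)
    simp [hκ, this]
  have hκr : ∀ a, 1 ≤ a → κ a = 0 := fun a ha => by
    have : θ a = 0 := θ.zero_of_le_dist (by
      rw [Real.dist_eq, le_abs]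
      left
      simp only [θ]
      linarith)
    simp [hκ, this]
  have hd1 (a : ℝ) : HasDerivAt κ ((j + 2) * θ a ^ (j + 1) * deriv θ a) a := by
    have := ((hθ.differentiable (by simp) a).hasDerivAt).fun_pow (j + 2)
    simpa [hκ, add_assoc] using this
  have hd1' : deriv κ = fun a => (j + 2) * θ a ^ (j + 1) * deriv θ a :=
    funext fun a => (hd1 a).deriv
  have hd2 (a : ℝ) : HasDerivAt (deriv κ) ((j + 2) * ((j + 1) * θ a ^ j * deriv θ a) * deriv θ a
      + (j + 2) * θ a ^ (j + 1) * deriv (deriv θ) a) a := by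
    have h1 := ((hθ.differentiable (by simp) a).hasDerivAt).fun_pow (j + 1)
    have h2 := (h1.const_mul ((j : ℝ) + 2)).fun_mul (hθd.differentiable (by simp) a).hasDerivAt
    rw [hd1']
    simpa [mul_assoc] using h2
  have hψd (a : ℝ) : HasDerivAt (fun z => ∫ u in z..1, κ u) (-κ a) a :=
    intervalIntegral.integral_hasDerivAt_left (hκs.continuous.intervalIntegrable _ _)
      (hκs.continuous.stronglyMeasurableAtFilter _ _) hκs.continuous.continuousAt
  have hψd' : deriv (fun z => ∫ u in z..1, κ u) = fun a => -κ a := funext fun a => (hψd a).deriv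
  have hψ1 : ∀ a, 1 ≤ a → ∫ u in a..1, κ u = 0 := fun a ha => by
    rw [intervalIntegral.integral_congr (g := fun _ => 0), intervalIntegral.integral_zero]
    intro u hu
    rw [uIcc_of_ge ha] at hu
    exact hκr u hu.1
  have hψs : ContDiff ℝ ∞ (fun z => ∫ u in z..1, κ u) :=
    contDiff_infty_iff_deriv.2 ⟨fun a => (hψd a).differentiableAt, by rw [hψd']; exact hκs.neg⟩
  set M : ℝ := 1 + (j + 2) * ((j + 1) * A * A + A + B) with hM
  have hM1 : (j + 2) * A ≤ M := by
    have : 0 ≤ ((j : ℝ) + 2) * ((j + 1) * A * A + B) := by positivity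
    rw [hM]; nlinarith
  have hM2 : (j + 2) * ((j + 1) * A * A + B) ≤ M := by
    have : 0 ≤ ((j : ℝ) + 2) * A := by positivity
    rw [hM]; nlinarith
  have hM0 : 1 ≤ M := by
    have : 0 ≤ ((j : ℝ) + 2) * ((j + 1) * A * A + A + B) := by positivity
    linarith
  have hθj {r : ℝ} (hr : p ≤ r) (a : ℝ) : θ a ^ j ≤ κ a ^ r⁻¹ := by
    have hr0 : 0 < r := by linarith
    rw [hκ]
    simp only
    rw [← Real.rpow_natCast, ← Real.rpow_natCast, ← Real.rpow_mul θ.nonneg]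
    have hj0 : 0 ≤ (j : ℝ) := j.cast_nonneg
    refine Real.rpow_le_rpow_of_exponent_ge_of_imp θ.nonneg θ.le_one ?_ ?_
    · rw [← div_eq_mul_inv, div_le_iff₀ hr0]
      push_cast
      nlinarith
    · intro _ h0
      rw [h0] at hj2
      linarith
  have hpw (a : ℝ) (i : ℕ) : θ a ^ (j + i) ≤ θ a ^ j :=
    pow_le_pow_of_le_one θ.nonneg θ.le_one (Nat.le_add_right _ _)
  have hdκ {r : ℝ} (hr : p ≤ r) (a : ℝ) : |deriv κ a| ≤ M * κ a ^ r⁻¹ := by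
    rw [hd1', abs_mul, abs_mul, abs_of_nonneg (by positivity : (0 : ℝ) ≤ j + 2),
      abs_of_nonneg (pow_nonneg θ.nonneg _)]
    have hka := hκ0 a
    calc ((j : ℝ) + 2) * θ a ^ (j + 1) * |deriv θ a| ≤ (j + 2) * κ a ^ r⁻¹ * A := by
          gcongr
          · exact (hpw a 1).trans (hθj hr a)
          · exact hA a
      _ = ((j + 2) * A) * κ a ^ r⁻¹ := by ring
      _ ≤ _ := mul_le_mul_of_nonneg_right hM1 (Real.rpow_nonneg (hκ0 a) _)
  refine ⟨κ, fun z => ∫ u in z..1, κ u, M, by linarith, hκs.continuous, hκ0, hκl, hκr, hψd, ?_,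
    fun r hr => ⟨⟨hκs, hκ0, hκr, hdκ hr, fun a => ?_⟩,
      ⟨hψs, fun a => ?_, hψ1, fun a => ?_, fun a => ?_⟩⟩⟩
  · refine intervalIntegral.integral_pos one_pos hκs.continuous.continuousOn
      (fun a _ => hκ0 a) ⟨3 / 4, by norm_num, ?_⟩
    have : θ (3 / 4) = 1 := θ.one_of_mem_closedBall (Metric.mem_closedBall_self (by norm_num [θ]))
    simp [hκ, this]
  · rw [(hd2 a).deriv]
    have hka := hκ0 a
    calc |((j : ℝ) + 2) * ((j + 1) * θ a ^ j * deriv θ a) * deriv θ a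
          + (j + 2) * θ a ^ (j + 1) * deriv (deriv θ) a|
        ≤ (j + 2) * ((j + 1) * θ a ^ j * |deriv θ a|) * |deriv θ a|
          + (j + 2) * θ a ^ (j + 1) * |deriv (deriv θ) a| := by
          refine (abs_add_le _ _).trans (le_of_eq ?_)
          simp only [abs_mul, abs_of_nonneg (pow_nonneg (θ.nonneg (x := a)) _),
            abs_of_nonneg (by positivity : (0 : ℝ) ≤ j + 2),
            abs_of_nonneg (by positivity : (0 : ℝ) ≤ j + 1)]
      _ ≤ (j + 2) * ((j + 1) * κ a ^ r⁻¹ * A) * A + (j + 2) * κ a ^ r⁻¹ * B := by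
          have := hθj hr a
          have h0 := pow_nonneg (θ.nonneg (x := a)) j
          gcongr
          · exact hA a
          · exact hA a
          · exact (hpw a 1).trans this
          · exact hB a
      _ = ((j + 2) * ((j + 1) * A * A + B)) * κ a ^ r⁻¹ := by ring
      _ ≤ _ := mul_le_mul_of_nonneg_right hM2 (Real.rpow_nonneg (hκ0 a) _)
  · rcases le_total a 1 with h | h
    · exact intervalIntegral.integral_nonneg h fun u _ => hκ0 u
    · exact (hψ1 a h).ge
  · rw [hψd', abs_neg, abs_of_nonneg (hκ0 a)]
    have := (hpw a 2).trans (hθj hr a)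
    exact this.trans (le_mul_of_one_le_left (Real.rpow_nonneg (hκ0 a) _) hM0)
  · rw [hψd', deriv.fun_neg, abs_neg]
    exact hdκ hr a

lemma IsCutoff.deriv_eq_zero {κ ζ : ℝ → ℝ} {r M : ℝ} (h : IsCutoff κ r M ζ) (hr : 0 < r) {a : ℝ}
    (ha : κ a = 0) : deriv ζ a = 0 := by
  have := h.deriv_le a
  rw [ha, Real.zero_rpow (inv_ne_zero hr.ne'), mul_zero] at this
  exact abs_eq_zero.1 (le_antisymm this (abs_nonneg _))

/-! ### Testing with a cutoff average of plane waves -/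

section test
variable {n : ℕ}

lemma integral_mul_congr_of_vanish {f a b : Space n → ℝ} {r : ℝ}
    (hf : ∀ᵐ x, r < ‖x‖ → f x = 0) (hab : ∀ x, ‖x‖ ≤ r → a x = b x) :
    ∫ x, f x * a x = ∫ x, f x * b x := by
  refine integral_congr_ae ?_
  filter_upwards [hf] with x hx
  by_cases h : ‖x‖ ≤ r
  · simp [hab x h]
  · simp [hx (not_le.1 h)]

/-- The wave operator applied to a product of a function of time with a solution. -/
lemma timeDeriv_cutoff {ζ : ℝ → ℝ} (hζ : ContDiff ℝ ∞ ζ) (ρ : ℝ) {H : ℝ × Space n → ℝ}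
    (hH : ContDiff ℝ ∞ H) :
    timeDeriv (fun z => ζ (z.1 / ρ) * H z)
      = fun z => (deriv ζ (z.1 / ρ) / ρ) * H z + ζ (z.1 / ρ) * timeDeriv H z := by
  have hd : Differentiable ℝ (fun z : ℝ × Space n => ζ (z.1 / ρ)) :=
    (hζ.comp (contDiff_fst.div_const ρ)).differentiable (by simp)
  rw [timeDeriv, dirDeriv_mul hd (hH.differentiable (by simp))]
  funext z
  congr 2
  have h1 := hasDerivAt_time hd z.1 z.2
  have h2 : HasDerivAt (fun τ : ℝ => ζ (τ / ρ)) (deriv ζ (z.1 / ρ) * (1 / ρ)) z.1 :=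
    ((hζ.differentiable (by simp) _).hasDerivAt).comp z.1 ((hasDerivAt_id z.1).div_const ρ)
  have := h1.unique h2
  simpa [div_eq_mul_inv] using this

lemma spaceDeriv_cutoff {ζ : ℝ → ℝ} (hζ : ContDiff ℝ ∞ ζ) (ρ : ℝ) {H : ℝ × Space n → ℝ}
    (hH : ContDiff ℝ ∞ H) (i : Fin n) :
    spaceDeriv i (fun z => ζ (z.1 / ρ) * H z) = fun z => ζ (z.1 / ρ) * spaceDeriv i H z := by
  have hd : Differentiable ℝ (fun z : ℝ × Space n => ζ (z.1 / ρ)) :=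
    (hζ.comp (contDiff_fst.div_const ρ)).differentiable (by simp)
  rw [spaceDeriv, dirDeriv_mul hd (hH.differentiable (by simp))]
  funext z
  have : dirDeriv (0, EuclideanSpace.single i 1) (fun z : ℝ × Space n => ζ (z.1 / ρ)) z = 0 := by
    have h2 := ((hζ.differentiable (by simp) (z.1 / ρ)).hasDerivAt).comp_hasFDerivAt z
      ((hasFDerivAt_fst (𝕜 := ℝ) (p := z)).mul_const ρ⁻¹)
    have h3 : fderiv ℝ (fun z : ℝ × Space n => ζ (z.1 / ρ)) z = _ := h2.fderiv
    rw [dirDeriv, h3]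
    simp
  rw [this, zero_mul, zero_add]

lemma waveOp_cutoff {ζ : ℝ → ℝ} (hζ : ContDiff ℝ ∞ ζ) (ρ : ℝ) {H : ℝ × Space n → ℝ}
    (hH : ContDiff ℝ ∞ H) (hw : ∀ z, waveOp H z = 0) (z : ℝ × Space n) :
    waveOp (fun z => ζ (z.1 / ρ) * H z) z
      = deriv (deriv ζ) (z.1 / ρ) / ρ ^ 2 * H z + 2 * (deriv ζ (z.1 / ρ) / ρ) * timeDeriv H z := by
  have hζ1 : ContDiff ℝ ∞ (deriv ζ) := (contDiff_infty_iff_deriv.1 hζ).2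
  have hH1 := hH.dirDeriv (1, 0)
  have hfst : ContDiff ℝ ∞ (fun z : ℝ × Space n => z.1 / ρ) := contDiff_fst.div_const ρ
  have hs (i : Fin n) : spaceDeriv i (spaceDeriv i (fun z => ζ (z.1 / ρ) * H z))
      = fun z => ζ (z.1 / ρ) * spaceDeriv i (spaceDeriv i H) z := by
    rw [spaceDeriv_cutoff hζ ρ hH, spaceDeriv_cutoff hζ ρ (hH.dirDeriv _)]
  have ht : timeDeriv (timeDeriv (fun z => ζ (z.1 / ρ) * H z)) z
      = (deriv (deriv ζ) (z.1 / ρ) / ρ * H z + deriv ζ (z.1 / ρ) * timeDeriv H z) / ρ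
        + ((deriv ζ (z.1 / ρ) / ρ) * timeDeriv H z
          + ζ (z.1 / ρ) * timeDeriv (timeDeriv H) z) := by
    rw [timeDeriv_cutoff hζ ρ hH]
    have e1 : (fun z : ℝ × Space n => deriv ζ (z.1 / ρ) / ρ * H z)
        = fun z => ρ⁻¹ * (deriv ζ (z.1 / ρ) * H z) := by
      funext z
      ring
    have d1 : Differentiable ℝ (fun z : ℝ × Space n => deriv ζ (z.1 / ρ) * H z) :=
      ((hζ1.comp hfst).mul hH).differentiable (by simp)
    have d2 : Differentiable ℝ (fun z : ℝ × Space n => deriv ζ (z.1 / ρ) / ρ * H z) := by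
      rw [e1]
      exact d1.const_mul _
    have d3 : Differentiable ℝ (fun z : ℝ × Space n => ζ (z.1 / ρ) * timeDeriv H z) :=
      ((hζ.comp hfst).mul hH1).differentiable (by simp)
    rw [timeDeriv, dirDeriv_add d2 d3, e1, dirDeriv_mul (differentiable_const _) d1]
    have t1 := timeDeriv_cutoff hζ1 ρ hH
    have t2 := timeDeriv_cutoff hζ ρ hH1
    rw [timeDeriv] at t1 t2
    simp only [t1, t2]
    simp [dirDeriv]
    ring
  have hz := hw z
  rw [waveOp, spaceLaplacian, sub_eq_zero] at hz
  rw [waveOp, spaceLaplacian, ht]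
  simp only [hs, ← Finset.mul_sum]
  rw [← hz]
  ring

/-- A weak solution `w` of `w_tt - Δw = |v|^r` in the energy class, together with its source `v`,
all supported in the light cone `|x| ≤ t + R`. -/
structure IsCausalSolution (T : EReal) (R r : ℝ) (w : ℝ → H1 n) (wt : ℝ → L2 n)
    (v : ℝ → Space n → ℝ) : Prop where
  cont : ContinuousOn w (timeInterval T)
  cont_deriv : ContinuousOn wt (timeInterval T)
  hasDeriv : ∀ t ∈ timeInterval T,
    HasDerivWithinAt (fun s => (w s).fn) (wt t) (timeInterval T) t
  weak : IsWeakWave (timeInterval T) w wt (fun s x => |v s x| ^ r)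
  source_cont : ContinuousIntoLr r (timeInterval T) v
  support : ∀ t ∈ timeInterval T, VanishesOutside (t + R) (w t).fn
  support_deriv : ∀ t ∈ timeInterval T, VanishesOutside (t + R) (wt t)
  source_support : ∀ t ∈ timeInterval T, ∀ᵐ x, t + R < ‖x‖ → v t x = 0

/-- The weak equation tested with `ζ(t/ρ) H(t,x)`, where `H` is a nonnegative smooth solution of the
wave equation. The spatial cutoff that makes this function admissible is invisible by finite speed
of propagation. -/
theorem test_identity {T : EReal} {R : ℝ} (hR : 0 < R) {w : ℝ → H1 n} {wt : ℝ → L2 n}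
    {v : ℝ → Space n → ℝ} {r : ℝ} (hr : 1 ≤ r)
    (hsol : IsCausalSolution T R r w wt v)
    {H : ℝ × Space n → ℝ} (hH : ContDiff ℝ ∞ H) (hH0 : ∀ z, 0 ≤ H z) (hHw : ∀ z, waveOp H z = 0)
    {ζ : ℝ → ℝ} (hζ : ContDiff ℝ ∞ ζ) (hζ0 : ∀ a, 0 ≤ ζ a) (hζ1 : ζ 1 = 0)
    (hζd0 : deriv ζ 0 = 0) (hζd1 : deriv ζ 1 = 0)
    {ρ : ℝ} (hρ0 : 0 < ρ) (hρ : ρ ∈ timeInterval T) :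
    ContinuousOn (fun s => ∫ x, |v s x| ^ r * (ζ (s / ρ) * H (s, x))) (Icc 0 ρ) ∧
    (∀ s ∈ Icc 0 ρ, Integrable fun x => |v s x| ^ r * (ζ (s / ρ) * H (s, x))) ∧
    ContinuousOn (fun s => ∫ x, (w s).fn x * (deriv (deriv ζ) (s / ρ) / ρ ^ 2 * H (s, x)
          + 2 * (deriv ζ (s / ρ) / ρ) * timeDeriv H (s, x))) (Icc 0 ρ) ∧
    (∫ s in (0 : ℝ)..ρ, ∫ x, |v s x| ^ r * (ζ (s / ρ) * H (s, x)))
      + ζ 0 * ((∫ x, wt 0 x * H (0, x)) - ∫ x, (w 0).fn x * timeDeriv H (0, x))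
      = ∫ s in (0 : ℝ)..ρ, ∫ x, (w s).fn x * (deriv (deriv ζ) (s / ρ) / ρ ^ 2 * H (s, x)
          + 2 * (deriv ζ (s / ρ) / ρ) * timeDeriv H (s, x)) := by
  obtain ⟨hw, hwt, hd, heq, hv, hws, hwts, hvs⟩ := hsol
  have hr0 : 0 < r := by linarith
  let χ : ContDiffBump (0 : ℝ × Space n) := ⟨ρ + R + 1, ρ + R + 2, by linarith, by linarith⟩
  set F : ℝ × Space n → ℝ := fun z => ζ (z.1 / ρ) * H z with hF
  have hFs : ContDiff ℝ ∞ F := (hζ.comp (contDiff_fst.div_const ρ)).mul hH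
  set φ : ℝ × Space n → ℝ := fun z => χ z * F z with hφdef
  have hφ : ContDiff ℝ ∞ φ := χ.contDiff.mul hFs
  have hφc : HasCompactSupport φ := χ.hasCompactSupport.mul_right
  have hφ0 : ∀ z, 0 ≤ φ z := fun z => mul_nonneg χ.nonneg (mul_nonneg (hζ0 _) (hH0 z))
  have hsub := Icc_subset_timeInterval hρ
  have hmem {s : ℝ} (hs : s ∈ Icc 0 ρ) {x : Space n} (hx : ‖x‖ ≤ s + R) :
      φ =ᶠ[𝓝 (s, x)] F := by
    have hb : (s, x) ∈ Metric.ball (0 : ℝ × Space n) (ρ + R + 1) := by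
      rw [mem_ball_zero_iff, Prod.norm_def, max_lt_iff]
      refine ⟨?_, ?_⟩
      · simp only [Real.norm_eq_abs, abs_of_nonneg hs.1]
        linarith [hs.2]
      · simp only
        linarith [hs.2]
    filter_upwards [Metric.isOpen_ball.mem_nhds hb] with z hz
    have : χ z = 1 := χ.one_of_mem_closedBall (Metric.ball_subset_closedBall hz)
    simp [hφdef, this]
  have h0 : (0 : ℝ) ∈ Icc 0 ρ := left_mem_Icc.2 hρ0.le
  have h1 : ρ ∈ Icc 0 ρ := right_mem_Icc.2 hρ0.le
  have hvs' {s : ℝ} (hs : s ∈ Icc 0 ρ) : ∀ᵐ x, s + R < ‖x‖ → |v s x| ^ r = 0 := by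
    filter_upwards [hvs s (hsub hs)] with x hx h
    simp [hx h, Real.zero_rpow hr0.ne']
  have eN {s : ℝ} (hs : s ∈ Icc 0 ρ) : ∫ x, |v s x| ^ r * φ (s, x) = ∫ x, |v s x| ^ r * F (s, x) :=
    integral_mul_congr_of_vanish (hvs' hs) fun x hx => (hmem hs hx).eq_of_nhds
  have eT {s : ℝ} (hs : s ∈ Icc 0 ρ) :
      ∫ x, (w s).fn x * timeDeriv φ (s, x) = ∫ x, (w s).fn x * timeDeriv F (s, x) :=
    integral_mul_congr_of_vanish (hws s (hsub hs)) fun x hx =>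
      (dirDeriv_eventuallyEq (hmem hs hx) _).eq_of_nhds
  have eW {s : ℝ} (hs : s ∈ Icc 0 ρ) :
      ∫ x, (w s).fn x * waveOp φ (s, x) = ∫ x, (w s).fn x * waveOp F (s, x) :=
    integral_mul_congr_of_vanish (hws s (hsub hs)) fun x hx => by
      rw [waveOp, waveOp, spaceLaplacian, spaceLaplacian]
      congr 1
      · exact (dirDeriv_eventuallyEq (dirDeriv_eventuallyEq (hmem hs hx) _) _).eq_of_nhds
      · exact Finset.sum_congr rfl fun i _ =>
          (dirDeriv_eventuallyEq (dirDeriv_eventuallyEq (hmem hs hx) _) _).eq_of_nhds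
  have eU {s : ℝ} (hs : s ∈ Icc 0 ρ) : ∫ x, wt s x * φ (s, x) = ∫ x, wt s x * F (s, x) :=
    integral_mul_congr_of_vanish (hwts s (hsub hs)) fun x hx => (hmem hs hx).eq_of_nhds
  have hNc := continuousOn_integral_rpow_mul hr hv hφ.continuous hφc hφ0
  have hNi : ∀ s ∈ timeInterval T, Integrable fun x => |v s x| ^ r * φ (s, x) := fun s hs =>
    integrable_rpow_mul_of_memLp hr0 (hv s hs).1 (continuous_slice hφ.continuous s)
      (hasCompactSupport_slice hφc s)
  have hen := energy_identity hw hwt hd heq hφ hφc hNi hNc hρ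
  have hbox : ContDiff ℝ ∞ (waveOp φ) := ((hφ.dirDeriv _).dirDeriv _).sub
    (ContDiff.sum fun i _ => (hφ.dirDeriv _).dirDeriv _)
  have hboxc : HasCompactSupport (waveOp φ) := by
    refine HasCompactSupport.intro hφc fun z hz => ?_
    have : φ =ᶠ[𝓝 z] fun _ => 0 := notMem_tsupport_iff_eventuallyEq.1 hz
    have h0 (e : ℝ × Space n) : dirDeriv e (fun _ : ℝ × Space n => (0 : ℝ)) = fun _ => 0 := by
      funext z
      simp [dirDeriv]
    have h2 (e : ℝ × Space n) : dirDeriv e (dirDeriv e φ) z = 0 := by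
      rw [(dirDeriv_eventuallyEq (dirDeriv_eventuallyEq this e) e).eq_of_nhds, h0, h0]
    simp [waveOp, spaceLaplacian, h2]
  have hwf : ContinuousOn (fun s => (w s).fn) (timeInterval T) :=
    (continuous_fst.comp continuous_subtype_val).comp_continuousOn hw
  have hboxcont : ContinuousOn (fun s => ∫ x, (w s).fn x * waveOp φ (s, x)) (timeInterval T) :=
    (hwf.inner (𝕜 := ℝ) (continuous_iff_continuousAt.2 fun s =>
      (slice_hasDerivAt hbox hboxc s).continuousAt).continuousOn).congr fun s _ =>
      (inner_slice hbox.continuous hboxc s _).symm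
  have hWF (s : ℝ) (x : Space n) : waveOp F (s, x) = deriv (deriv ζ) (s / ρ) / ρ ^ 2 * H (s, x)
      + 2 * (deriv ζ (s / ρ) / ρ) * timeDeriv H (s, x) := waveOp_cutoff hζ ρ hH hHw (s, x)
  have hTF (s : ℝ) (x : Space n) : timeDeriv F (s, x)
      = (deriv ζ (s / ρ) / ρ) * H (s, x) + ζ (s / ρ) * timeDeriv H (s, x) := by
    rw [hF, timeDeriv_cutoff hζ ρ hH]
  have c1 : ContinuousOn (fun s => ∫ x, |v s x| ^ r * F (s, x)) (Icc 0 ρ) :=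
    (hNc.mono hsub).congr fun s hs => (eN hs).symm
  have c2 : ContinuousOn (fun s => ∫ x, (w s).fn x * waveOp F (s, x)) (Icc 0 ρ) :=
    (hboxcont.mono hsub).congr fun s hs => (eW hs).symm
  refine ⟨c1, fun s hs => (hNi s (hsub hs)).congr ?_, ?_, ?_⟩
  · filter_upwards [hvs' hs] with x hx
    by_cases h : ‖x‖ ≤ s + R
    · rw [(hmem hs h).eq_of_nhds]
    · simp [hx (not_le.1 h)]
  · simpa only [hWF] using c2
  · rw [← uIcc_of_le hρ0.le] at c1 c2
    have hcong : ∫ s in (0 : ℝ)..ρ, ((∫ x, (w s).fn x * waveOp φ (s, x))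
        - ∫ x, |v s x| ^ r * φ (s, x))
        = ∫ s in (0 : ℝ)..ρ,
          ((∫ x, (w s).fn x * waveOp F (s, x)) - ∫ x, |v s x| ^ r * F (s, x)) := by
      refine intervalIntegral.integral_congr fun s hs => ?_
      rw [uIcc_of_le hρ0.le] at hs
      simp only [eW hs, eN hs]
    rw [hcong, eT h1, eT h0, eU h1, eU h0,
      intervalIntegral.integral_sub c2.intervalIntegrable c1.intervalIntegrable] at hen
    have hF1 (x : Space n) : F (ρ, x) = 0 := by simp [hF, div_self hρ0.ne', hζ1]
    simp only [hWF, hTF, hF1, div_self hρ0.ne', hζ1, hζd1, zero_div, hζd0] at hen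
    simp only [zero_mul, add_zero, zero_add, mul_zero, integral_zero, hF, zero_div] at hen
    have e1 : ∫ x, (w 0).fn x * (ζ 0 * timeDeriv H (0, x))
        = ζ 0 * ∫ x, (w 0).fn x * timeDeriv H (0, x) := by
      rw [← integral_const_mul]
      congr 1
      funext x
      ring
    have e2 : ∫ x, wt 0 x * (ζ 0 * H (0, x)) = ζ 0 * ∫ x, wt 0 x * H (0, x) := by
      rw [← integral_const_mul]
      congr 1
      funext x
      ring
    rw [e1, e2] at hen
    linarith

end test

/-! ### Hölder's inequality on one scale -/

section holder
variable {n : ℕ}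

/-- Hölder's inequality on a ball containing the support of `f`. -/
lemma integral_abs_mul_le {f : Space n → ℝ} {r r' σ : ℝ} (hrr : r.HolderConjugate r')
    (hf : MemLp f (ENNReal.ofReal r) volume)
    {Q : Space n → ℝ} (hQ : Continuous Q) (hQ0 : ∀ x, 0 ≤ Q x) :
    ∫ x in Metric.closedBall 0 σ, |f x| * Q x
      ≤ (∫ x, |f x| ^ r) ^ r⁻¹ * (∫ x in Metric.closedBall 0 σ, Q x ^ r') ^ r'⁻¹ := by
  set B := Metric.closedBall (0 : Space n) σ
  have hB : IsCompact B := isCompact_closedBall 0 σ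
  have : IsFiniteMeasure ((volume : Measure (Space n)).restrict B) :=
    ⟨by simpa using hB.measure_lt_top⟩
  obtain ⟨M, hM⟩ := hB.exists_bound_of_continuousOn hQ.continuousOn
  have hQm : MemLp Q (ENNReal.ofReal r') (volume.restrict B) :=
    MemLp.of_bound hQ.aestronglyMeasurable M
      ((ae_restrict_iff' hB.isClosed.measurableSet).2 (Eventually.of_forall hM))
  have h := integral_mul_le_Lp_mul_Lq_of_nonneg hrr
    (Eventually.of_forall fun x => abs_nonneg (f x)) (Eventually.of_forall hQ0)
    (hf.abs.restrict B) hQm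
  simp only [one_div] at h
  refine h.trans (mul_le_mul_of_nonneg_right ?_ (Real.rpow_nonneg
    (integral_nonneg fun x => Real.rpow_nonneg (hQ0 x) _) _))
  refine Real.rpow_le_rpow (integral_nonneg fun x => by positivity) ?_
    (inv_nonneg.2 hrr.nonneg)
  exact setIntegral_le_integral (integrable_rpow_of_memLp hrr.pos hf)
    (Eventually.of_forall fun x => by positivity)

lemma intervalIntegral_rpow_le {g : ℝ → ℝ} {ρ r r' : ℝ} (hρ : 0 ≤ ρ) (hrr : r.HolderConjugate r')
    (hg : ContinuousOn g (Icc 0 ρ)) (hg0 : ∀ s ∈ Icc 0 ρ, 0 ≤ g s) :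
    ∫ s in (0 : ℝ)..ρ, g s ^ r⁻¹ ≤ (∫ s in (0 : ℝ)..ρ, g s) ^ r⁻¹ * ρ ^ r'⁻¹ := by
  rw [intervalIntegral.integral_of_le hρ, intervalIntegral.integral_of_le hρ]
  have hr := hrr.pos
  have hgc : ContinuousOn (fun s => g s ^ r⁻¹) (Icc 0 ρ) :=
    hg.rpow_const fun _ _ => Or.inr (inv_nonneg.2 hr.le)
  have : IsFiniteMeasure ((volume : Measure ℝ).restrict (Ioc 0 ρ)) := ⟨by simp⟩
  obtain ⟨M, hM⟩ := isCompact_Icc.exists_bound_of_continuousOn hgc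
  have hmem : ∀ᵐ s ∂(volume : Measure ℝ).restrict (Ioc 0 ρ), s ∈ Icc 0 ρ :=
    (ae_restrict_iff' measurableSet_Ioc).2 (Eventually.of_forall fun s hs => Ioc_subset_Icc_self hs)
  have h1 : MemLp (fun s => g s ^ r⁻¹) (ENNReal.ofReal r) (volume.restrict (Ioc 0 ρ)) :=
    MemLp.of_bound ((hgc.mono Ioc_subset_Icc_self).aestronglyMeasurable measurableSet_Ioc) M
      (hmem.mono fun s hs => hM s hs)
  have h := integral_mul_le_Lp_mul_Lq_of_nonneg hrr (f := fun s => g s ^ r⁻¹) (g := fun _ => 1)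
    (hmem.mono fun s hs => Real.rpow_nonneg (hg0 s hs) _)
    (Eventually.of_forall fun _ => zero_le_one) h1 (memLp_const 1)
  simp only [mul_one, Real.one_rpow, one_div] at h
  refine h.trans (le_of_eq ?_)
  congr 2
  · refine setIntegral_congr_fun measurableSet_Ioc fun s hs => ?_
    rw [← Real.rpow_mul (hg0 s (Ioc_subset_Icc_self hs)), inv_mul_cancel₀ hr.ne', Real.rpow_one]
  · simp [hρ]

/-- The basic inequality on the scale `ρ`: the test function identity followed by Hölder's
inequality in space and in time. Here `r` is the power in the equation and `k` the Hölder exponent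
used for the solution. -/
theorem scale_inequality {T : EReal} {R : ℝ} (hR : 0 < R) {w : ℝ → H1 n} {wt : ℝ → L2 n}
    {v : ℝ → Space n → ℝ} {r : ℝ} (hr : 1 ≤ r) (hsol : IsCausalSolution T R r w wt v)
    {k k' : ℝ} (hk : k.HolderConjugate k')
    (hwk : ContinuousIntoLr k (timeInterval T) (fun s => ((w s).fn : Space n → ℝ)))
    (hw0 : 0 ≤ (w 0).fn)
    {H : ℝ × Space n → ℝ} (hH : ContDiff ℝ ∞ H) (hH0 : ∀ z, 0 ≤ H z) (hHw : ∀ z, waveOp H z = 0)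
    (hHt : ∀ x, ‖x‖ ≤ R → timeDeriv H (0, x) ≤ 0)
    {κ ζ : ℝ → ℝ} {M : ℝ} (hM : 0 ≤ M) (hκc : Continuous κ) (hκ0 : ∀ a, 0 ≤ κ a)
    (hκl : ∀ a, a ≤ 1 / 2 → κ a = 0) (hκr : ∀ a, 1 ≤ a → κ a = 0) (hζ : IsCutoff κ k M ζ)
    {ρ : ℝ} (hρ0 : 0 < ρ) (hρ : ρ ∈ timeInterval T) {K : ℝ}
    (hK : ∀ s ∈ Icc (ρ / 2) ρ, ∫ x in Metric.closedBall (0 : Space n) (s + R),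
      (H (s, x) / ρ ^ 2 + 2 / ρ * |timeDeriv H (s, x)|) ^ k' ≤ K) :
    ContinuousOn (fun s => ∫ x, |v s x| ^ r * (ζ (s / ρ) * H (s, x))) (Icc 0 ρ) ∧
    (∀ s ∈ Icc 0 ρ, Integrable fun x => |v s x| ^ r * (ζ (s / ρ) * H (s, x))) ∧
    (∫ s in (0 : ℝ)..ρ, ∫ x, |v s x| ^ r * (ζ (s / ρ) * H (s, x)))
      + ζ 0 * (∫ x, wt 0 x * H (0, x))
      ≤ M * (K * ρ) ^ k'⁻¹ * (∫ s in (0 : ℝ)..ρ, κ (s / ρ) * ∫ x, |(w s).fn x| ^ k) ^ k⁻¹ := by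
  have hkpos := hk.pos
  have hk'pos := hk.symm.pos
  have hk1 : 1 ≤ k := hk.lt.le
  obtain ⟨c1, i1, c2, hid⟩ := test_identity hR hr hsol hH hH0 hHw hζ.contDiff hζ.nonneg
    (hζ.eq_zero 1 le_rfl) (hζ.deriv_eq_zero hkpos (hκl 0 (by norm_num)))
    (hζ.deriv_eq_zero hkpos (hκr 1 le_rfl)) hρ0 hρ
  refine ⟨c1, i1, ?_⟩
  have hsub := Icc_subset_timeInterval hρ
  have h0 : (0 : ℝ) ∈ Icc 0 ρ := left_mem_Icc.2 hρ0.le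
  have hHtc : Continuous (timeDeriv H) := (hH.dirDeriv _).continuous
  have hK0 : 0 ≤ K := (integral_nonneg fun x => by
    have := hH0 (ρ, x)
    positivity).trans (hK ρ ⟨by linarith, le_rfl⟩)
  -- the contribution of `w(0)` has a sign
  have hdata : ∫ x, (w 0).fn x * timeDeriv H (0, x) ≤ 0 := by
    refine integral_nonpos_of_ae ?_
    have hpos := (Lp.coeFn_nonneg _).2 hw0
    filter_upwards [hpos, hsol.support 0 (hsub h0)] with x hx1 hx2
    by_cases hxR : ‖x‖ ≤ R
    · exact mul_nonpos_of_nonneg_of_nonpos hx1 (hHt x hxR)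
    · rw [hx2 (by linarith), zero_mul]
      rfl
  have hζ0 := hζ.nonneg 0
  set e : ℝ → ℝ := fun s => ∫ x, |(w s).fn x| ^ k with he
  have hec : ContinuousOn e (Icc 0 ρ) := (continuousOn_integral_rpow hk1 hwk).mono hsub
  have he0 : ∀ s, 0 ≤ e s := fun s => integral_nonneg fun x => by positivity
  have hκρ : Continuous fun s => κ (s / ρ) := hκc.comp (continuous_id.div_const ρ)
  have hgc : ContinuousOn (fun s => κ (s / ρ) * e s) (Icc 0 ρ) := hκρ.continuousOn.mul hec
  have hg0 : ∀ s ∈ Icc 0 ρ, 0 ≤ κ (s / ρ) * e s := fun s _ => mul_nonneg (hκ0 _) (he0 s)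
  have hpt : ∀ s ∈ Icc 0 ρ, ∫ x, (w s).fn x * (deriv (deriv ζ) (s / ρ) / ρ ^ 2 * H (s, x)
          + 2 * (deriv ζ (s / ρ) / ρ) * timeDeriv H (s, x))
        ≤ M * K ^ k'⁻¹ * (κ (s / ρ) * e s) ^ k⁻¹ := by
    intro s hs
    set X := κ (s / ρ) ^ k⁻¹ with hX
    have hX0 : 0 ≤ X := Real.rpow_nonneg (hκ0 _) _
    rw [Real.mul_rpow (hκ0 _) (he0 s), ← hX]
    rcases lt_or_ge s (ρ / 2) with hlt | hge
    · have hk0 : κ (s / ρ) = 0 := hκl _ (by rw [div_le_iff₀ hρ0]; linarith)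
      have hX' : X = 0 := by rw [hX, hk0, Real.zero_rpow (inv_ne_zero hkpos.ne')]
      have d1 : deriv ζ (s / ρ) = 0 := hζ.deriv_eq_zero hkpos hk0
      have d2 : deriv (deriv ζ) (s / ρ) = 0 := by
        have := hζ.deriv2_le (s / ρ)
        rw [← hX, hX', mul_zero] at this
        exact abs_eq_zero.1 (le_antisymm this (abs_nonneg _))
      simp [d1, d2, hX']
    · set B := Metric.closedBall (0 : Space n) (s + R) with hB
      have hBc : IsCompact B := isCompact_closedBall _ _
      set Q : Space n → ℝ := fun x => H (s, x) / ρ ^ 2 + 2 / ρ * |timeDeriv H (s, x)| with hQ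
      have hQc : Continuous Q := ((continuous_slice hH.continuous s).div_const _).add
        (continuous_const.mul (continuous_slice hHtc s).abs)
      have hQ0 : ∀ x, 0 ≤ Q x := fun x => by
        have := hH0 (s, x)
        positivity
      have hfi : IntegrableOn (fun x => |(w s).fn x|) B :=
        (((Lp.memLp (w s).fn).locallyIntegrable (by norm_num)).integrableOn_isCompact hBc).abs
      have hvan := hsol.support s (hsub hs)
      calc ∫ x, (w s).fn x * (deriv (deriv ζ) (s / ρ) / ρ ^ 2 * H (s, x)
              + 2 * (deriv ζ (s / ρ) / ρ) * timeDeriv H (s, x))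
          ≤ ∫ x, |(w s).fn x| * |deriv (deriv ζ) (s / ρ) / ρ ^ 2 * H (s, x)
              + 2 * (deriv ζ (s / ρ) / ρ) * timeDeriv H (s, x)| := by
            simp_rw [← abs_mul]
            exact (le_abs_self _).trans (abs_integral_le_integral_abs)
        _ = ∫ x in B, |(w s).fn x| * |deriv (deriv ζ) (s / ρ) / ρ ^ 2 * H (s, x)
              + 2 * (deriv ζ (s / ρ) / ρ) * timeDeriv H (s, x)| := by
            refine (setIntegral_eq_integral_of_ae_compl_eq_zero ?_).symm
            filter_upwards [hvan] with x hx hxB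
            rw [hx (by simpa [hB] using hxB)]
            simp
        _ ≤ ∫ x in B, (M * X) * (|(w s).fn x| * Q x) := by
            refine integral_mono_of_nonneg (Eventually.of_forall fun x => by positivity)
              ((hfi.mul_continuousOn hQc.continuousOn hBc).const_mul _)
              (Eventually.of_forall fun x => ?_)
            simp only
            rw [mul_left_comm]
            refine mul_le_mul_of_nonneg_left ?_ (abs_nonneg _)
            refine (abs_add_le _ _).trans ?_
            rw [hQ, mul_add]
            refine add_le_add ?_ ?_
            · rw [abs_mul, abs_div, abs_of_nonneg (hH0 _),
                abs_of_nonneg (by positivity : 0 ≤ ρ ^ 2),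
                div_mul_eq_mul_div, mul_div_assoc]
              exact mul_le_mul_of_nonneg_right (hζ.deriv2_le _)
                (div_nonneg (hH0 _) (by positivity))
            · rw [abs_mul, abs_mul, abs_div, abs_of_pos hρ0, abs_of_pos (by norm_num : (0:ℝ) < 2)]
              have := hζ.deriv_le (s / ρ)
              calc 2 * (|deriv ζ (s / ρ)| / ρ) * |timeDeriv H (s, x)|
                  ≤ 2 * ((M * X) / ρ) * |timeDeriv H (s, x)| := by gcongr
                _ = _ := by ring
        _ = (M * X) * ∫ x in B, |(w s).fn x| * Q x := integral_const_mul _ _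
        _ ≤ (M * X) * ((e s) ^ k⁻¹ * K ^ k'⁻¹) := by
            refine mul_le_mul_of_nonneg_left ?_ (by positivity)
            refine (integral_abs_mul_le hk (hwk s (hsub hs)).1 hQc hQ0).trans ?_
            refine mul_le_mul_of_nonneg_left ?_ (Real.rpow_nonneg (he0 s) _)
            refine Real.rpow_le_rpow (integral_nonneg fun x => Real.rpow_nonneg (hQ0 x) _)
              (hK s ⟨hge, hs.2⟩) (inv_nonneg.2 hk'pos.le)
        _ = _ := by ring
  have hint2 : ∫ s in (0 : ℝ)..ρ, ∫ x, (w s).fn x * (deriv (deriv ζ) (s / ρ) / ρ ^ 2 * H (s, x)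
          + 2 * (deriv ζ (s / ρ) / ρ) * timeDeriv H (s, x))
      ≤ ∫ s in (0 : ℝ)..ρ, M * K ^ k'⁻¹ * (κ (s / ρ) * e s) ^ k⁻¹ := by
    rw [← uIcc_of_le hρ0.le] at c2 hgc
    refine intervalIntegral.integral_mono_on hρ0.le c2.intervalIntegrable ?_ hpt
    exact (continuousOn_const.mul (hgc.rpow_const fun _ _ =>
      Or.inr (inv_nonneg.2 hkpos.le))).intervalIntegrable
  rw [intervalIntegral.integral_const_mul] at hint2
  have hh := intervalIntegral_rpow_le hρ0.le hk hgc hg0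
  have h3 : M * K ^ k'⁻¹ * ∫ s in (0 : ℝ)..ρ, (κ (s / ρ) * e s) ^ k⁻¹
      ≤ M * K ^ k'⁻¹ * ((∫ s in (0 : ℝ)..ρ, κ (s / ρ) * e s) ^ k⁻¹ * ρ ^ k'⁻¹) :=
    mul_le_mul_of_nonneg_left hh (by positivity)
  rw [Real.mul_rpow hK0 hρ0.le]
  have h4 := mul_nonneg hζ0 (neg_nonneg.2 hdata)
  nlinarith

end holder

/-! ### The self-similar test functions -/

/-- A smooth nonnegative function on the line that equals `(a + c) ^ (-β)` for `a + c ≥ 3/4`. -/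
noncomputable def powerProfile (β c : ℝ) (a : ℝ) : ℝ :=
  Real.smoothTransition (4 * (a + c) - 2) * (a + c) ^ (-β)

lemma powerProfile_eq {β c a : ℝ} (h : 3 / 4 ≤ a + c) : powerProfile β c a = (a + c) ^ (-β) := by
  rw [powerProfile, Real.smoothTransition.one_of_one_le (by linarith), one_mul]

lemma powerProfile_nonneg (β c a : ℝ) : 0 ≤ powerProfile β c a := by
  rcases le_or_gt 0 (a + c) with h | h
  · exact mul_nonneg (Real.smoothTransition.nonneg _) (Real.rpow_nonneg h _)
  · rw [powerProfile, Real.smoothTransition.zero_of_nonpos (by linarith), zero_mul]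

lemma contDiff_powerProfile (β c : ℝ) : ContDiff ℝ ∞ (powerProfile β c) := by
  rw [contDiff_iff_contDiffAt]
  intro a
  rcases lt_or_ge (a + c) (1 / 2) with h | h
  · have : powerProfile β c =ᶠ[𝓝 a] fun _ => 0 := by
      filter_upwards [Iio_mem_nhds (show a < 1 / 2 - c by linarith)] with b hb
      have hb' : b < 1 / 2 - c := hb
      rw [powerProfile, Real.smoothTransition.zero_of_nonpos (by linarith), zero_mul]
    exact contDiffAt_const.congr_of_eventuallyEq this
  · refine ContDiffAt.mul ?_ ?_
    · exact (Real.smoothTransition.contDiff.comp (by fun_prop)).contDiffAt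
    · exact (contDiffAt_id.add contDiffAt_const).rpow_const_of_ne (by simp; linarith)

lemma deriv_powerProfile {β c a : ℝ} (h : 1 ≤ a + c) :
    deriv (powerProfile β c) a = -β * (a + c) ^ (-(β + 1)) := by
  have : powerProfile β c =ᶠ[𝓝 a] fun b => (b + c) ^ (-β) := by
    filter_upwards [Ioi_mem_nhds (show 3 / 4 - c < a by linarith)] with b hb
    have hb' : 3 / 4 - c < b := hb
    exact powerProfile_eq (by linarith)
  rw [this.deriv_eq]
  have h1 := ((hasDerivAt_id a).add_const c).rpow_const (p := -β) (Or.inl (by simp; linarith))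
  simp only [id] at h1
  rw [h1.deriv, show -(β + 1) = -β - 1 by ring]
  ring

section profile
variable {n : ℕ}

/-- The smooth solution `∫ (t + R + 1 + ⟨x, y/|y|⟩)^(-β) dy` of the wave equation on the light cone
`|x| ≤ t + R`. -/
noncomputable def testWave (n : ℕ) (β R : ℝ) : ℝ × Space n → ℝ := planeAvg (powerProfile β (R + 1))

/-- The average of `(τ + ⟨x, y/|y|⟩)^(-γ)` over the unit ball in `y`. -/
noncomputable def phaseMean (γ τ : ℝ) (x : Space n) : ℝ :=
  ∫ y in Metric.ball (0 : Space n) 1, (τ + inner ℝ (waveDir y) x) ^ (-γ)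

lemma contDiff_testWave (β R : ℝ) : ContDiff ℝ ∞ (testWave n β R) :=
  contDiff_planeAvg (contDiff_powerProfile _ _)

lemma testWave_nonneg (β R : ℝ) (z : ℝ × Space n) : 0 ≤ testWave n β R z :=
  integral_nonneg fun _ => powerProfile_nonneg _ _ _

lemma waveOp_testWave [NeZero n] (β R : ℝ) (z : ℝ × Space n) : waveOp (testWave n β R) z = 0 :=
  waveOp_planeAvg (contDiff_powerProfile _ _) z

lemma one_le_phase {τ : ℝ} {x y : Space n} (h : ‖x‖ ≤ τ - 1) :
    1 ≤ τ + inner ℝ (waveDir y) x := by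
  have := (abs_le.1 (abs_inner_waveDir_le y x)).1
  linarith

lemma phase_le {τ : ℝ} {x y : Space n} (h : ‖x‖ ≤ τ - 1) :
    τ + inner ℝ (waveDir y) x ≤ 2 * τ := by
  have := (abs_le.1 (abs_inner_waveDir_le y x)).2
  linarith

lemma testWave_eq {β R t : ℝ} {x : Space n} (h : ‖x‖ ≤ t + R) :
    testWave n β R (t, x) = phaseMean β (t + R + 1) x := by
  refine integral_congr_ae (Eventually.of_forall fun y => ?_)
  have := one_le_phase (y := y) (show ‖x‖ ≤ (t + R + 1) - 1 by linarith)
  simp only [phase_apply]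
  rw [powerProfile_eq (by linarith)]
  congr 1
  ring

lemma timeDeriv_testWave_eq {β R t : ℝ} {x : Space n} (h : ‖x‖ ≤ t + R) :
    timeDeriv (testWave n β R) (t, x) = -β * phaseMean (β + 1) (t + R + 1) x := by
  rw [testWave, timeDeriv_planeAvg (contDiff_powerProfile _ _), phaseMean, ← integral_const_mul]
  refine integral_congr_ae (Eventually.of_forall fun y => ?_)
  have := one_le_phase (y := y) (show ‖x‖ ≤ (t + R + 1) - 1 by linarith)
  simp only [phase_apply]
  rw [deriv_powerProfile (by linarith)]
  congr 2
  ring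

lemma integrable_phase_rpow {γ τ : ℝ} (hγ : 0 ≤ γ) {x : Space n} (h : ‖x‖ ≤ τ - 1) :
    IntegrableOn (fun y => (τ + inner ℝ (waveDir y) x) ^ (-γ)) (Metric.ball (0 : Space n) 1) := by
  have hm : Measurable fun y : Space n => (τ + inner ℝ (waveDir y) x) ^ (-γ) :=
    (measurable_const.add (measurable_waveDir.inner measurable_const)).pow_const _
  refine Integrable.of_bound hm.aestronglyMeasurable 1 (Eventually.of_forall fun y => ?_)
  have h1 := one_le_phase (y := y) h
  rw [Real.norm_of_nonneg (Real.rpow_nonneg (by linarith) _)]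
  exact Real.rpow_le_one_of_one_le_of_nonpos h1 (by linarith)

lemma phaseMean_nonneg {γ τ : ℝ} {x : Space n} (h : ‖x‖ ≤ τ - 1) : 0 ≤ phaseMean γ τ x :=
  integral_nonneg fun y => Real.rpow_nonneg (by linarith [one_le_phase (y := y) h]) _

lemma volume_ball_pos : 0 < volume.real (Metric.ball (0 : Space n) 1) :=
  ENNReal.toReal_pos (Metric.measure_ball_pos _ _ one_pos).ne' measure_ball_lt_top.ne

lemma le_phaseMean {γ τ : ℝ} (hγ : 0 ≤ γ) {x : Space n} (h : ‖x‖ ≤ τ - 1) :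
    volume.real (Metric.ball (0 : Space n) 1) * (2 * τ) ^ (-γ) ≤ phaseMean γ τ x := by
  have h1 : ∫ y in Metric.ball (0 : Space n) 1, (2 * τ) ^ (-γ)
      = volume.real (Metric.ball (0 : Space n) 1) * (2 * τ) ^ (-γ) := by
    rw [setIntegral_const, smul_eq_mul]
  rw [← h1]
  refine integral_mono (integrable_const _) (integrable_phase_rpow hγ h) fun y => ?_
  exact Real.rpow_le_rpow_of_nonpos (by linarith [one_le_phase (y := y) h]) (phase_le h)
    (by linarith)

/-- Lowering the exponent by one costs at most a factor `2 τ`. -/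
lemma phaseMean_le_mul {γ τ : ℝ} (hγ : 0 ≤ γ) {x : Space n} (h : ‖x‖ ≤ τ - 1) :
    phaseMean γ τ x ≤ 2 * τ * phaseMean (γ + 1) τ x := by
  rw [phaseMean, phaseMean, ← integral_const_mul]
  refine integral_mono (integrable_phase_rpow hγ h)
    ((integrable_phase_rpow (by linarith) h).const_mul _) fun y => ?_
  have h1 := one_le_phase (y := y) h
  have h0 : 0 < τ + inner ℝ (waveDir y) x := by linarith
  simp only
  rw [show -γ = 1 + -(γ + 1) by ring, Real.rpow_add h0, Real.rpow_one]
  exact mul_le_mul_of_nonneg_right (phase_le h) (Real.rpow_nonneg h0.le _)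

lemma phaseMean_le (k : ℕ) {γ : ℝ} (hγ : (k : ℝ) / 2 < γ) :
    ∃ C : ℝ, 0 < C ∧ ∀ (x : Space (k + 1)) (τ : ℝ), ‖x‖ ≤ τ - 1 →
      phaseMean γ τ x ≤ C * τ ^ (-((k : ℝ) / 2)) * (τ - ‖x‖) ^ ((k : ℝ) / 2 - γ) := by
  obtain ⟨C, hC, h⟩ := lintegral_phase_rpow_le k hγ
  refine ⟨C, hC, fun x τ hx => ?_⟩
  have hγ0 : 0 ≤ γ := (by positivity : (0 : ℝ) ≤ (k : ℝ) / 2).trans hγ.le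
  have hτ : 0 ≤ τ := by linarith [norm_nonneg x]
  rw [phaseMean, integral_eq_lintegral_of_nonneg_ae
    (Eventually.of_forall fun y => Real.rpow_nonneg (by linarith [one_le_phase (y := y) hx]) _)
    (integrable_phase_rpow hγ0 hx).aestronglyMeasurable]
  refine ENNReal.toReal_le_of_le_ofReal ?_ (h x τ (by linarith))
  have : 0 ≤ τ - ‖x‖ := by linarith
  positivity

end profile

/-! ### The Hölder weights on one scale -/

section weights

/-- For `β = (n-1)/2 + δ/k' - 1`, the `k'`-th power of the weight decays like `(τ - |x|)^(-δ)` away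
from the light cone. -/
lemma weight_rpow_le (m : ℕ) {β δ k k' R : ℝ} (hR : 0 < R) (hk : k.HolderConjugate k')
    (hβ : 0 ≤ β) (hδ : 0 < δ) (hβδ : β + 1 = (m : ℝ) / 2 + δ / k') :
    ∃ C : ℝ, 0 < C ∧ ∀ ρ s : ℝ, R + 1 ≤ ρ → s ∈ Icc (ρ / 2) ρ → ∀ x : Space (m + 1), ‖x‖ ≤ s + R →
      (testWave (m + 1) β R (s, x) / ρ ^ 2
          + 2 / ρ * |timeDeriv (testWave (m + 1) β R) (s, x)|) ^ k'
        ≤ C * ρ ^ (-k' - (m : ℝ) / 2 * k') * (s + R + 1 - ‖x‖) ^ (-δ) := by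
  have hk' := hk.symm.pos
  have hδk : 0 < δ / k' := div_pos hδ hk'
  obtain ⟨C, hC, h⟩ := phaseMean_le m (γ := β + 1) (by linarith)
  refine ⟨((4 + 2 * β) * (C * 2 ^ ((m : ℝ) / 2))) ^ k', by positivity, fun ρ s hρ hs x hx => ?_⟩
  have hρ0 : 0 < ρ := by linarith
  set τ := s + R + 1 with hτ
  have hx' : ‖x‖ ≤ τ - 1 := by rw [hτ]; linarith
  have hτl : ρ / 2 ≤ τ := by linarith [hs.1]
  have hτr : τ ≤ 2 * ρ := by linarith [hs.2]
  have hτ0 : 0 < τ := by linarith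
  have ha : 0 < τ - ‖x‖ := by linarith
  set P := phaseMean (β + 1) τ x with hP
  have hP0 : 0 ≤ P := phaseMean_nonneg hx'
  have h1 := phaseMean_le_mul hβ hx'
  have h2 : P ≤ C * τ ^ (-((m : ℝ) / 2)) * (τ - ‖x‖) ^ (-(δ / k')) := by
    have := h x τ hx'
    rwa [hβδ, show (m : ℝ) / 2 - ((m : ℝ) / 2 + δ / k') = -(δ / k') by ring, ← hβδ] at this
  have h3 : τ ^ (-((m : ℝ) / 2)) ≤ 2 ^ ((m : ℝ) / 2) * ρ ^ (-((m : ℝ) / 2)) := by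
    calc τ ^ (-((m : ℝ) / 2)) ≤ (ρ / 2) ^ (-((m : ℝ) / 2)) :=
          Real.rpow_le_rpow_of_nonpos (by linarith) hτl (by
            have : (0 : ℝ) ≤ (m : ℝ) / 2 := by positivity
            linarith)
      _ = _ := by
          rw [Real.div_rpow hρ0.le (by norm_num), Real.rpow_neg (by norm_num : (0 : ℝ) ≤ 2),
            div_inv_eq_mul, mul_comm]
  have hle : testWave (m + 1) β R (s, x) / ρ ^ 2
      + 2 / ρ * |timeDeriv (testWave (m + 1) β R) (s, x)| ≤ (4 + 2 * β) * (P / ρ) := by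
    rw [testWave_eq hx, timeDeriv_testWave_eq hx, abs_mul, abs_neg, abs_of_nonneg hβ,
      abs_of_nonneg hP0]
    have h4 : phaseMean β τ x / ρ ^ 2 ≤ 4 * (P / ρ) := by
      rw [div_le_iff₀ (by positivity)]
      calc phaseMean β τ x ≤ 2 * τ * P := h1
        _ ≤ 2 * (2 * ρ) * P := by gcongr
        _ = _ := by field_simp; ring
    calc _ ≤ 4 * (P / ρ) + 2 / ρ * (β * P) := by gcongr
      _ = _ := by ring
  have hfin : (4 + 2 * β) * (P / ρ) ≤ ((4 + 2 * β) * (C * 2 ^ ((m : ℝ) / 2))) *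
      (ρ ^ (-1 - (m : ℝ) / 2) * (τ - ‖x‖) ^ (-(δ / k'))) := by
    have h5 : ρ ^ (-1 - (m : ℝ) / 2) = ρ⁻¹ * ρ ^ (-((m : ℝ) / 2)) := by
      rw [sub_eq_add_neg, Real.rpow_add hρ0, Real.rpow_neg_one]
    calc (4 + 2 * β) * (P / ρ) ≤ (4 + 2 * β) * ((C * (2 ^ ((m : ℝ) / 2) * ρ ^ (-((m : ℝ) / 2)))
          * (τ - ‖x‖) ^ (-(δ / k'))) / ρ) := by
          gcongr
          exact h2.trans (by gcongr)
      _ = _ := by rw [h5]; ring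
  have hnn : 0 ≤ testWave (m + 1) β R (s, x) / ρ ^ 2
      + 2 / ρ * |timeDeriv (testWave (m + 1) β R) (s, x)| := by
    have := testWave_nonneg β R (s, x)
    positivity
  refine (Real.rpow_le_rpow hnn (hle.trans hfin) hk'.le).trans (le_of_eq ?_)
  rw [Real.mul_rpow (x := (4 + 2 * β) * (C * 2 ^ ((m : ℝ) / 2))) (by positivity) (by positivity),
    Real.mul_rpow (x := ρ ^ (-1 - (m : ℝ) / 2)) (by positivity) (by positivity),
    ← Real.rpow_mul hρ0.le, ← Real.rpow_mul ha.le, mul_assoc]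
  congr 3
  · ring
  · field_simp

lemma setIntegral_weight_le (m : ℕ) {β δ k k' R : ℝ} (hR : 0 < R) (hk : k.HolderConjugate k')
    (hβ : 0 ≤ β) (hδ : 0 < δ) (hβδ : β + 1 = (m : ℝ) / 2 + δ / k') :
    ∃ C : ℝ, 0 < C ∧ ∀ ρ s : ℝ, R + 1 ≤ ρ → s ∈ Icc (ρ / 2) ρ →
      ∫ x in Metric.closedBall (0 : Space (m + 1)) (s + R),
        (testWave (m + 1) β R (s, x) / ρ ^ 2
          + 2 / ρ * |timeDeriv (testWave (m + 1) β R) (s, x)|) ^ k'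
        ≤ C * ρ ^ (-k' - (m : ℝ) / 2 * k' + m) *
          ∫ a in (0 : ℝ)..(s + R + 1 - 1), (s + R + 1 - a) ^ (-δ) := by
  obtain ⟨C, hC, h⟩ := weight_rpow_le m hR hk hβ hδ hβδ
  obtain ⟨C', hC', h'⟩ := setIntegral_radial_le (m + 1)
  refine ⟨C * (C' * 2 ^ (m : ℝ)), by positivity, fun ρ s hρ hs => ?_⟩
  have hρ0 : 0 < ρ := by linarith
  have hs0 : 0 ≤ s := by linarith [hs.1]
  have hB : IsCompact (Metric.closedBall (0 : Space (m + 1)) (s + R)) := isCompact_closedBall _ _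
  have hfc : ContinuousOn (fun a : ℝ => (s + R + 1 - a) ^ (-δ)) (Icc 0 (s + R)) := by
    refine ContinuousOn.rpow_const (by fun_prop) fun a ha => Or.inl ?_
    linarith [ha.2]
  have hfx : ContinuousOn (fun x : Space (m + 1) => (s + R + 1 - ‖x‖) ^ (-δ))
      (Metric.closedBall (0 : Space (m + 1)) (s + R)) := by
    refine ContinuousOn.rpow_const (by fun_prop) fun x hx => Or.inl ?_
    have : ‖x‖ ≤ s + R := by simpa using hx
    linarith
  have hrad := h' (fun a => (s + R + 1 - a) ^ (-δ)) (s + R) (2 * ρ) (by linarith)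
    (by linarith [hs.2]) hfc fun a ha => Real.rpow_nonneg (by linarith [ha.2]) _
  have hI0 : 0 ≤ ∫ a in (0 : ℝ)..(s + R), (s + R + 1 - a) ^ (-δ) :=
    intervalIntegral.integral_nonneg (by linarith) fun a ha =>
      Real.rpow_nonneg (by linarith [ha.2]) _
  calc _ ≤ ∫ x in Metric.closedBall (0 : Space (m + 1)) (s + R),
        C * ρ ^ (-k' - (m : ℝ) / 2 * k') * (s + R + 1 - ‖x‖) ^ (-δ) := by
        refine setIntegral_mono_on ?_ ((hfx.integrableOn_compact hB).const_mul _)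
          hB.isClosed.measurableSet fun x hx => h ρ s hρ hs x (by simpa using hx)
        refine ContinuousOn.integrableOn_compact hB ?_
        refine Continuous.continuousOn ?_
        refine Continuous.rpow_const ?_ fun _ => Or.inr hk.symm.nonneg
        exact ((continuous_slice (contDiff_testWave β R).continuous s).div_const _).add
          (continuous_const.mul
            (continuous_slice ((contDiff_testWave β R).dirDeriv _).continuous s).abs)
    _ = C * ρ ^ (-k' - (m : ℝ) / 2 * k') *
        ∫ x in Metric.closedBall (0 : Space (m + 1)) (s + R), (s + R + 1 - ‖x‖) ^ (-δ) :=
        integral_const_mul _ _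
    _ ≤ C * ρ ^ (-k' - (m : ℝ) / 2 * k') * (C' * (2 * ρ) ^ (((m + 1 : ℕ) : ℝ) - 1) *
        ∫ a in (0 : ℝ)..(s + R), (s + R + 1 - a) ^ (-δ)) := by
        gcongr
    _ = _ := by
        rw [Nat.cast_add, Nat.cast_one, add_sub_cancel_right, Real.mul_rpow (by norm_num) hρ0.le,
          Real.rpow_add hρ0, add_sub_cancel_right]
        ring

end weights

/-! ### Growth inequalities for the space integrals of the nonlinear terms -/

section growth

lemma rpow_conj_mul {k k' : ℝ} (hk : k.HolderConjugate k') : k' * (k - 1) = k := by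
  have h1 := hk.sub_one_mul_conj
  linarith

/-- The basic inequality for the test functions `testWave`. -/
theorem scale_inequality_testWave {m : ℕ} {T : EReal} {R : ℝ} (hR : 0 < R)
    {w : ℝ → H1 (m + 1)} {wt : ℝ → L2 (m + 1)}
    {v : ℝ → Space (m + 1) → ℝ} {r : ℝ} (hr : 1 ≤ r) (hsol : IsCausalSolution T R r w wt v)
    {k k' : ℝ} (hk : k.HolderConjugate k')
    (hwk : ContinuousIntoLr k (timeInterval T) (fun s => ((w s).fn : Space (m + 1) → ℝ)))
    (hw0 : 0 ≤ (w 0).fn) (hwt0 : 0 ≤ wt 0) {β : ℝ} (hβ : 0 ≤ β)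
    {κ ζ : ℝ → ℝ} {M : ℝ} (hM : 0 ≤ M) (hκc : Continuous κ) (hκ0 : ∀ a, 0 ≤ κ a)
    (hκl : ∀ a, a ≤ 1 / 2 → κ a = 0) (hκr : ∀ a, 1 ≤ a → κ a = 0) (hζ : IsCutoff κ k M ζ)
    {ρ : ℝ} (hρ0 : 0 < ρ) (hρ : ρ ∈ timeInterval T) {K : ℝ} (hK0 : 0 ≤ K)
    (hK : ∀ s ∈ Icc (ρ / 2) ρ, ∫ x in Metric.closedBall (0 : Space (m + 1)) (s + R),
      (testWave (m + 1) β R (s, x) / ρ ^ 2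
        + 2 / ρ * |timeDeriv (testWave (m + 1) β R) (s, x)|) ^ k' ≤ K) :
    (volume.real (Metric.ball (0 : Space (m + 1)) 1) * 2 ^ (-β) *
        (∫ s in (0 : ℝ)..ρ, ζ (s / ρ) * ((s + R + 1) ^ (-β) * ∫ x, |v s x| ^ r))
      + ζ 0 * ∫ x, wt 0 x * testWave (m + 1) β R (0, x)) ^ k
      ≤ M ^ k * (K * ρ) ^ (k - 1) * ∫ s in (0 : ℝ)..ρ, κ (s / ρ) * ∫ x, |(w s).fn x| ^ k := by
  have hkpos := hk.pos
  have hk'pos := hk.symm.pos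
  have hr0 : 0 < r := by linarith
  have hsub := Icc_subset_timeInterval hρ
  set V := volume.real (Metric.ball (0 : Space (m + 1)) 1) with hV
  have hV0 : 0 < V := volume_ball_pos
  obtain ⟨c1, i1, hmain⟩ := scale_inequality hR hr hsol hk hwk hw0 (contDiff_testWave β R)
    (testWave_nonneg β R) (waveOp_testWave β R) (fun x hx => by
      rw [timeDeriv_testWave_eq (by linarith)]
      exact mul_nonpos_of_nonpos_of_nonneg (by linarith) (phaseMean_nonneg (by linarith)))
    hM hκc hκ0 hκl hκr hζ hρ0 hρ hK
  have hdata0 : 0 ≤ ∫ x, wt 0 x * testWave (m + 1) β R (0, x) := by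
    refine integral_nonneg_of_ae ?_
    filter_upwards [(Lp.coeFn_nonneg _).2 hwt0] with x hx
    exact mul_nonneg hx (testWave_nonneg _ _ _)
  have hbc : ContinuousOn (fun s => ∫ x, |v s x| ^ r) (Icc 0 ρ) :=
    (continuousOn_integral_rpow hr hsol.source_cont).mono hsub
  have hb0 (s : ℝ) : 0 ≤ ∫ x, |v s x| ^ r := integral_nonneg fun x => by positivity
  have hlc : ContinuousOn (fun s => ζ (s / ρ) * ((s + R + 1) ^ (-β) * ∫ x, |v s x| ^ r))
      (Icc 0 ρ) := by
    refine ContinuousOn.mul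
      (hζ.contDiff.continuous.comp (continuous_id.div_const ρ)).continuousOn
      (ContinuousOn.mul (ContinuousOn.rpow_const (by fun_prop) fun s hs => Or.inl ?_) hbc)
    linarith [hs.1]
  have hlow : V * 2 ^ (-β) *
        (∫ s in (0 : ℝ)..ρ, ζ (s / ρ) * ((s + R + 1) ^ (-β) * ∫ x, |v s x| ^ r))
      ≤ ∫ s in (0 : ℝ)..ρ, ∫ x, |v s x| ^ r * (ζ (s / ρ) * testWave (m + 1) β R (s, x)) := by
    rw [← intervalIntegral.integral_const_mul]
    rw [← uIcc_of_le hρ0.le] at c1 hlc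
    refine intervalIntegral.integral_mono_on hρ0.le
      (continuousOn_const.mul hlc).intervalIntegrable c1.intervalIntegrable fun s hs => ?_
    have hs0 := hs.1
    have : V * 2 ^ (-β) * (ζ (s / ρ) * ((s + R + 1) ^ (-β) * ∫ x, |v s x| ^ r))
        = ∫ x, (V * 2 ^ (-β) * (ζ (s / ρ) * (s + R + 1) ^ (-β))) * |v s x| ^ r := by
      rw [integral_const_mul]
      ring
    rw [this]
    refine integral_mono_ae ((integrable_rpow_of_memLp hr0
      (hsol.source_cont s (hsub hs)).1).const_mul _) (i1 s hs) ?_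
    filter_upwards [hsol.source_support s (hsub hs)] with x hx
    by_cases hxs : ‖x‖ ≤ s + R
    · have h1 := le_phaseMean hβ (show ‖x‖ ≤ (s + R + 1) - 1 by linarith)
      rw [← hV, Real.mul_rpow (by norm_num) (by linarith), ← testWave_eq hxs] at h1
      calc _ = |v s x| ^ r * (ζ (s / ρ) * (V * (2 ^ (-β) * (s + R + 1) ^ (-β)))) := by ring
        _ ≤ _ := mul_le_mul_of_nonneg_left (mul_le_mul_of_nonneg_left h1 (hζ.nonneg _))
            (by positivity)
    · rw [hx (not_le.1 hxs), abs_zero, Real.zero_rpow hr0.ne']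
      simp
  have hE0 : 0 ≤ ∫ s in (0 : ℝ)..ρ, κ (s / ρ) * ∫ x, |(w s).fn x| ^ k :=
    intervalIntegral.integral_nonneg hρ0.le fun s _ =>
      mul_nonneg (hκ0 _) (integral_nonneg fun x => by positivity)
  have hL0 : 0 ≤ ∫ s in (0 : ℝ)..ρ, ζ (s / ρ) * ((s + R + 1) ^ (-β) * ∫ x, |v s x| ^ r) :=
    intervalIntegral.integral_nonneg hρ0.le fun s hs =>
      mul_nonneg (hζ.nonneg _) (mul_nonneg (Real.rpow_nonneg (by linarith [hs.1]) _) (hb0 s))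
  have hζ00 := hζ.nonneg 0
  have hle := (add_le_add_left hlow (ζ 0 * ∫ x, wt 0 x * testWave (m + 1) β R (0, x))).trans hmain
  refine (Real.rpow_le_rpow (by positivity) hle hkpos.le).trans (le_of_eq ?_)
  have hKρ : 0 ≤ K * ρ := by positivity
  rw [Real.mul_rpow (by positivity) (by positivity), Real.mul_rpow hM (by positivity),
    ← Real.rpow_mul hKρ, ← Real.rpow_mul hE0, inv_mul_cancel₀ hkpos.ne', Real.rpow_one]
  congr 3
  rw [← rpow_conj_mul hk]
  field_simp
  rw [rpow_conj_mul hk]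

/-- The inequality obtained from weights decaying like `(τ - |x|)^(-δ)` off the light cone; `J`
bounds the integral of the decay. -/
theorem scale_inequality_cone (m : ℕ) {R k k' β δ M : ℝ} (hR : 0 < R) (hk : k.HolderConjugate k')
    (hβ : 0 ≤ β) (hδ : 0 < δ) (hβδ : β + 1 = (m : ℝ) / 2 + δ / k')
    {κ ζ : ℝ → ℝ} (hM : 0 ≤ M) (hκc : Continuous κ) (hκ0 : ∀ a, 0 ≤ κ a)
    (hκl : ∀ a, a ≤ 1 / 2 → κ a = 0) (hκr : ∀ a, 1 ≤ a → κ a = 0) (hζ : IsCutoff κ k M ζ) :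
    ∃ C : ℝ, 0 < C ∧ ∀ (T : EReal) (w : ℝ → H1 (m + 1)) (wt : ℝ → L2 (m + 1))
      (v : ℝ → Space (m + 1) → ℝ) (r : ℝ), 1 ≤ r → IsCausalSolution T R r w wt v →
      ContinuousIntoLr k (timeInterval T) (fun s => ((w s).fn : Space (m + 1) → ℝ)) →
      0 ≤ (w 0).fn → 0 ≤ wt 0 → ∀ ρ J : ℝ, R + 1 ≤ ρ → ρ ∈ timeInterval T → 0 ≤ J →
      (∀ s ∈ Icc (ρ / 2) ρ, ∫ a in (0 : ℝ)..(s + R + 1 - 1), (s + R + 1 - a) ^ (-δ) ≤ J) →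
      (volume.real (Metric.ball (0 : Space (m + 1)) 1) * 2 ^ (-β) *
        (∫ s in (0 : ℝ)..ρ, ζ (s / ρ) * ((s + R + 1) ^ (-β) * ∫ x, |v s x| ^ r))
      + ζ 0 * ∫ x, wt 0 x * testWave (m + 1) β R (0, x)) ^ k
      ≤ C * J ^ (k - 1) * ρ ^ ((m : ℝ) / 2 * k - m - 1)
        * ∫ s in (0 : ℝ)..ρ, κ (s / ρ) * ∫ x, |(w s).fn x| ^ k := by
  obtain ⟨C, hC, h⟩ := setIntegral_weight_le m hR hk hβ hδ hβδ
  have hk1 : 0 < k - 1 := sub_pos.2 hk.lt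
  refine ⟨(M + 1) ^ k * C ^ (k - 1), by positivity,
    fun T w wt v r hr hsol hwk hw0 hwt0 ρ J hρR hρ hJ0 hJ => ?_⟩
  have hρ0 : 0 < ρ := by linarith
  have hE0 : 0 ≤ ∫ s in (0 : ℝ)..ρ, κ (s / ρ) * ∫ x, |(w s).fn x| ^ k :=
    intervalIntegral.integral_nonneg hρ0.le fun s _ =>
      mul_nonneg (hκ0 _) (integral_nonneg fun x => by positivity)
  refine (scale_inequality_testWave hR hr hsol hk hwk hw0 hwt0 hβ hM hκc hκ0 hκl hκr hζ hρ0 hρ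
    (K := C * ρ ^ (-k' - (m : ℝ) / 2 * k' + m) * J) (by positivity) fun s hs =>
      (h ρ s hρR hs).trans (mul_le_mul_of_nonneg_left (hJ s hs) (by positivity))).trans ?_
  refine mul_le_mul_of_nonneg_right ?_ hE0
  have e1 : C * ρ ^ (-k' - (m : ℝ) / 2 * k' + m) * J * ρ
      = C * J * ρ ^ (-k' - (m : ℝ) / 2 * k' + m + 1) := by
    rw [Real.rpow_add_one hρ0.ne']
    ring
  rw [e1, Real.mul_rpow (by positivity) (by positivity), Real.mul_rpow hC.le hJ0,
    ← Real.rpow_mul hρ0.le]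
  have e2 : (-k' - (m : ℝ) / 2 * k' + m + 1) * (k - 1) = (m : ℝ) / 2 * k - m - 1 := by
    have := rpow_conj_mul hk
    linear_combination (-1 - (m : ℝ) / 2) * this
  rw [e2]
  have hMk : M ^ k ≤ (M + 1) ^ k := Real.rpow_le_rpow hM (by linarith) hk.nonneg
  calc M ^ k * (C ^ (k - 1) * J ^ (k - 1) * ρ ^ ((m : ℝ) / 2 * k - m - 1))
      ≤ (M + 1) ^ k * (C ^ (k - 1) * J ^ (k - 1) * ρ ^ ((m : ℝ) / 2 * k - m - 1)) := by gcongr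
    _ = _ := by ring

/-- The choice `δ = 1`, at the price of a logarithm. -/
theorem growth_log (m : ℕ) {R k k' M : ℝ} (hR : 0 < R) (hk : k.HolderConjugate k')
    (hmk : 1 / k ≤ (m : ℝ) / 2)
    {κ ζ : ℝ → ℝ} (hM : 0 ≤ M) (hκc : Continuous κ) (hκ0 : ∀ a, 0 ≤ κ a)
    (hκl : ∀ a, a ≤ 1 / 2 → κ a = 0) (hκr : ∀ a, 1 ≤ a → κ a = 0) (hζ : IsCutoff κ k M ζ) :
    ∃ C : ℝ, 0 < C ∧ ∀ (T : EReal) (w : ℝ → H1 (m + 1)) (wt : ℝ → L2 (m + 1))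
      (v : ℝ → Space (m + 1) → ℝ) (r : ℝ), 1 ≤ r → IsCausalSolution T R r w wt v →
      ContinuousIntoLr k (timeInterval T) (fun s => ((w s).fn : Space (m + 1) → ℝ)) →
      0 ≤ (w 0).fn → 0 ≤ wt 0 → ∀ ρ : ℝ, R + 2 ≤ ρ → ρ ∈ timeInterval T →
      (∫ s in (0 : ℝ)..ρ, ζ (s / ρ) * ((s + R + 1) ^ (-((m : ℝ) / 2 - 1 / k)) *
        ∫ x, |v s x| ^ r)) ^ k
      ≤ C * Real.log ρ ^ (k - 1) * ρ ^ ((m : ℝ) / 2 * k - m - 1)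
        * ∫ s in (0 : ℝ)..ρ, κ (s / ρ) * ∫ x, |(w s).fn x| ^ k := by
  have hβ : 0 ≤ (m : ℝ) / 2 - 1 / k := by linarith
  obtain ⟨C, hC, h⟩ := scale_inequality_cone m (δ := 1) hR hk hβ one_pos (by
    have := hk.inv_add_inv_eq_one
    rw [one_div, one_div]
    linarith) hM hκc hκ0 hκl hκr hζ
  set V := volume.real (Metric.ball (0 : Space (m + 1)) 1) * 2 ^ (-((m : ℝ) / 2 - 1 / k)) with hV
  have hV0 : 0 < V := mul_pos volume_ball_pos (by positivity)
  refine ⟨(V ^ k)⁻¹ * (C * 2 ^ (k - 1)), by positivity,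
    fun T w wt v r hr hsol hwk hw0 hwt0 ρ hρR hρ => ?_⟩
  have hρ0 : 0 < ρ := by linarith
  have hlog : 0 ≤ Real.log ρ := Real.log_nonneg (by linarith)
  have h1 := h T w wt v r hr hsol hwk hw0 hwt0 ρ (2 * Real.log ρ) (by linarith) hρ
    (by positivity) fun s hs => by
      rw [integral_sub_rpow_neg_one (by linarith [hs.1]), two_mul,
        ← Real.log_mul hρ0.ne' hρ0.ne']
      refine Real.log_le_log (by linarith [hs.1]) ?_
      nlinarith [hs.2]
  have hL0 : 0 ≤ ∫ s in (0 : ℝ)..ρ, ζ (s / ρ) * ((s + R + 1) ^ (-((m : ℝ) / 2 - 1 / k)) *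
      ∫ x, |v s x| ^ r) :=
    intervalIntegral.integral_nonneg hρ0.le fun s hs =>
      mul_nonneg (hζ.nonneg _) (mul_nonneg (Real.rpow_nonneg (by linarith [hs.1]) _)
        (integral_nonneg fun x => by positivity))
  have hdata0 : 0 ≤ ∫ x, wt 0 x * testWave (m + 1) ((m : ℝ) / 2 - 1 / k) R (0, x) := by
    refine integral_nonneg_of_ae ?_
    filter_upwards [(Lp.coeFn_nonneg _).2 hwt0] with x hx
    exact mul_nonneg hx (testWave_nonneg _ _ _)
  have hζ00 := hζ.nonneg 0
  have h2 := (Real.rpow_le_rpow (by positivity)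
    (le_add_of_nonneg_right (mul_nonneg hζ00 hdata0)) hk.nonneg).trans h1
  rw [Real.mul_rpow hV0.le hL0, Real.mul_rpow (by norm_num) hlog, ← le_inv_mul_iff₀ (by positivity)]
    at h2
  refine h2.trans (le_of_eq ?_)
  ring

/-- The choice `δ = 2`: the initial velocity, averaged against a rapidly decaying test function,
forces the solution to be large near the light cone on every scale. -/
theorem growth_data (m : ℕ) {R k k' M : ℝ} (hR : 0 < R) (hk : k.HolderConjugate k')
    (hm : 2 ≤ m)
    {κ ζ : ℝ → ℝ} (hM : 0 ≤ M) (hκc : Continuous κ) (hκ0 : ∀ a, 0 ≤ κ a)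
    (hκl : ∀ a, a ≤ 1 / 2 → κ a = 0) (hκr : ∀ a, 1 ≤ a → κ a = 0) (hζ : IsCutoff κ k M ζ)
    (hζ0 : 0 < ζ 0) {g : L2 (m + 1)} (hg : 0 ≤ g) (hg0 : g ≠ 0) (hgR : VanishesOutside R g) :
    ∃ C : ℝ, 0 < C ∧ ∀ (T : EReal) (w : ℝ → H1 (m + 1)) (wt : ℝ → L2 (m + 1))
      (v : ℝ → Space (m + 1) → ℝ) (r ε : ℝ), 1 ≤ r → IsCausalSolution T R r w wt v →
      ContinuousIntoLr k (timeInterval T) (fun s => ((w s).fn : Space (m + 1) → ℝ)) →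
      0 ≤ (w 0).fn → 0 < ε → wt 0 = ε • g → ∀ ρ : ℝ, R + 2 ≤ ρ → ρ ∈ timeInterval T →
      ε ^ k ≤ C * ρ ^ ((m : ℝ) / 2 * k - m - 1)
        * ∫ s in (0 : ℝ)..ρ, κ (s / ρ) * ∫ x, |(w s).fn x| ^ k := by
  have hm' : (1 : ℝ) ≤ (m : ℝ) / 2 := by
    have : (2 : ℝ) ≤ m := by exact_mod_cast hm
    linarith
  set β : ℝ := (m : ℝ) / 2 + 2 / k' - 1 with hβdef
  have hk' := hk.symm.pos
  have hβ : 0 ≤ β := by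
    have : 0 < 2 / k' := by positivity
    linarith
  obtain ⟨C, hC, h⟩ := scale_inequality_cone m (δ := 2) hR hk hβ two_pos (by linarith)
    hM hκc hκ0 hκl hκr hζ
  have hgn := (Lp.coeFn_nonneg g).2 hg
  -- the test function is bounded below on the support of the data
  set V := volume.real (Metric.ball (0 : Space (m + 1)) 1) with hV
  have hV0 : 0 < V := volume_ball_pos
  set G := ∫ x, g x * testWave (m + 1) β R (0, x) with hG
  have hG0 : 0 < G := by
    have hint : Integrable fun x => g x * testWave (m + 1) β R (0, x) := by
      have hgi : IntegrableOn (fun x => g x * testWave (m + 1) β R (0, x))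
          (Metric.closedBall 0 R) :=
        (((Lp.memLp g).locallyIntegrable (by norm_num)).integrableOn_isCompact
          (isCompact_closedBall _ _)).mul_continuousOn
          (continuous_slice (contDiff_testWave β R).continuous 0).continuousOn
          (isCompact_closedBall _ _)
      refine hgi.integrable_of_ae_notMem_eq_zero ?_
      filter_upwards [hgR] with x hx hxB
      rw [hx (by simpa using hxB), zero_mul]
    have hnn : 0 ≤ᵐ[volume] fun x => g x * testWave (m + 1) β R (0, x) := by
      filter_upwards [hgn] with x hx
      exact mul_nonneg hx (testWave_nonneg _ _ _)
    refine lt_of_le_of_ne (integral_nonneg_of_ae hnn) fun h0 => hg0 ?_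
    have hz := (integral_eq_zero_iff_of_nonneg_ae hnn hint).1 h0.symm
    refine Lp.eq_zero_iff_ae_eq_zero.2 ?_
    filter_upwards [hz, hgR] with x hx1 hx2
    by_cases hxR : ‖x‖ ≤ R
    · have h1 := le_phaseMean hβ (show ‖x‖ ≤ (0 + R + 1) - 1 by linarith)
      rw [← testWave_eq (by linarith)] at h1
      have h2 : 0 < testWave (m + 1) β R (0, x) :=
        lt_of_lt_of_le (mul_pos volume_ball_pos (by positivity)) h1
      rcases mul_eq_zero.1 hx1 with h3 | h3
      · exact h3
      · exact absurd h3 h2.ne'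
    · exact hx2 (not_le.1 hxR)
  refine ⟨((ζ 0 * G) ^ k)⁻¹ * C, by positivity,
    fun T w wt v r ε hr hsol hwk hw0 hε hwt0 ρ hρR hρ => ?_⟩
  have hρ0 : 0 < ρ := by linarith
  have hwtn : 0 ≤ wt 0 := by
    rw [hwt0, ← Lp.coeFn_nonneg]
    filter_upwards [Lp.coeFn_smul ε g, hgn] with x hx1 hx2
    rw [hx1]
    exact mul_nonneg hε.le hx2
  have h1 := h T w wt v r hr hsol hwk hw0 hwtn ρ 1 (by linarith) hρ zero_le_one fun s hs =>
    integral_sub_rpow_neg_two (by linarith [hs.1])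
  have hL0 : 0 ≤ ∫ s in (0 : ℝ)..ρ, ζ (s / ρ) * ((s + R + 1) ^ (-β) *
      ∫ x, |v s x| ^ r) :=
    intervalIntegral.integral_nonneg hρ0.le fun s hs =>
      mul_nonneg (hζ.nonneg _) (mul_nonneg (Real.rpow_nonneg (by linarith [hs.1]) _)
        (integral_nonneg fun x => by positivity))
  have hdat : ∫ x, wt 0 x * testWave (m + 1) β R (0, x) = ε * G := by
    rw [hG, ← integral_const_mul]
    refine integral_congr_ae ?_
    rw [hwt0]
    filter_upwards [Lp.coeFn_smul ε g] with x hx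
    rw [hx, Pi.smul_apply, smul_eq_mul, mul_assoc]
  rw [hdat, Real.one_rpow, mul_one] at h1
  have h2 := (Real.rpow_le_rpow (by positivity) (le_add_of_nonneg_left
    (mul_nonneg (by positivity : 0 ≤ V * 2 ^ (-β)) hL0)) hk.nonneg).trans h1
  rw [show ζ 0 * (ε * G) = (ζ 0 * G) * ε by ring, Real.mul_rpow (by positivity) hε.le,
    ← le_inv_mul_iff₀ (by positivity)] at h2
  refine h2.trans (le_of_eq ?_)
  ring

/-- The test function that is constant in space. -/
theorem growth_const (m : ℕ) {R k k' M : ℝ} (hR : 0 < R) (hk : k.HolderConjugate k')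
    {κ ζ : ℝ → ℝ} (hM : 0 ≤ M) (hκc : Continuous κ) (hκ0 : ∀ a, 0 ≤ κ a)
    (hκl : ∀ a, a ≤ 1 / 2 → κ a = 0) (hκr : ∀ a, 1 ≤ a → κ a = 0) (hζ : IsCutoff κ k M ζ) :
    ∃ C : ℝ, 0 < C ∧ ∀ (T : EReal) (w : ℝ → H1 (m + 1)) (wt : ℝ → L2 (m + 1))
      (v : ℝ → Space (m + 1) → ℝ) (r : ℝ), 1 ≤ r → IsCausalSolution T R r w wt v →
      ContinuousIntoLr k (timeInterval T) (fun s => ((w s).fn : Space (m + 1) → ℝ)) →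
      0 ≤ (w 0).fn → 0 ≤ wt 0 → ∀ ρ : ℝ, R + 2 ≤ ρ → ρ ∈ timeInterval T →
      (∫ s in (0 : ℝ)..ρ, ζ (s / ρ) * ∫ x, |v s x| ^ r) ^ k
      ≤ C * ρ ^ ((m : ℝ) * k - m - 2)
        * ∫ s in (0 : ℝ)..ρ, κ (s / ρ) * ∫ x, |(w s).fn x| ^ k := by
  set V := volume.real (Metric.ball (0 : Space (m + 1)) 1) with hV
  have hV0 : 0 < V := volume_ball_pos
  have hk1 : 0 < k - 1 := sub_pos.2 hk.lt
  set D : ℝ := V ^ k' * (2 ^ (m + 1) * V) with hD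
  have hD0 : 0 < D := by positivity
  refine ⟨(V ^ k)⁻¹ * ((M + 1) ^ k * D ^ (k - 1)), by positivity,
    fun T w wt v r hr hsol hwk hw0 hwt0 ρ hρR hρ => ?_⟩
  have hρ0 : 0 < ρ := by linarith
  have hE0 : 0 ≤ ∫ s in (0 : ℝ)..ρ, κ (s / ρ) * ∫ x, |(w s).fn x| ^ k :=
    intervalIntegral.integral_nonneg hρ0.le fun s _ =>
      mul_nonneg (hκ0 _) (integral_nonneg fun x => by positivity)
  have hK : ∀ s ∈ Icc (ρ / 2) ρ, ∫ x in Metric.closedBall (0 : Space (m + 1)) (s + R),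
      (testWave (m + 1) 0 R (s, x) / ρ ^ 2
        + 2 / ρ * |timeDeriv (testWave (m + 1) 0 R) (s, x)|) ^ k'
      ≤ D * ρ ^ (-(2 * k') + (m + 1)) := by
    intro s hs
    have hc : ∀ x ∈ Metric.closedBall (0 : Space (m + 1)) (s + R),
        (testWave (m + 1) 0 R (s, x) / ρ ^ 2
          + 2 / ρ * |timeDeriv (testWave (m + 1) 0 R) (s, x)|) ^ k' = (V / ρ ^ 2) ^ k' := by
      intro x hx
      have hx' : ‖x‖ ≤ s + R := by simpa using hx
      rw [testWave_eq hx', timeDeriv_testWave_eq hx']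
      have : phaseMean 0 (s + R + 1) x = V := by
        simp [phaseMean, hV]
      simp [this]
    rw [setIntegral_congr_fun Metric.isClosed_closedBall.measurableSet hc, setIntegral_const,
      smul_eq_mul, measureReal_def, Measure.addHaar_closedBall _ _ (by linarith [hs.1]),
      ENNReal.toReal_mul, ENNReal.toReal_ofReal (pow_nonneg (by linarith [hs.1]) _),
      ← measureReal_def, ← hV, finrank_euclideanSpace_fin]
    have h1 : (V / ρ ^ 2) ^ k' = V ^ k' * ρ ^ (-(2 * k')) := by
      rw [Real.div_rpow hV0.le (by positivity), ← Real.rpow_natCast, ← Real.rpow_mul hρ0.le,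
        Real.rpow_neg hρ0.le, div_eq_mul_inv]
      norm_num
    have h2 : (s + R) ^ (m + 1) ≤ (2 * ρ) ^ (m + 1) :=
      pow_le_pow_left₀ (by linarith [hs.1]) (by linarith [hs.2]) _
    have h3 : ρ ^ (-(2 * k') + ((m : ℝ) + 1)) = ρ ^ (-(2 * k')) * ρ ^ (m + 1) := by
      rw [Real.rpow_add hρ0, ← Real.rpow_natCast ρ (m + 1)]
      push_cast
      ring
    rw [h1, h3, hD]
    calc (s + R) ^ (m + 1) * V * (V ^ k' * ρ ^ (-(2 * k')))
        ≤ (2 * ρ) ^ (m + 1) * V * (V ^ k' * ρ ^ (-(2 * k'))) := by gcongr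
      _ = _ := by rw [mul_pow]; ring
  have h1 := scale_inequality_testWave hR hr hsol hk hwk hw0 hwt0 le_rfl hM hκc
    hκ0 hκl hκr hζ hρ0 hρ (K := D * ρ ^ (-(2 * k') + ((m : ℝ) + 1))) (by positivity) hK
  have e0 : ∀ s, (s + R + 1) ^ (-(0 : ℝ)) = 1 := fun s => by simp
  have e0' : (2 : ℝ) ^ (-(0 : ℝ)) = 1 := by simp
  simp only [e0, e0', mul_one, one_mul] at h1
  have hL0 : 0 ≤ ∫ s in (0 : ℝ)..ρ, ζ (s / ρ) * ∫ x, |v s x| ^ r :=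
    intervalIntegral.integral_nonneg hρ0.le fun s hs =>
      mul_nonneg (hζ.nonneg _) (integral_nonneg fun x => by positivity)
  have hdata0 : 0 ≤ ∫ x, wt 0 x * testWave (m + 1) 0 R (0, x) := by
    refine integral_nonneg_of_ae ?_
    filter_upwards [(Lp.coeFn_nonneg _).2 hwt0] with x hx
    exact mul_nonneg hx (testWave_nonneg _ _ _)
  have hζ00 := hζ.nonneg 0
  have h2 := (Real.rpow_le_rpow (by positivity)
    (le_add_of_nonneg_right (mul_nonneg hζ00 hdata0)) hk.nonneg).trans h1
  rw [← hV, Real.mul_rpow hV0.le hL0, ← le_inv_mul_iff₀ (by positivity)] at h2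
  refine h2.trans ?_
  have e1 : D * ρ ^ (-(2 * k') + ((m : ℝ) + 1)) * ρ = D * ρ ^ (-(2 * k') + ((m : ℝ) + 1) + 1) := by
    rw [Real.rpow_add_one hρ0.ne']
    ring
  have e2 : (-(2 * k') + ((m : ℝ) + 1) + 1) * (k - 1) = (m : ℝ) * k - m - 2 := by
    have := rpow_conj_mul hk
    linear_combination (-2 : ℝ) * this
  rw [e1, Real.mul_rpow hD0.le (by positivity), ← Real.rpow_mul hρ0.le, e2]
  have hMk : M ^ k ≤ (M + 1) ^ k := Real.rpow_le_rpow hM (by linarith) hk.nonneg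
  calc (V ^ k)⁻¹ * (M ^ k * (D ^ (k - 1) * ρ ^ ((m : ℝ) * k - m - 2)) *
        ∫ s in (0 : ℝ)..ρ, κ (s / ρ) * ∫ x, |(w s).fn x| ^ k)
      ≤ (V ^ k)⁻¹ * ((M + 1) ^ k * (D ^ (k - 1) * ρ ^ ((m : ℝ) * k - m - 2)) *
        ∫ s in (0 : ℝ)..ρ, κ (s / ρ) * ∫ x, |(w s).fn x| ^ k) := by gcongr
    _ = _ := by ring

end growth

/-! ### The ordinary differential inequality in logarithmic time -/

section ode

/-- A function growing at least linearly that satisfies `Z' ≥ c Z^K τ^(-μ)` cannot live on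
`[S, 3S]` once `S` is large. -/
lemma le_of_growth_inequalities {Z Z' : ℝ → ℝ} {S A c K μ : ℝ} (hS : 0 < S) (hA : 0 < A)
    (hc : 0 < c) (hK : 1 < K) (hμ : 0 ≤ μ)
    (hd : ∀ τ ∈ Icc S (3 * S), HasDerivAt Z (Z' τ) τ) (h0 : 0 ≤ Z S)
    (h1 : ∀ τ ∈ Icc S (3 * S), A ≤ Z' τ)
    (h2 : ∀ τ ∈ Icc S (3 * S), c * Z τ ^ K * τ ^ (-μ) ≤ Z' τ) :
    (K - 1) * c * (3 * S) ^ (-μ) * S ≤ (A * S) ^ (1 - K) := by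
  have hcont : ContinuousOn Z (Icc S (3 * S)) := fun τ hτ =>
    (hd τ hτ).continuousAt.continuousWithinAt
  have hlin : ∀ τ ∈ Icc S (3 * S), A * (τ - S) ≤ Z τ := by
    intro τ hτ
    have := (convex_Icc S (3 * S)).mul_sub_le_image_sub_of_le_deriv hcont
      (fun x hx => (hd x (interior_subset hx)).differentiableAt.differentiableWithinAt)
      (C := A) (fun x hx => by
        rw [(hd x (interior_subset hx)).deriv]
        exact h1 x (interior_subset hx)) S (left_mem_Icc.2 (by linarith)) τ hτ hτ.1
    linarith
  have hsub : Icc (2 * S) (3 * S) ⊆ Icc S (3 * S) := Icc_subset_Icc_left (by linarith)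
  have hZ : ∀ τ ∈ Icc (2 * S) (3 * S), 0 < Z τ := fun τ hτ => by
    have := hlin τ (hsub hτ)
    nlinarith [hτ.1]
  have hdG : ∀ τ ∈ Icc (2 * S) (3 * S),
      HasDerivAt (fun τ => Z τ ^ (1 - K)) (Z' τ * (1 - K) * Z τ ^ (1 - K - 1)) τ := fun τ hτ =>
    (hd τ (hsub hτ)).rpow_const (Or.inl (hZ τ hτ).ne')
  have hG := (convex_Icc (2 * S) (3 * S)).image_sub_le_mul_sub_of_deriv_le
    (fun τ hτ => (hdG τ hτ).continuousAt.continuousWithinAt)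
    (fun x hx => (hdG x (interior_subset hx)).differentiableAt.differentiableWithinAt)
    (C := -((K - 1) * c * (3 * S) ^ (-μ))) (fun x hx => by
      have hx' := interior_subset hx
      have hx0 : 0 < x := by linarith [hx'.1]
      rw [(hdG x hx').deriv]
      have h3 := h2 x (hsub hx')
      have h4 : (3 * S) ^ (-μ) ≤ x ^ (-μ) :=
        Real.rpow_le_rpow_of_nonpos hx0 hx'.2 (by linarith)
      have hz := hZ x hx'
      have h5 : Z x ^ K * Z x ^ (1 - K - 1) = 1 := by
        rw [← Real.rpow_add hz]
        simp
      have h6 : c * (3 * S) ^ (-μ) ≤ Z' x * Z x ^ (1 - K - 1) := by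
        calc c * (3 * S) ^ (-μ) ≤ c * x ^ (-μ) := by gcongr
          _ = (c * Z x ^ K * x ^ (-μ)) * Z x ^ (1 - K - 1) := by
            linear_combination (-c * x ^ (-μ)) * h5
          _ ≤ _ := by gcongr
      nlinarith)
    (2 * S) (left_mem_Icc.2 (by linarith)) (3 * S) (right_mem_Icc.2 (by linarith)) (by linarith)
  have h7 : 0 ≤ Z (3 * S) ^ (1 - K) :=
    Real.rpow_nonneg (hZ _ (right_mem_Icc.2 (by linarith))).le _
  have h8 : Z (2 * S) ^ (1 - K) ≤ (A * S) ^ (1 - K) := by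
    refine Real.rpow_le_rpow_of_nonpos (by positivity) ?_ (by linarith)
    have := hlin (2 * S) ⟨by linarith, by linarith⟩
    linarith
  nlinarith

/-- Differentiating in the scale: since `κ = -ψ'`, the derivative of `∫ ψ(s/ρ) w(s) ds` controls
`∫ κ(s/ρ) w(s) ds`. -/
lemma hasDerivAt_scale {κ ψ : ℝ → ℝ} (hκc : Continuous κ)
    (hψ : ∀ a, HasDerivAt ψ (-κ a) a) {w : ℝ → ℝ} {L : ℝ} (hL : 0 ≤ L)
    (hκl : ∀ a, a ≤ 1 / 2 → κ a = 0) (hκr : ∀ a, 1 ≤ a → κ a = 0)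
    (hw : ContinuousOn w (Icc 0 L)) {ρ : ℝ} (hρ : 0 < ρ) :
    HasDerivAt (fun ρ => ∫ s in (0 : ℝ)..L, ψ (s / ρ) * w s)
      (∫ s in (0 : ℝ)..L, κ (s / ρ) * (s / ρ ^ 2) * w s) ρ := by
  have hψc : Continuous ψ := continuous_iff_continuousAt.2 fun a => (hψ a).continuousAt
  obtain ⟨B, hB⟩ := isCompact_Icc.exists_bound_of_continuousOn (s := Icc (1 / 2 : ℝ) 1)
    hκc.continuousOn
  have hB0 : 0 ≤ B := (norm_nonneg _).trans (hB 1 ⟨by norm_num, le_rfl⟩)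
  have hB' : ∀ a, ‖κ a‖ ≤ B := fun a => by
    by_cases ha : a ∈ Icc (1 / 2 : ℝ) 1
    · exact hB a ha
    · have : κ a = 0 := by
        rcases le_total a (1 / 2) with h | h
        · exact hκl a h
        · exact hκr a (by
            by_contra h1
            exact ha ⟨h, by linarith⟩)
      simp [this, hB0]
  rw [← uIcc_of_le hL] at hw
  have hcont (f : ℝ → ℝ) (hf : Continuous f) :
      IntervalIntegrable (fun s => f s * w s) volume 0 L :=
    (hf.continuousOn.mul hw).intervalIntegrable
  refine (intervalIntegral.hasDerivAt_integral_of_dominated_loc_of_deriv_le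
    (F := fun ρ s => ψ (s / ρ) * w s) (F' := fun ρ s => κ (s / ρ) * (s / ρ ^ 2) * w s)
    (s := Metric.ball ρ (ρ / 2)) (bound := fun s => B * (L / (ρ / 2) ^ 2) * |w s|)
    (Metric.ball_mem_nhds ρ (by positivity)) (Eventually.of_forall fun r =>
      (hcont _ (hψc.comp (continuous_id.div_const r))).def'.aestronglyMeasurable)
    (hcont _ (hψc.comp (continuous_id.div_const ρ)))
    (hcont _ ((hκc.comp (continuous_id.div_const ρ)).mul
      (continuous_id.div_const (ρ ^ 2)))).def'.aestronglyMeasurable ?_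
    (continuousOn_const.mul hw.abs).intervalIntegrable ?_).2
  · refine Eventually.of_forall fun s hs r hr => ?_
    rw [uIoc_of_le hL] at hs
    have hr' : |r - ρ| < ρ / 2 := by simpa [Real.dist_eq] using hr
    have hr1 : ρ / 2 ≤ r := by linarith [(abs_lt.1 hr').1]
    rw [norm_mul, norm_mul, Real.norm_eq_abs (w s), Real.norm_of_nonneg
      (div_nonneg hs.1.le (sq_nonneg r))]
    have hs0 := hs.1.le
    have h1 := hB' (s / r)
    have h2 : s / r ^ 2 ≤ L / (ρ / 2) ^ 2 := by
      gcongr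
      exact hs.2
    have h3 : 0 ≤ s / r ^ 2 := by positivity
    gcongr
  · refine Eventually.of_forall fun s hs r hr => ?_
    have hr' : |r - ρ| < ρ / 2 := by simpa [Real.dist_eq] using hr
    have hr0 : 0 < r := by linarith [(abs_lt.1 hr').1]
    have h1 : HasDerivAt (fun r : ℝ => s / r) (-(s / r ^ 2)) r := by
      have := (hasDerivAt_inv hr0.ne').const_mul s
      simpa [div_eq_mul_inv] using this
    have h2 := ((hψ (s / r)).comp r h1).mul_const (w s)
    simpa using h2

/-- Lifespan estimate from the two growth inequalities for a nonnegative density `w`. -/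
theorem lifespan_of_growth {κ ψ : ℝ → ℝ} (hκc : Continuous κ) (hκ0 : ∀ a, 0 ≤ κ a)
    (hκl : ∀ a, a ≤ 1 / 2 → κ a = 0) (hκr : ∀ a, 1 ≤ a → κ a = 0)
    (hψ : ∀ a, HasDerivAt ψ (-κ a) a) (hψ0 : ∀ a, 0 ≤ ψ a) (hψr : ∀ a, 1 ≤ a → ψ a = 0)
    {c₁ c₂ ρ₀ a K μ : ℝ} (hc₁ : 0 < c₁) (hc₂ : 0 < c₂) (hK : 1 < K)
    (hμ : 0 ≤ μ) (hμK : μ < K) :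
    ∃ C : ℝ, 0 < C ∧ ∀ (ε : ℝ), 0 < ε → ε ≤ 1 → 0 ≤ a → ∀ (T : EReal) (w : ℝ → ℝ),
      ContinuousOn w (timeInterval T) → (∀ s ∈ timeInterval T, 0 ≤ w s) →
      (∀ ρ ∈ timeInterval T, ρ₀ ≤ ρ → c₁ * ε ^ a ≤ ∫ s in (0 : ℝ)..ρ, κ (s / ρ) * w s) →
      (∀ ρ ∈ timeInterval T, ρ₀ ≤ ρ →
        c₂ * (∫ s in (0 : ℝ)..ρ, ψ (s / ρ) * w s) ^ K * Real.log ρ ^ (-μ)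
          ≤ ∫ s in (0 : ℝ)..ρ, κ (s / ρ) * w s) →
      T ≤ ((Real.exp (C * ε ^ (-(a * (K - 1) / (K - μ)))) : ℝ) : EReal) := by
  have hKμ : 0 < K - μ := sub_pos.2 hμK
  set D : ℝ := (c₁ / 2) ^ (1 - K) / ((K - 1) * (c₂ / 2) * 3 ^ (-μ)) with hD
  have hK1 : 0 < K - 1 := sub_pos.2 hK
  have hD0 : 0 < D := by positivity
  set C₀ : ℝ := D ^ (K - μ)⁻¹ + |Real.log ρ₀| + 1 with hC₀
  have hC₀0 : 0 < C₀ := by positivity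
  refine ⟨3 * C₀, by positivity, fun ε hε hε1 ha T w hw hw0 hy1 hy2 => ?_⟩
  set lam := a * (K - 1) / (K - μ) with hlam
  have hlam0 : 0 ≤ lam := by positivity
  by_contra hT
  rw [not_le] at hT
  set S := C₀ * ε ^ (-lam) with hS
  have hεl : 1 ≤ ε ^ (-lam) :=
    Real.one_le_rpow_of_pos_of_le_one_of_nonpos hε hε1 (by linarith)
  have hS0 : 0 < S := by positivity
  have hSC : C₀ ≤ S := le_mul_of_one_le_right hC₀0.le hεl
  set L := Real.exp (3 * S) with hL
  have hL0 : 0 < L := Real.exp_pos _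
  have hLT : L ∈ timeInterval T := ⟨hL0.le, by
    rw [hL, hS, ← mul_assoc]
    exact hT⟩
  have hsub := Icc_subset_timeInterval hLT
  have hψc : Continuous ψ := continuous_iff_continuousAt.2 fun a => (hψ a).continuousAt
  have hwL : ContinuousOn w (Icc 0 L) := hw.mono hsub
  -- beyond the scale `ρ` the cutoffs vanish
  have hext (f : ℝ → ℝ) (hf : Continuous f) (hf1 : ∀ a, 1 ≤ a → f a = 0) {ρ : ℝ} (hρ0 : 0 < ρ)
      (hρL : ρ ≤ L) : ∫ s in (0 : ℝ)..L, f (s / ρ) * w s = ∫ s in (0 : ℝ)..ρ, f (s / ρ) * w s := by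
    have hc : ContinuousOn (fun s => f (s / ρ) * w s) (Icc 0 L) :=
      (hf.comp (continuous_id.div_const ρ)).continuousOn.mul hwL
    have i1 : IntervalIntegrable (fun s => f (s / ρ) * w s) volume 0 ρ :=
      (hc.mono (by rw [uIcc_of_le hρ0.le]; exact Icc_subset_Icc_right hρL)).intervalIntegrable
    have i2 : IntervalIntegrable (fun s => f (s / ρ) * w s) volume ρ L :=
      (hc.mono (by rw [uIcc_of_le hρL]; exact Icc_subset_Icc_left hρ0.le)).intervalIntegrable
    rw [← intervalIntegral.integral_add_adjacent_intervals i1 i2]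
    have : ∫ s in ρ..L, f (s / ρ) * w s = 0 := by
      rw [intervalIntegral.integral_congr (g := fun _ => 0), intervalIntegral.integral_zero]
      intro s hs
      rw [uIcc_of_le hρL] at hs
      simp only
      rw [hf1 _ ((one_le_div hρ0).2 hs.1), zero_mul]
    rw [this, add_zero]
  set Z : ℝ → ℝ := fun τ => ∫ s in (0 : ℝ)..L, ψ (s / Real.exp τ) * w s with hZ
  set Z' : ℝ → ℝ := fun τ => (∫ s in (0 : ℝ)..L,
    κ (s / Real.exp τ) * (s / Real.exp τ ^ 2) * w s) * Real.exp τ with hZ'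
  have hd : ∀ τ, HasDerivAt Z (Z' τ) τ := fun τ =>
    (hasDerivAt_scale hκc hψ hL0.le hκl hκr hwL (Real.exp_pos τ)).comp τ (Real.hasDerivAt_exp τ)
  have hZ0 : 0 ≤ Z S := intervalIntegral.integral_nonneg hL0.le fun s hs =>
    mul_nonneg (hψ0 _) (hw0 s (hsub hs))
  have hmem : ∀ τ ∈ Icc S (3 * S), Real.exp τ ≤ L ∧ Real.exp τ ∈ timeInterval T ∧
      ρ₀ ≤ Real.exp τ := by
    intro τ hτ
    have h1 : Real.exp τ ≤ L := Real.exp_le_exp.2 hτ.2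
    refine ⟨h1, hsub ⟨(Real.exp_pos τ).le, h1⟩, ?_⟩
    rcases le_or_gt ρ₀ 0 with h | h
    · exact h.trans (Real.exp_pos τ).le
    · rw [← Real.log_le_iff_le_exp h]
      have h2 : 0 ≤ D ^ (K - μ)⁻¹ := by positivity
      linarith [le_abs_self (Real.log ρ₀), hτ.1]
  have hZy : ∀ τ ∈ Icc S (3 * S),
      (∫ s in (0 : ℝ)..Real.exp τ, κ (s / Real.exp τ) * w s) / 2 ≤ Z' τ := by
    intro τ hτ
    have hρ0 := Real.exp_pos τ
    obtain ⟨hρL, -, -⟩ := hmem τ hτ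
    rw [← hext κ hκc hκr hρ0 hρL, hZ']
    simp only
    rw [← intervalIntegral.integral_div, ← intervalIntegral.integral_mul_const]
    rw [← uIcc_of_le hL0.le] at hwL
    refine intervalIntegral.integral_mono_on hL0.le
      (((hκc.comp (continuous_id.div_const _)).continuousOn.mul hwL).div_const 2).intervalIntegrable
      ((((hκc.comp (continuous_id.div_const _)).mul
        (continuous_id.div_const _)).continuousOn.mul hwL).mul
          continuousOn_const).intervalIntegrable fun s hs => ?_
    have hws := hw0 s (hsub hs)
    rcases le_or_gt (s / Real.exp τ) (1 / 2) with h | h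
    · simp [hκl _ h]
    · have e1 : κ (s / Real.exp τ) * (s / Real.exp τ ^ 2) * w s * Real.exp τ
          = κ (s / Real.exp τ) * w s * (s / Real.exp τ) := by
        field_simp
      rw [e1, div_eq_mul_inv]
      refine mul_le_mul_of_nonneg_left ?_ (mul_nonneg (hκ0 _) hws)
      linarith
  have hfinal := le_of_growth_inequalities (Z := Z) (Z' := Z') (A := c₁ / 2 * ε ^ a)
    (c := c₂ / 2) hS0 (by positivity) (by positivity) hK hμ (fun τ _ => hd τ) hZ0
    (fun τ hτ => by
      obtain ⟨-, h2, h3⟩ := hmem τ hτ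
      have := hy1 _ h2 h3
      linarith [hZy τ hτ])
    (fun τ hτ => by
      obtain ⟨h1, h2, h3⟩ := hmem τ hτ
      have := hy2 _ h2 h3
      rw [Real.log_exp, ← hext ψ hψc hψr (Real.exp_pos τ) h1] at this
      have h4 := hZy τ hτ
      calc c₂ / 2 * Z τ ^ K * τ ^ (-μ) = (c₂ * Z τ ^ K * τ ^ (-μ)) / 2 := by ring
        _ ≤ _ := by linarith)
  -- the resulting upper bound for `S` contradicts its choice
  have hSle : S ^ (K - μ) ≤ D * (ε ^ a) ^ (1 - K) := by
    have hεa : 0 < ε ^ a := by positivity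
    rw [Real.mul_rpow (z := 1 - K) (by positivity) hS0.le,
      Real.mul_rpow (z := 1 - K) (by positivity) hεa.le,
      Real.mul_rpow (by norm_num) hS0.le] at hfinal
    have e1 : S ^ (K - μ) = S ^ (-μ) * S * S ^ (K - 1) := by
      rw [← Real.rpow_add_one hS0.ne', ← Real.rpow_add hS0]
      congr 1
      ring
    have e2 : S ^ (1 - K) * S ^ (K - 1) = 1 := by
      rw [← Real.rpow_add hS0]
      simp
    rw [hD, div_mul_eq_mul_div, le_div_iff₀ (by positivity), e1]
    have hSK : 0 < S ^ (K - 1) := by positivity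
    calc S ^ (-μ) * S * S ^ (K - 1) * ((K - 1) * (c₂ / 2) * 3 ^ (-μ))
        = ((K - 1) * (c₂ / 2) * (3 ^ (-μ) * S ^ (-μ)) * S) * S ^ (K - 1) := by ring
      _ ≤ ((c₁ / 2) ^ (1 - K) * (ε ^ a) ^ (1 - K) * S ^ (1 - K)) * S ^ (K - 1) := by gcongr
      _ = _ := by linear_combination ((c₁ / 2) ^ (1 - K) * (ε ^ a) ^ (1 - K)) * e2
  have hSgt : D * (ε ^ a) ^ (1 - K) < S ^ (K - μ) := by
    have e1 : (ε ^ a) ^ (1 - K) = (ε ^ (-lam)) ^ (K - μ) := by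
      rw [← Real.rpow_mul hε.le, ← Real.rpow_mul hε.le]
      congr 1
      rw [hlam]
      field_simp
      ring
    have e2 : D = (D ^ (K - μ)⁻¹) ^ (K - μ) := by
      rw [← Real.rpow_mul hD0.le, inv_mul_cancel₀ hKμ.ne', Real.rpow_one]
    rw [e1, hS, Real.mul_rpow hC₀0.le (by positivity)]
    refine mul_lt_mul_of_pos_right ?_ (by positivity)
    calc D = (D ^ (K - μ)⁻¹) ^ (K - μ) := e2
      _ < C₀ ^ (K - μ) := Real.rpow_lt_rpow (by positivity)
          (by linarith [abs_nonneg (Real.log ρ₀)]) hKμ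
  exact absurd hSle (not_le.2 hSgt)

end ode

/-! ### Critical exponents and the lifespan estimates -/

section critical

lemma critical_identity {m : ℕ} {p q : ℝ} (hp : 1 < p) (hpq : p ≤ q)
    (hF : criticalF p q (m + 1) = 0) : (m : ℝ) / 2 * (p * q - 1) = q + 2 + 1 / p := by
  have hp0 : 0 < p := by linarith
  have hpq1 : 0 < p * q - 1 := by nlinarith
  have hinv : q⁻¹ ≤ p⁻¹ := inv_anti₀ hp0 hpq
  have hmax : max ((q + 2 + p⁻¹) / (p * q - 1)) ((p + 2 + q⁻¹) / (p * q - 1))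
      = (q + 2 + p⁻¹) / (p * q - 1) :=
    max_eq_left (div_le_div_of_nonneg_right (by linarith) hpq1.le)
  rw [criticalF, hmax, sub_eq_zero, div_eq_iff hpq1.ne'] at hF
  push_cast at hF
  rw [one_div, hF]
  ring

/-- In dimension at least four, criticality forces `p ≤ 2`. -/
lemma le_two_of_critical {m : ℕ} {p q : ℝ} (hm : 3 ≤ m) (hpq : p ≤ q)
    (hc : (m : ℝ) / 2 * (p * q - 1) = q + 2 + 1 / p) : p ≤ 2 := by
  by_contra h
  rw [not_le] at h
  have hm' : (3 : ℝ) ≤ m := by exact_mod_cast hm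
  have h1 : 1 / p < 1 / 2 := one_div_lt_one_div_of_lt two_pos h
  have h2 : 2 * q ≤ p * q := mul_le_mul_of_nonneg_right h.le (by linarith)
  have h3 : 0 ≤ p * q - 1 := by linarith
  linarith [mul_le_mul_of_nonneg_right hm' h3]

lemma Lp_smul_nonneg {n : ℕ} {ε : ℝ} (hε : 0 ≤ ε) {g : L2 n} (hg : 0 ≤ g) : 0 ≤ ε • g := by
  rw [← Lp.coeFn_nonneg]
  filter_upwards [Lp.coeFn_smul ε g, (Lp.coeFn_nonneg g).2 hg] with x hx1 hx2
  rw [hx1]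
  exact mul_nonneg hε hx2

/-- On the scale `ρ` the weight `(s + R + 1)^(-β)` is at least `(2ρ)^(-β)`. -/
lemma integral_kernel_le {κ f : ℝ → ℝ} (hκc : Continuous κ) (hκ0 : ∀ a, 0 ≤ κ a) {β R ρ : ℝ}
    (hR : 0 < R) (hβ : 0 ≤ β) (hρ : R + 2 ≤ ρ) (hf : ContinuousOn f (Icc 0 ρ))
    (hf0 : ∀ s, 0 ≤ f s) :
    ∫ s in (0 : ℝ)..ρ, κ (s / ρ) * f s
      ≤ 2 ^ β * ρ ^ β * ∫ s in (0 : ℝ)..ρ, κ (s / ρ) * ((s + R + 1) ^ (-β) * f s) := by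
  have hρ0 : 0 < ρ := by linarith
  have hk : ContinuousOn (fun s => κ (s / ρ)) (Icc 0 ρ) :=
    (hκc.comp (continuous_id.div_const ρ)).continuousOn
  have hp : ContinuousOn (fun s : ℝ => (s + R + 1) ^ (-β)) (Icc 0 ρ) :=
    ContinuousOn.rpow_const (by fun_prop) fun s hs => Or.inl (by linarith [hs.1])
  rw [← intervalIntegral.integral_const_mul]
  rw [← uIcc_of_le hρ0.le] at hk hp hf
  refine intervalIntegral.integral_mono_on hρ0.le (hk.mul hf).intervalIntegrable
    (continuousOn_const.mul (hk.mul (hp.mul hf))).intervalIntegrable fun s hs => ?_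
  have h1 : (2 * ρ) ^ (-β) ≤ (s + R + 1) ^ (-β) :=
    Real.rpow_le_rpow_of_nonpos (by linarith [hs.1]) (by linarith [hs.2]) (by linarith)
  have h2 : 2 ^ β * ρ ^ β * (2 * ρ) ^ (-β) = 1 := by
    rw [← Real.mul_rpow (by norm_num) hρ0.le, ← Real.rpow_add (by positivity)]
    simp
  have h3 : 0 ≤ κ (s / ρ) * f s := mul_nonneg (hκ0 _) (hf0 s)
  calc κ (s / ρ) * f s = (2 ^ β * ρ ^ β * (2 * ρ) ^ (-β)) * (κ (s / ρ) * f s) := by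
        rw [h2, one_mul]
    _ ≤ (2 ^ β * ρ ^ β * (s + R + 1) ^ (-β)) * (κ (s / ρ) * f s) := by gcongr
    _ = _ := by ring

section
variable {m : ℕ} {p q R ε : ℝ} {f₁ f₂ : H1 (m + 1)} {g₁ g₂ : L2 (m + 1)} {T : EReal}
  {u v : ℝ → H1 (m + 1)} {ut vt : ℝ → L2 (m + 1)}

lemma IsEnergySolution.v_cont_Lp (h : IsEnergySolution p q R ε f₁ f₂ g₁ g₂ T u v ut vt)
    (hp : 1 < p) (hp2 : p ≤ 2) :
    ContinuousIntoLr p (timeInterval T) (fun t => ((v t).fn : Space (m + 1) → ℝ)) :=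
  continuousIntoLr_of_continuousOn hp.le hp2
    ((continuous_fst.comp continuous_subtype_val).comp_continuousOn h.v_cont)
    fun t ht => (h.support t ht).2.1

lemma IsEnergySolution.causal_u (h : IsEnergySolution p q R ε f₁ f₂ g₁ g₂ T u v ut vt)
    (hp : 1 < p) (hp2 : p ≤ 2) :
    IsCausalSolution T R p u ut (fun t => ((v t).fn : Space (m + 1) → ℝ)) where
  cont := h.u_cont
  cont_deriv := h.ut_cont
  hasDeriv := h.u_deriv
  weak := h.u_eq
  source_cont := h.v_cont_Lp hp hp2
  support t ht := (h.support t ht).1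
  support_deriv t ht := (h.support t ht).2.2.1
  source_support t ht := (h.support t ht).2.1

lemma IsEnergySolution.causal_v (h : IsEnergySolution p q R ε f₁ f₂ g₁ g₂ T u v ut vt) :
    IsCausalSolution T R q v vt (fun t => ((u t).fn : Space (m + 1) → ℝ)) where
  cont := h.v_cont
  cont_deriv := h.vt_cont
  hasDeriv := h.v_deriv
  weak := h.v_eq
  source_cont := h.u_cont_Lq
  support t ht := (h.support t ht).2.1
  support_deriv t ht := (h.support t ht).2.2.2
  source_support t ht := (h.support t ht).1

end

/-- The lifespan estimate obtained by feeding the second equation into the first. It holds for all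
`p ≤ q`, but is not optimal for `p = q`. -/
theorem lifespan_system {m : ℕ} (hm : 3 ≤ m) {p q : ℝ} (hp : 1 < p) (hpq : p ≤ q)
    (hc : (m : ℝ) / 2 * (p * q - 1) = q + 2 + 1 / p) {R : ℝ} (hR : 0 < R)
    {f₁ f₂ : H1 (m + 1)} {g₁ g₂ : L2 (m + 1)} (hg₂R : VanishesOutside R g₂)
    (hf₁ : 0 ≤ f₁.fn) (hf₂ : 0 ≤ f₂.fn) (hg₁ : 0 ≤ g₁) (hg₂ : 0 ≤ g₂) (hg₂0 : g₂ ≠ 0) :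
    ∃ C : ℝ, 0 < C ∧ ∀ ε : ℝ, 0 < ε → ε ≤ 1 → ∀ T : EReal, 0 < T →
      ∀ (u v : ℝ → H1 (m + 1)) (ut vt : ℝ → L2 (m + 1)),
        IsEnergySolution p q R ε f₁ f₂ g₁ g₂ T u v ut vt →
        T ≤ ((Real.exp (C * ε ^ (-(p * (p * q - 1)))) : ℝ) : EReal) := by
  have hp2 := le_two_of_critical hm hpq hc
  have hq : 1 < q := hp.trans_le hpq
  have hp0 : 0 < p := by linarith
  have hq0 : 0 < q := by linarith
  have hm' : (3 : ℝ) ≤ m := by exact_mod_cast hm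
  obtain ⟨κ, ψ, M, hM, hκc, hκ0, hκl, hκr, hψ, hψ00, hcut⟩ := exists_cutoffs hp
  obtain ⟨-, hψp⟩ := hcut p le_rfl
  obtain ⟨hκq, -⟩ := hcut q hpq
  have hp' := Real.HolderConjugate.conjExponent hp
  have hq' := Real.HolderConjugate.conjExponent hq
  have h1p : 1 / p < 1 := by
    rw [div_lt_one hp0]
    exact hp
  obtain ⟨C₁, hC₁, hlog⟩ := growth_log m hR hp' (by linarith) hM.le hκc hκ0 hκl hκr hψp
  obtain ⟨C₂, hC₂, hconst⟩ := growth_const m hR hq' hM.le hκc hκ0 hκl hκr hκq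
  obtain ⟨C₃, hC₃, hdata⟩ := growth_data m hR hp' (by omega) hM.le hκc hκ0 hκl hκr hψp hψ00 hg₂ hg₂0
    hg₂R
  set β : ℝ := (m : ℝ) / 2 - 1 / p with hβ
  have hβ0 : 0 ≤ β := by linarith
  set e : ℝ := (m : ℝ) / 2 * p - m - 1 with he
  -- criticality: all powers of the scale cancel
  have hexp : e * q + ((m : ℝ) * q - m - 2 + β) = 0 := by
    rw [he, hβ]
    linear_combination hc
  have hpq1 : 1 < p * q := by nlinarith
  obtain ⟨C, hC, hlife⟩ := lifespan_of_growth hκc hκ0 hκl hκr hψ hψp.nonneg hψp.eq_zero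
    (c₁ := (C₃ ^ q * (C₂ * 2 ^ β))⁻¹) (c₂ := (C₁ ^ q * (C₂ * 2 ^ β))⁻¹) (ρ₀ := R + 2) (a := p * q)
    (K := p * q) (μ := (p - 1) * q) (by positivity) (by positivity) hpq1
    (mul_nonneg (by linarith) hq0.le) (by linarith)
  refine ⟨C, hC, fun ε hε hε1 T hT u v ut vt hsol => ?_⟩
  have h0 : (0 : ℝ) ∈ timeInterval T := ⟨le_rfl, by simpa using hT⟩
  have hu := hsol.causal_u hp hp2
  have hv := hsol.causal_v
  have hvp := hsol.v_cont_Lp hp hp2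
  have hu0 : 0 ≤ (u 0).fn := by
    rw [hsol.u_init]
    exact Lp_smul_nonneg hε.le hf₁
  have hv0 : 0 ≤ (v 0).fn := by
    rw [hsol.v_init]
    exact Lp_smul_nonneg hε.le hf₂
  have hut0 : 0 ≤ ut 0 := by
    rw [hsol.ut_init]
    exact Lp_smul_nonneg hε.le hg₁
  have hvt0 : 0 ≤ vt 0 := by
    rw [hsol.vt_init]
    exact Lp_smul_nonneg hε.le hg₂
  set b : ℝ → ℝ := fun s => ∫ x, |(u s).fn x| ^ q with hb
  have hb0 : ∀ s, 0 ≤ b s := fun s => integral_nonneg fun x => by positivity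
  have hbc : ContinuousOn b (timeInterval T) := continuousOn_integral_rpow hq.le hsol.u_cont_Lq
  -- the second equation, on the scale `ρ`
  have hD (ρ : ℝ) (hρT : ρ ∈ timeInterval T) (hρ : R + 2 ≤ ρ) :
      (∫ s in (0 : ℝ)..ρ, κ (s / ρ) * ∫ x, |(v s).fn x| ^ p) ^ q
        ≤ C₂ * 2 ^ β * ρ ^ ((m : ℝ) * q - m - 2 + β)
          * ∫ s in (0 : ℝ)..ρ, κ (s / ρ) * ((s + R + 1) ^ (-β) * b s) := by
    have hρ0 : 0 < ρ := by linarith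
    refine (hconst T u ut _ p hp.le hu hsol.u_cont_Lq hu0 hut0 ρ hρ hρT).trans ?_
    have := integral_kernel_le hκc hκ0 hR hβ0 hρ (hbc.mono (Icc_subset_timeInterval hρT)) hb0
    rw [Real.rpow_add hρ0]
    calc _ ≤ C₂ * ρ ^ ((m : ℝ) * q - m - 2) * (2 ^ β * ρ ^ β *
          ∫ s in (0 : ℝ)..ρ, κ (s / ρ) * ((s + R + 1) ^ (-β) * b s)) := by gcongr
      _ = _ := by ring
  have hD0 (ρ : ℝ) (hρ : R + 2 ≤ ρ) : 0 ≤ ∫ s in (0 : ℝ)..ρ, κ (s / ρ) * ∫ x, |(v s).fn x| ^ p :=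
    intervalIntegral.integral_nonneg (by linarith) fun s _ =>
      mul_nonneg (hκ0 _) (integral_nonneg fun x => by positivity)
  have hcancel {ρ : ℝ} (hρ : 0 < ρ) : (ρ ^ e) ^ q * ρ ^ ((m : ℝ) * q - m - 2 + β) = 1 := by
    rw [← Real.rpow_mul hρ.le, ← Real.rpow_add hρ, hexp, Real.rpow_zero]
  have hfin := hlife ε hε hε1 (by positivity) T (fun s => (s + R + 1) ^ (-β) * b s)
    (ContinuousOn.mul (ContinuousOn.rpow_const (by fun_prop) fun s hs =>
      Or.inl (by linarith [hs.1])) hbc)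
    (fun s hs => mul_nonneg (Real.rpow_nonneg (by linarith [hs.1]) _) (hb0 s))
    (fun ρ hρT hρ => by
      have hρ0 : 0 < ρ := by linarith
      rw [inv_mul_le_iff₀ (by positivity)]
      have h1 := hdata T v vt _ q ε hq.le hv hvp hv0 hε hsol.vt_init ρ hρ hρT
      have h2 := Real.rpow_le_rpow (by positivity) h1 hq0.le
      rw [← Real.rpow_mul hε.le, Real.mul_rpow (by positivity) (hD0 ρ hρ),
        Real.mul_rpow hC₃.le (by positivity)] at h2
      refine h2.trans ((mul_le_mul_of_nonneg_left (hD ρ hρT hρ) (by positivity)).trans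
        (le_of_eq ?_))
      linear_combination (C₃ ^ q * (C₂ * 2 ^ β) * ∫ s in (0 : ℝ)..ρ, κ (s / ρ) *
        ((s + R + 1) ^ (-β) * b s)) * hcancel hρ0)
    (fun ρ hρT hρ => by
      have hρ0 : 0 < ρ := by linarith
      have hl0 : 0 < Real.log ρ := Real.log_pos (by linarith)
      have h1 := hlog T v vt _ q hq.le hv hvp hv0 hvt0 ρ hρ hρT
      have hW0 : 0 ≤ ∫ s in (0 : ℝ)..ρ, ψ (s / ρ) * ((s + R + 1) ^ (-β) * b s) :=
        intervalIntegral.integral_nonneg hρ0.le fun s hs => mul_nonneg (hψp.nonneg _)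
          (mul_nonneg (Real.rpow_nonneg (by linarith [hs.1]) _) (hb0 s))
      have h2 := Real.rpow_le_rpow (Real.rpow_nonneg hW0 _) h1 hq0.le
      rw [← Real.rpow_mul hW0, Real.mul_rpow (by positivity) (hD0 ρ hρ),
        Real.mul_rpow (by positivity) (by positivity), Real.mul_rpow hC₁.le (by positivity),
        ← Real.rpow_mul hl0.le] at h2
      have h3 := h2.trans (mul_le_mul_of_nonneg_left (hD ρ hρT hρ) (by positivity))
      rw [mul_assoc, inv_mul_le_iff₀ (by positivity), Real.rpow_neg hl0.le, ← div_eq_mul_inv,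
        div_le_iff₀ (by positivity)]
      refine h3.trans (le_of_eq ?_)
      linear_combination (C₁ ^ q * Real.log ρ ^ ((p - 1) * q) * (C₂ * 2 ^ β) *
        ∫ s in (0 : ℝ)..ρ, κ (s / ρ) * ((s + R + 1) ^ (-β) * b s)) * hcancel hρ0)
  have hlam : p * q * (p * q - 1) / (p * q - (p - 1) * q) = p * (p * q - 1) := by
    rw [show p * q - (p - 1) * q = q by ring]
    field_simp
  rwa [hlam] at hfin

/-- For equal powers both equations are tested with the same function and added, which loses only
one logarithm instead of two. -/
theorem lifespan_symmetric {m : ℕ} (hm : 3 ≤ m) {p : ℝ} (hp : 1 < p)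
    (hc : (m : ℝ) / 2 * (p * p - 1) = p + 2 + 1 / p) {R : ℝ} (hR : 0 < R)
    {f₁ f₂ : H1 (m + 1)} {g₁ g₂ : L2 (m + 1)} (hg₂R : VanishesOutside R g₂)
    (hf₁ : 0 ≤ f₁.fn) (hf₂ : 0 ≤ f₂.fn) (hg₁ : 0 ≤ g₁) (hg₂ : 0 ≤ g₂) (hg₂0 : g₂ ≠ 0) :
    ∃ C : ℝ, 0 < C ∧ ∀ ε : ℝ, 0 < ε → ε ≤ 1 → ∀ T : EReal, 0 < T →
      ∀ (u v : ℝ → H1 (m + 1)) (ut vt : ℝ → L2 (m + 1)),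
        IsEnergySolution p p R ε f₁ f₂ g₁ g₂ T u v ut vt →
        T ≤ ((Real.exp (C * ε ^ (-(p * (p - 1)))) : ℝ) : EReal) := by
  have hp2 := le_two_of_critical hm le_rfl hc
  have hp0 : 0 < p := by linarith
  have hm' : (3 : ℝ) ≤ m := by exact_mod_cast hm
  obtain ⟨κ, ψ, M, hM, hκc, hκ0, hκl, hκr, hψ, hψ00, hcut⟩ := exists_cutoffs hp
  obtain ⟨-, hψp⟩ := hcut p le_rfl
  have hp' := Real.HolderConjugate.conjExponent hp
  have h1p : 1 / p < 1 := by
    rw [div_lt_one hp0]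
    exact hp
  obtain ⟨C₁, hC₁, hlog⟩ := growth_log m hR hp' (by linarith) hM.le hκc hκ0 hκl hκr hψp
  obtain ⟨C₃, hC₃, hdata⟩ := growth_data m hR hp' (by omega) hM.le hκc hκ0 hκl hκr hψp hψ00 hg₂ hg₂0
    hg₂R
  set β : ℝ := (m : ℝ) / 2 - 1 / p with hβ
  have hβ0 : 0 ≤ β := by linarith
  set e : ℝ := (m : ℝ) / 2 * p - m - 1 with he
  -- criticality, after division by `p + 1`
  have hexp : e + β = 0 := by
    have h1 : (p + 1) * (e + β) = 0 := by
      rw [he, hβ]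
      have h2 : p * (1 / p) = 1 := by field_simp
      linear_combination hc - h2
    exact (mul_eq_zero.1 h1).resolve_left (by linarith)
  obtain ⟨C, hC, hlife⟩ := lifespan_of_growth hκc hκ0 hκl hκr hψ hψp.nonneg hψp.eq_zero
    (c₁ := (C₃ * 2 ^ β)⁻¹) (c₂ := (2 ^ p * (C₁ * 2 ^ β))⁻¹) (ρ₀ := R + 2) (a := p)
    (K := p) (μ := p - 1) (by positivity) (by positivity) hp (by linarith) (by linarith)
  refine ⟨C, hC, fun ε hε hε1 T hT u v ut vt hsol => ?_⟩
  have h0 : (0 : ℝ) ∈ timeInterval T := ⟨le_rfl, by simpa using hT⟩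
  have hu := hsol.causal_u hp hp2
  have hv := hsol.causal_v
  have hvp := hsol.v_cont_Lp hp hp2
  have hu0 : 0 ≤ (u 0).fn := by
    rw [hsol.u_init]
    exact Lp_smul_nonneg hε.le hf₁
  have hv0 : 0 ≤ (v 0).fn := by
    rw [hsol.v_init]
    exact Lp_smul_nonneg hε.le hf₂
  have hut0 : 0 ≤ ut 0 := by
    rw [hsol.ut_init]
    exact Lp_smul_nonneg hε.le hg₁
  have hvt0 : 0 ≤ vt 0 := by
    rw [hsol.vt_init]
    exact Lp_smul_nonneg hε.le hg₂
  set b : ℝ → ℝ := fun s => ∫ x, |(u s).fn x| ^ p with hb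
  set d : ℝ → ℝ := fun s => ∫ x, |(v s).fn x| ^ p with hd
  have hb0 : ∀ s, 0 ≤ b s := fun s => integral_nonneg fun x => by positivity
  have hd0 : ∀ s, 0 ≤ d s := fun s => integral_nonneg fun x => by positivity
  have hbc : ContinuousOn b (timeInterval T) := continuousOn_integral_rpow hp.le hsol.u_cont_Lq
  have hdc : ContinuousOn d (timeInterval T) := continuousOn_integral_rpow hp.le hvp
  have hcancel {ρ : ℝ} (hρ : 0 < ρ) : ρ ^ e * ρ ^ β = 1 := by
    rw [← Real.rpow_add hρ, hexp, Real.rpow_zero]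
  have hwt : ContinuousOn (fun s : ℝ => (s + R + 1) ^ (-β)) (timeInterval T) :=
    ContinuousOn.rpow_const (by fun_prop) fun s hs => Or.inl (by linarith [hs.1])
  -- integrals on one scale are additive in the density
  have hadd (η f g : ℝ → ℝ) (hη : Continuous η) (hf : ContinuousOn f (timeInterval T))
      (hg : ContinuousOn g (timeInterval T)) (ρ : ℝ) (hρT : ρ ∈ timeInterval T) :
      ∫ s in (0 : ℝ)..ρ, η (s / ρ) * (f s + g s)
        = (∫ s in (0 : ℝ)..ρ, η (s / ρ) * f s) + ∫ s in (0 : ℝ)..ρ, η (s / ρ) * g s := by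
    have hsub := Icc_subset_timeInterval hρT
    rw [← uIcc_of_le hρT.1] at hsub
    have hη' : ContinuousOn (fun s => η (s / ρ)) (uIcc 0 ρ) :=
      (hη.comp (continuous_id.div_const ρ)).continuousOn
    refine Eq.trans ?_ (intervalIntegral.integral_add
      (hη'.mul (hf.mono hsub)).intervalIntegrable (hη'.mul (hg.mono hsub)).intervalIntegrable)
    refine intervalIntegral.integral_congr fun s _ => ?_
    simp only [mul_add]
  have hker (ρ : ℝ) (hρT : ρ ∈ timeInterval T) (hρ : R + 2 ≤ ρ) :=
    integral_kernel_le (f := fun s => b s + d s) hκc hκ0 hR hβ0 hρ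
      ((hbc.add hdc).mono (Icc_subset_timeInterval hρT)) fun s => add_nonneg (hb0 s) (hd0 s)
  have hI0 (f : ℝ → ℝ) (hf : ∀ s, 0 ≤ f s) (ρ : ℝ) (hρ : R + 2 ≤ ρ) :
      0 ≤ ∫ s in (0 : ℝ)..ρ, κ (s / ρ) * f s :=
    intervalIntegral.integral_nonneg (by linarith) fun s _ => mul_nonneg (hκ0 _) (hf s)
  have hfin := hlife ε hε hε1 hp0.le T (fun s => (s + R + 1) ^ (-β) * (b s + d s))
    (hwt.mul (hbc.add hdc))
    (fun s hs => mul_nonneg (Real.rpow_nonneg (by linarith [hs.1]) _)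
      (add_nonneg (hb0 s) (hd0 s)))
    (fun ρ hρT hρ => by
      have hρ0 : 0 < ρ := by linarith
      rw [inv_mul_le_iff₀ (by positivity)]
      have h1 := hdata T v vt _ p ε hp.le hv hvp hv0 hε hsol.vt_init ρ hρ hρT
      have h2 : ∫ s in (0 : ℝ)..ρ, κ (s / ρ) * d s
          ≤ ∫ s in (0 : ℝ)..ρ, κ (s / ρ) * (b s + d s) := by
        rw [hadd κ b d hκc hbc hdc ρ hρT]
        linarith [hI0 b hb0 ρ hρ]
      have h3 := h2.trans (hker ρ hρT hρ)
      refine h1.trans ((mul_le_mul_of_nonneg_left h3 (by positivity)).trans (le_of_eq ?_))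
      linear_combination (C₃ * 2 ^ β * ∫ s in (0 : ℝ)..ρ, κ (s / ρ) *
        ((s + R + 1) ^ (-β) * (b s + d s))) * hcancel hρ0)
    (fun ρ hρT hρ => by
      have hρ0 : 0 < ρ := by linarith
      have hl0 : 0 < Real.log ρ := Real.log_pos (by linarith)
      have h1 := hlog T v vt _ p hp.le hv hvp hv0 hvt0 ρ hρ hρT
      have h2 := hlog T u ut _ p hp.le hu hsol.u_cont_Lq hu0 hut0 ρ hρ hρT
      have hψc : Continuous ψ := hψp.contDiff.continuous
      have hW0 (f : ℝ → ℝ) (hf : ∀ s, 0 ≤ f s) :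
          0 ≤ ∫ s in (0 : ℝ)..ρ, ψ (s / ρ) * ((s + R + 1) ^ (-β) * f s) :=
        intervalIntegral.integral_nonneg hρ0.le fun s hs => mul_nonneg (hψp.nonneg _)
          (mul_nonneg (Real.rpow_nonneg (by linarith [hs.1]) _) (hf s))
      have hsplit : ∫ s in (0 : ℝ)..ρ, ψ (s / ρ) * ((s + R + 1) ^ (-β) * (b s + d s))
          = (∫ s in (0 : ℝ)..ρ, ψ (s / ρ) * ((s + R + 1) ^ (-β) * b s))
            + ∫ s in (0 : ℝ)..ρ, ψ (s / ρ) * ((s + R + 1) ^ (-β) * d s) := by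
        refine Eq.trans ?_ (hadd ψ (fun s => (s + R + 1) ^ (-β) * b s)
          (fun s => (s + R + 1) ^ (-β) * d s) hψc (hwt.mul hbc) (hwt.mul hdc) ρ hρT)
        simp only [mul_add]
      rw [hsplit]
      have hA := hW0 b hb0
      have hB := hW0 d hd0
      set A := ∫ s in (0 : ℝ)..ρ, ψ (s / ρ) * ((s + R + 1) ^ (-β) * b s)
      set B := ∫ s in (0 : ℝ)..ρ, ψ (s / ρ) * ((s + R + 1) ^ (-β) * d s)
      have hAB : (A + B) ^ p ≤ 2 ^ p * (A ^ p + B ^ p) := by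
        have hA' : 0 ≤ A ^ p := Real.rpow_nonneg hA _
        have hB' : 0 ≤ B ^ p := Real.rpow_nonneg hB _
        rcases le_total A B with h | h
        · calc (A + B) ^ p ≤ (2 * B) ^ p :=
                Real.rpow_le_rpow (by linarith) (by linarith) hp0.le
            _ = 2 ^ p * B ^ p := Real.mul_rpow (by norm_num) hB
            _ ≤ _ := by gcongr; linarith
        · calc (A + B) ^ p ≤ (2 * A) ^ p :=
                Real.rpow_le_rpow (by linarith) (by linarith) hp0.le
            _ = 2 ^ p * A ^ p := Real.mul_rpow (by norm_num) hA
            _ ≤ _ := by gcongr; linarith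
      have h3 := hker ρ hρT hρ
      rw [hadd κ b d hκc hbc hdc ρ hρT] at h3
      have h4 : A ^ p + B ^ p ≤ C₁ * Real.log ρ ^ (p - 1) * ρ ^ e *
          (2 ^ β * ρ ^ β * ∫ s in (0 : ℝ)..ρ, κ (s / ρ) * ((s + R + 1) ^ (-β) * (b s + d s))) := by
        refine le_trans ?_ (mul_le_mul_of_nonneg_left h3 (by positivity))
        rw [mul_add, add_comm (_ * _)]
        exact add_le_add h1 h2
      rw [mul_assoc, inv_mul_le_iff₀ (by positivity), Real.rpow_neg hl0.le, ← div_eq_mul_inv,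
        div_le_iff₀ (by positivity)]
      refine hAB.trans ((mul_le_mul_of_nonneg_left h4 (by positivity)).trans (le_of_eq ?_))
      linear_combination (2 ^ p * C₁ * Real.log ρ ^ (p - 1) * 2 ^ β *
        ∫ s in (0 : ℝ)..ρ, κ (s / ρ) * ((s + R + 1) ^ (-β) * (b s + d s))) * hcancel hρ0)
  have hlam : p * (p - 1) / (p - (p - 1)) = p * (p - 1) := by
    rw [sub_sub_cancel, div_one]
  rwa [hlam] at hfin

end critical

theorem theorem1p1 (n : ℕ) (hn : 4 ≤ n) (p q : ℝ) (hp : 1 < p) (hpq : p ≤ q)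
    (hF : criticalF p q n = 0) (R : ℝ) (hR : 0 < R)
    (f₁ f₂ : H1 n) (g₁ g₂ : L2 n)
    (hf₁q : MemLp (f₁.fn : Space n → ℝ) (ENNReal.ofReal q) volume)
    (hf₁R : VanishesOutside R f₁.fn) (hf₂R : VanishesOutside R f₂.fn)
    (hg₁R : VanishesOutside R g₁) (hg₂R : VanishesOutside R g₂)
    (hf₁ : 0 ≤ f₁.fn) (hf₂ : 0 ≤ f₂.fn) (hg₁ : 0 ≤ g₁) (hg₂ : 0 ≤ g₂)
    (hg₁0 : g₁ ≠ 0) (hg₂0 : g₂ ≠ 0) :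
    ∃ ε₀ : ℝ, 0 < ε₀ ∧ ∃ C : ℝ, 0 < C ∧
      ∀ ε : ℝ, 0 < ε → ε ≤ ε₀ →
        ∀ T : EReal, 0 < T →
          ∀ (u v : ℝ → H1 n) (ut vt : ℝ → L2 n),
            IsEnergySolution p q R ε f₁ f₂ g₁ g₂ T u v ut vt →
              (p ≠ q → T ≤ ((Real.exp (C * ε ^ (-(p * (p * q - 1)))) : ℝ) : EReal)) ∧
              (p = q → T ≤ ((Real.exp (C * ε ^ (-(p * (p - 1)))) : ℝ) : EReal)) := by

  obtain ⟨m, rfl⟩ : ∃ m, n = m + 1 := ⟨n - 1, by omega⟩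
  have hm : 3 ≤ m := by omega
  have hc := critical_identity hp hpq hF
  obtain ⟨C, hC, hne⟩ := lifespan_system hm hp hpq hc hR hg₂R hf₁ hf₂ hg₁ hg₂ hg₂0
  rcases eq_or_ne p q with rfl | hpq'
  · obtain ⟨C', hC', heq⟩ := lifespan_symmetric hm hp hc hR hg₂R hf₁ hf₂ hg₁ hg₂ hg₂0
    exact ⟨1, one_pos, C', hC', fun ε hε hε1 T hT u v ut vt h =>
      ⟨fun hh => absurd rfl hh, fun _ => heq ε hε hε1 T hT u v ut vt h⟩⟩
  · exact ⟨1, one_pos, C, hC, fun ε hε hε1 T hT u v ut vt h =>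
      ⟨fun _ => hne ε hε hε1 T hT u v ut vt h, fun hh => absurd hh hpq'⟩⟩
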